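/- Let $G$ be a real reductive Lie group: a Hausdorff topological group with finitely many connected components together with a finite covering $p:G\to p(G)$ onto a closed subgroup $p(G)\subset GL(n,\mathbb R)$ that is stable under transposition (so $G$ is a real reductive linear group when $p$ is injective). Put $K=p^{-1}(O(n))$ and let $\mathfrak g\subset M(n,\mathbb R)$ be the Lie algebra. Let $Q$ be a parabolic subgroup of $G$, i.e. for some symmetric $X\in\mathfrak g$, $$Q=\{g\in G:\ \lim_{t\to+\infty}e^{-tX}\,p(g)\,e^{tX}\ \text{exists in } M(n,\mathbb R)\},$$ let $H$ be a closed subgroup of $G$, and suppose that the real generalized flag variety $G/Q$ contains $m$ pairwise disjoint non-empty $H$-invariant open subsets. All finite-dimensional representations below are complex and continuous. For a finite-dimensional representation $(\zeta,W)$ of $Q$, let $L^2(G/Q;\zeta)$ be the Hilbert space of functions $f:G\to W$ with $f(gq)=\zeta(q)^{-1}f(g)$ for $g\in G$, $q\in Q$, whose restriction to $K$ is square integrable for the Haar measure of $K$, modulo equality almost everywhere on $K$. Let $E(G/Q;\zeta)$ be the $(\mathfrak g,K)$-module of $K$-finite smooth $f:G\to W$ with $f(gq)=\zeta(q)^{-1}f(g)$.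 For a finite-dimensional representation $(\tau,W_\tau)$ of $H$, let $C(G/H;\tau)$ be the space of continuous $f:G\to W_\tau$ with $f(gh)=\tau(h)^{-1}f(g)$, with the topology of uniform convergence on compact sets. $G$ acts on all these spaces by left translation, $\operatorname{Hom}_G$ denotes the continuous linear maps commuting with $G$, and $\operatorname{Hom}_H$ the linear maps commuting with $H$. Write $\Omega_{G/Q}$ for the character $q\mapsto|\det(\operatorname{Ad}_\#(q):\mathfrak g/\mathfrak q\to\mathfrak g/\mathfrak q)|^{-1}$ of $Q$, whose associated line bundle on $G/Q$ is the bundle of densities. 1. Suppose that $G/Q$ is connected. Let $\sigma$, $\tau$ be finite-dimensional representations of $G$, $H$, and let $\zeta$ be any finite-dimensional representation of $Q$ such that $\sigma$ is a quotient of the $(\mathfrak g,K)$-module $E(G/Q;\zeta)$. Then $$\dim\operatorname{Hom}_G\big(L^2(G/Q;\zeta),\,C(G/H;\tau)\big)\ \ge\ m\cdot\dim\operatorname{Hom}_H(\sigma|_H,\tau).$$ In particular this holds, for $\sigma$ irreducible, with $\zeta=\lambda(\sigma)$, the irreducible finite-dimensional representation of the Levi part of $Q$ (extended to $Q$ trivially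 on the unipotent radical) for which $\sigma$ is the unique irreducible quotient of $E(G/Q;\lambda(\sigma))$. 2. In particular (without assuming $G/Q$ connected), $\dim\operatorname{Hom}_G\big(L^2(G/Q,\Omega_{G/Q}),\,C(G/H)\big)\ge m$. -/

import Mathlib

open Topology Filter MeasureTheory
open scoped ContDiff

noncomputable section

namespace RealFlag

/-! ### Real reductive groups and parabolic subgroups -/

section Group

variable {n : ℕ} {G : Type*} [Group G]

/-- A real reductive group: a (Hausdorff) topological group `G` with finitely many connected
components, together with a homomorphism `p` onto a closed subgroup of `GL(n, ℝ)` stable under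
transposition, which is a finite covering of its image. For `p` injective, `G` is a real reductive
linear group. As `p` is a covering of a closed subgroup of `GL(n, ℝ)`, `G` is a Lie group. -/
structure IsRealReductive [TopologicalSpace G] (p : G →* GL (Fin n) ℝ) : Prop where
  continuous : Continuous p
  isOpenMap : IsOpenMap p.rangeRestrict
  finite_ker : Finite p.ker
  isClosed_range : IsClosed (p.range : Set (GL (Fin n) ℝ))
  transpose_mem : ∀ g : G, ∃ g' : G, (p g').val = (p g).val.transpose
  finite_components : Finite (ConnectedComponents G)

/-- The maximal compact subgroup `K = p⁻¹(O(n))`. -/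
def maxCompact (p : G →* GL (Fin n) ℝ) : Subgroup G where
  carrier := {g | (p g).val.transpose * (p g).val = 1}
  one_mem' := by simp
  mul_mem' := by
    intro a b ha hb
    simp only [Set.mem_ofPred_eq, map_mul, Units.val_mul, Matrix.transpose_mul] at *
    calc _ = (p b).val.transpose * ((p a).val.transpose * (p a).val) * (p b).val := by
            simp only [Matrix.mul_assoc]
      _ = 1 := by rw [ha, Matrix.mul_one, hb]
  inv_mem' := by
    intro a ha
    simp only [Set.mem_ofPred_eq, map_inv] at *
    have h : ((p a)⁻¹).val = (p a).val.transpose :=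
      Units.inv_eq_of_mul_eq_one_left ha
    rw [h, Matrix.transpose_transpose]
    exact mul_eq_one_comm.mp ha

instance [TopologicalSpace G] (p : G →* GL (Fin n) ℝ) : MeasurableSpace (maxCompact p) := borel _

instance [TopologicalSpace G] (p : G →* GL (Fin n) ℝ) : BorelSpace (maxCompact p) := ⟨rfl⟩

/-- The matrices `X` with `exp(tX) ∈ p(H)` for all real `t`. For a closed subgroup `H` of a real
reductive group this is the Lie algebra of `H`, regarded in `M(n, ℝ)` through the differential
of `p`. -/
def lieSet (p : G →* GL (Fin n) ℝ) (H : Subgroup G) : Set (Matrix (Fin n) (Fin n) ℝ) :=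
  {X | ∀ t : ℝ, ∃ h ∈ H, (p h).val = NormedSpace.exp (t • X)}

/-- The Lie algebra of `H` as a real vector space. (For closed `H` the set `lieSet p H` is already
a linear subspace; taking the span makes this part of the definition.) -/
def lieAlg (p : G →* GL (Fin n) ℝ) (H : Subgroup G) :
    Submodule ℝ (Matrix (Fin n) (Fin n) ℝ) :=
  Submodule.span ℝ (lieSet p H)

/-- `Q` is the parabolic subgroup determined by some hyperbolic element `X` of the Lie algebra of
`G`, taken in the symmetric part `𝔭` of the Cartan decomposition: `Q` consists of all `g` for which
`exp(-tX) g exp(tX)` has a limit as `t → +∞`. Its Levi part `L` is the centralizer of `X`, and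
its unipotent radical `N` corresponds to the elements with limit `1`; the Lie algebra of `Q` is the sum of the eigenspaces of `ad X` for the non-negative eigenvalues. -/
def IsParabolic (p : G →* GL (Fin n) ℝ) (Q : Subgroup G) : Prop :=
  ∃ X ∈ lieSet p ⊤, X.IsSymm ∧ ∀ g : G, g ∈ Q ↔
    ∃ l : Matrix (Fin n) (Fin n) ℝ,
      Tendsto (fun t : ℝ => NormedSpace.exp ((-t) • X) * (p g).val * NormedSpace.exp (t • X))
        atTop (𝓝 l)

/-! ### The density character -/

/-- Conjugation `X ↦ u X u⁻¹`. -/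
def conj (u : GL (Fin n) ℝ) : Matrix (Fin n) (Fin n) ℝ →ₗ[ℝ] Matrix (Fin n) (Fin n) ℝ :=
  LinearMap.mulLeft ℝ u.val ∘ₗ LinearMap.mulRight ℝ (u⁻¹).val

lemma conj_apply (u : GL (Fin n) ℝ) (X : Matrix (Fin n) (Fin n) ℝ) :
    conj u X = u.val * X * (u⁻¹).val := by
  simp [conj, Matrix.mul_assoc]

lemma conj_mem (p : G →* GL (Fin n) ℝ) (H : Subgroup G) {h : G} (hh : h ∈ H)
    {X : Matrix (Fin n) (Fin n) ℝ} (hX : X ∈ lieAlg p H) : conj (p h) X ∈ lieAlg p H := by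
  induction hX using Submodule.span_induction with
  | mem X hX =>
    refine Submodule.subset_span fun t => ?_
    obtain ⟨a, ha, hat⟩ := hX t
    refine ⟨h * a * h⁻¹, H.mul_mem (H.mul_mem hh ha) (H.inv_mem hh), ?_⟩
    have := Matrix.exp_units_conj (p h) (t • X)
    rw [← map_smul, conj_apply, this]
    simp [hat]
  | zero => simp
  | add X Y _ _ hX hY => rw [map_add]; exact add_mem hX hY
  | smul c X _ hX => rw [map_smul]; exact Submodule.smul_mem _ c hX

/-- The adjoint representation `Ad` of `G` on its Lie algebra. -/
def Ad (p : G →* GL (Fin n) ℝ) (g : G) : lieAlg p ⊤ →ₗ[ℝ] lieAlg p ⊤ :=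
  (conj (p g)).restrict fun _ hX => conj_mem p ⊤ (Subgroup.mem_top g) hX

/-- `Lie(H)` as a subspace of `Lie(G)`. -/
def lieSub (p : G →* GL (Fin n) ℝ) (H : Subgroup G) : Submodule ℝ (lieAlg p ⊤) :=
  (lieAlg p H).comap (lieAlg p ⊤).subtype

/-- The quotient `Ad_#` of the adjoint action of `H` on `Lie(G) / Lie(H)`. -/
def AdQuot (p : G →* GL (Fin n) ℝ) (H : Subgroup G) (h : H) :
    (lieAlg p ⊤ ⧸ lieSub p H) →ₗ[ℝ] (lieAlg p ⊤ ⧸ lieSub p H) :=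
  (lieSub p H).mapQ (lieSub p H) (Ad p h) fun _ hX => conj_mem p H h.2 hX

lemma AdQuot_one (p : G →* GL (Fin n) ℝ) (H : Subgroup G) : AdQuot p H 1 = LinearMap.id := by
  ext X
  simp [AdQuot, Ad, conj_apply, LinearMap.restrict_apply]

lemma AdQuot_mul (p : G →* GL (Fin n) ℝ) (H : Subgroup G) (a b : H) :
    AdQuot p H (a * b) = AdQuot p H a ∘ₗ AdQuot p H b := by
  ext X
  simp [AdQuot, Ad, conj_apply, LinearMap.restrict_apply, Matrix.mul_assoc]

/-- The character `χ_{G/H}(h) = |det(Ad_#(h) : 𝔤/𝔥 → 𝔤/𝔥)|⁻¹` as a representation of `H` on `ℂ`.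
The line bundle `G ×_H χ_{G/H}` is the bundle of densities on `G/H`. -/
def densityRep (p : G →* GL (Fin n) ℝ) (H : Subgroup G) : Representation ℂ H ℂ where
  toFun h := ((|LinearMap.det (AdQuot p H h)|⁻¹ : ℝ) : ℂ) • LinearMap.id
  map_one' := by
    rw [AdQuot_one]; ext; simp
  map_mul' a b := by
    rw [AdQuot_mul, LinearMap.det_comp, abs_mul, mul_inv, Complex.ofReal_mul]
    refine LinearMap.ext fun z => ?_
    simp only [LinearMap.smul_apply, Module.End.mul_apply, LinearMap.id_apply, smul_eq_mul,
      mul_assoc]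

end Group

/-! ### Representations on spaces of sections -/

section Sections

variable {n : ℕ} {G : Type*} [Group G] [TopologicalSpace G]
variable {W : Type*} [NormedAddCommGroup W]

/-- Continuity of a representation on a finite-dimensional space. -/
def IsContinuousRep {Γ V : Type*} [Group Γ] [TopologicalSpace Γ] [NormedAddCommGroup V]
    [NormedSpace ℂ V] (ρ : Representation ℂ Γ V) : Prop :=
  Continuous fun x : Γ × V => ρ x.1 x.2

/-- The left regular representation of `G` on functions, `(g · f)(x) = f(g⁻¹ x)`. -/
def leftReg [NormedSpace ℂ W] : Representation ℂ G (G → W) where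
  toFun g :=
    { toFun := fun f x => f (g⁻¹ * x)
      map_add' := fun _ _ => rfl
      map_smul' := fun _ _ => rfl }
  map_one' := by ext; simp
  map_mul' a b := by ext; simp [mul_assoc]

/-- Sections of `G ×_Q ζ` over `G/Q`, as functions `f : G → W` with `f(gq) = ζ(q)⁻¹ f(g)`. -/
def equivSections [NormedSpace ℂ W] {Q : Subgroup G} (ζ : Representation ℂ Q W) :
    Submodule ℂ (G → W) where
  carrier := {f | ∀ (g : G) (q : Q), f (g * q) = ζ q⁻¹ (f g)}
  add_mem' := by
    intro f f' hf hf' g q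
    simp [hf g q, hf' g q]
  zero_mem' := by intro g q; simp
  smul_mem' := by
    intro c f hf g q
    simp [hf g q]

/-- Square-integrable sections of `G ×_Q ζ` over `G/Q = K/(Q ∩ K)`, before identification of
sections that agree almost everywhere. Square-integrability refers to the Haar measure `μ` of the
compact group `K`. (It is imposed on all translates `x ↦ f(g x)`; by compactness of `G/Q` this
follows from the condition at `g = 1`.) -/
def sqIntSections [NormedSpace ℂ W] (p : G →* GL (Fin n) ℝ) (μ : Measure (maxCompact p))
    {Q : Subgroup G} (ζ : Representation ℂ Q W) : Submodule ℂ (G → W) where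
  carrier := {f | f ∈ equivSections ζ ∧ ∀ g : G, MemLp (fun k : maxCompact p => f (g * k)) 2 μ}
  add_mem' := fun hf hf' => ⟨add_mem hf.1 hf'.1, fun g => (hf.2 g).add (hf'.2 g)⟩
  zero_mem' := ⟨zero_mem _, fun _ => MemLp.zero'⟩
  smul_mem' := fun c _ hf => ⟨Submodule.smul_mem _ c hf.1, fun g => (hf.2 g).const_smul c⟩

/-- The action of `g ∈ G` on square-integrable sections, `(π(g) f)(x) = f(g⁻¹ x)`. -/
def sqIntAction [NormedSpace ℂ W] (p : G →* GL (Fin n) ℝ) (μ : Measure (maxCompact p))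
    {Q : Subgroup G} (ζ : Representation ℂ Q W) (g : G) :
    sqIntSections p μ ζ →ₗ[ℂ] sqIntSections p μ ζ :=
  (leftReg g).restrict fun f hf =>
    ⟨fun x q => by simpa [leftReg, mul_assoc] using hf.1 (g⁻¹ * x) q,
     fun x => by simpa [leftReg, mul_assoc] using hf.2 (g⁻¹ * x)⟩

/-- The almost-everywhere class in `L²(K; W)` of a square-integrable section. -/
def classL2 [NormedSpace ℂ W] (p : G →* GL (Fin n) ℝ) (μ : Measure (maxCompact p))
    {Q : Subgroup G} (ζ : Representation ℂ Q W) :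
    sqIntSections p μ ζ →ₗ[ℂ] Lp W 2 μ where
  toFun f := MemLp.toLp (fun k : maxCompact p => f.1 k) (by simpa using f.2.2 1)
  map_add' _ _ := rfl
  map_smul' _ _ := rfl

/-- The Hilbert space `L²(G/Q; ζ)`: square-integrable sections up to equality almost everywhere,
with the norm of `L²(K; W)`. Another inner product on `W` (for instance one invariant under
`Q ∩ K`, which makes the bundle Hermitian with `K`-invariant metric) or another multiple `μ` of the
Haar measure gives the same space with an equivalent norm. -/
def L2 [NormedSpace ℂ W] (p : G →* GL (Fin n) ℝ) (μ : Measure (maxCompact p))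
    {Q : Subgroup G} (ζ : Representation ℂ Q W) : Submodule ℂ (Lp W 2 μ) :=
  LinearMap.range (classL2 p μ ζ)

/-- The element of `L²(G/Q; ζ)` given by a square-integrable section. -/
def toL2 [NormedSpace ℂ W] (p : G →* GL (Fin n) ℝ) (μ : Measure (maxCompact p))
    {Q : Subgroup G} (ζ : Representation ℂ Q W) :
    sqIntSections p μ ζ →ₗ[ℂ] L2 p μ ζ :=
  (classL2 p μ ζ).rangeRestrict

/-- The space `C(G/H; τ)` of continuous sections, with the topology of uniform convergence on
compact sets. -/
def contSections [NormedSpace ℂ W] {H : Subgroup G} (τ : Representation ℂ H W) :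
    Submodule ℂ C(G, W) where
  carrier := {f | ∀ (g : G) (h : H), f (g * h) = τ h⁻¹ (f g)}
  add_mem' := by
    intro f f' hf hf' g h
    simp [hf g h, hf' g h]
  zero_mem' := by intro g h; simp
  smul_mem' := by
    intro c f hf g h
    simp [hf g h]

/-- The action of `g ∈ G` on `C(G/H; τ)`, `(g · f)(x) = f(g⁻¹ x)`. -/
def contAction [IsTopologicalGroup G] [NormedSpace ℂ W] {H : Subgroup G}
    (τ : Representation ℂ H W) (g : G) (f : contSections τ) : contSections τ :=
  ⟨f.1.comp ⟨fun x => g⁻¹ * x, by fun_prop⟩,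
   fun x h => by simpa [mul_assoc] using f.2 (g⁻¹ * x) h⟩

/-- `Hom_G(L²(G/Q; ζ), C(G/H; τ))`: continuous linear maps commuting with `G`. -/
def homG [IsTopologicalGroup G] [NormedSpace ℂ W] {W' : Type*} [NormedAddCommGroup W']
    [NormedSpace ℂ W'] (p : G →* GL (Fin n) ℝ) (μ : Measure (maxCompact p))
    {Q H : Subgroup G} (ζ : Representation ℂ Q W) (τ : Representation ℂ H W') :
    Submodule ℂ (L2 p μ ζ →L[ℂ] contSections τ) where
  carrier := {T | ∀ (g : G) (f : sqIntSections p μ ζ),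
    T (toL2 p μ ζ (sqIntAction p μ ζ g f)) = contAction τ g (T (toL2 p μ ζ f))}
  add_mem' := by
    intro S T hS hT g f
    rw [add_apply, hS g f, hT g f]; rfl
  zero_mem' := fun _ _ => rfl
  smul_mem' := by
    intro c T hT g f
    rw [smul_apply, hT g f]; rfl

/-- `Hom_H(σ|_H, τ)` for finite-dimensional `σ` and `τ`. -/
def homH {V W' : Type*} [NormedAddCommGroup V] [NormedSpace ℂ V] [NormedAddCommGroup W']
    [NormedSpace ℂ W'] {H : Subgroup G} (σ : Representation ℂ G V) (τ : Representation ℂ H W') :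
    Submodule ℂ (V →ₗ[ℂ] W') where
  carrier := {T | ∀ (h : H) (v : V), T (σ h v) = τ h (T v)}
  add_mem' := by
    intro S T hS hT h v
    simp [hS h v, hT h v]
  zero_mem' := by intro h v; simp
  smul_mem' := by
    intro c T hT h v
    simp [hT h v]

/-! ### The underlying `(𝔤, K)`-module -/

/-- Smoothness of `f : G → W`. As `p` is a local homeomorphism onto the embedded submanifold
`p(G)` of `M(n, ℝ)`, this says that `f` is locally the pull-back of a smooth function on an open
set of `M(n, ℝ)`. -/
def IsSmooth [NormedSpace ℂ W] (p : G →* GL (Fin n) ℝ) (f : G → W) : Prop :=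
  ∀ x : G, ∃ F : (Fin n → Fin n → ℝ) → W,
    ContDiffAt ℝ ∞ F (fun i j => (p x).val i j) ∧
      ∀ᶠ y in 𝓝 x, f y = F (fun i j => (p y).val i j)

/-- `f` is `K`-finite: its left translates by `K` lie in a finite-dimensional space. -/
def IsKFinite [NormedSpace ℂ W] (p : G →* GL (Fin n) ℝ) (f : G → W) : Prop :=
  ∃ F : Submodule ℂ (G → W), FiniteDimensional ℂ F ∧ ∀ k ∈ maxCompact p, leftReg k f ∈ F

/-- The space of the `(𝔤, K)`-module `E(G/Q; ζ)`: the `K`-finite smooth sections. -/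
def gkModule [NormedSpace ℂ W] (p : G →* GL (Fin n) ℝ) {Q : Subgroup G}
    (ζ : Representation ℂ Q W) : Submodule ℂ (G → W) where
  carrier := {f | f ∈ equivSections ζ ∧ IsSmooth p f ∧ IsKFinite p f}
  add_mem' := by
    rintro f f' ⟨hf, hs, F, hF, hk⟩ ⟨hf', hs', F', hF', hk'⟩
    refine ⟨add_mem hf hf', fun x => ?_, F ⊔ F', inferInstance, fun k hK => ?_⟩
    · obtain ⟨A, hA, hfA⟩ := hs x
      obtain ⟨A', hA', hfA'⟩ := hs' x
      refine ⟨A + A', hA.add hA', ?_⟩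
      filter_upwards [hfA, hfA'] with y hy hy'
      simp [hy, hy']
    · rw [map_add]
      exact add_mem (Submodule.mem_sup_left (hk k hK)) (Submodule.mem_sup_right (hk' k hK))
  zero_mem' := ⟨zero_mem _, fun x => ⟨0, contDiffAt_const, by simp⟩,
    ⊥, inferInstance, fun k _ => by simp⟩
  smul_mem' := by
    rintro c f ⟨hf, hs, F, hF, hk⟩
    refine ⟨Submodule.smul_mem _ c hf, fun x => ?_, F, hF, fun k hK => ?_⟩
    · obtain ⟨A, hA, hfA⟩ := hs x
      refine ⟨c • A, hA.const_smul c, ?_⟩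
      filter_upwards [hfA] with y hy
      simp [hy]
    · rw [map_smul]
      exact Submodule.smul_mem _ c (hk k hK)

/-- The finite-dimensional representation `σ` of `G` is a quotient of the `(𝔤, K)`-module
`E(G/Q; ζ)`: there is a surjective linear map `T : E(G/Q; ζ) → σ` which commutes with `K`, and with
the infinitesimal action of every one-parameter subgroup `γ` of `G`, that is, with `𝔤`. Here
`f' = k · f`, resp. `f' = d/dt|₀ f(γ(t)⁻¹ ·)`, is again an element of `E(G/Q; ζ)`. -/
def IsQuotientOfGKModule [NormedSpace ℂ W] {V : Type*} [NormedAddCommGroup V] [NormedSpace ℂ V]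
    (p : G →* GL (Fin n) ℝ) {Q : Subgroup G} (ζ : Representation ℂ Q W)
    (σ : Representation ℂ G V) : Prop :=
  ∃ T : gkModule p ζ →ₗ[ℂ] V, Function.Surjective T ∧
    (∀ k ∈ maxCompact p, ∀ f f' : gkModule p ζ,
      (∀ x : G, f'.1 x = f.1 (k⁻¹ * x)) → T f' = σ k (T f)) ∧
    (∀ γ : Multiplicative ℝ →ₜ* G, ∀ f f' : gkModule p ζ,
      (∀ x : G, HasDerivAt (fun t : ℝ => f.1 ((γ (Multiplicative.ofAdd t))⁻¹ * x)) (f'.1 x) 0) →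
      HasDerivAt (fun t : ℝ => σ (γ (Multiplicative.ofAdd t)) (T f)) (T f') 0)

end Sections

end RealFlag

end

/-!
Intertwining operators from `L²(G/Q; ζ)` to `C(G/H; τ)` are obtained by cutting off sections along
`H`-invariant open sets. Let `J` be a `G`-equivariant functional on sections of `G ×_Q ζ` with values
in `σ`, of the form `J(f) = ∫_K Θ(k) f(k) dk` with `Θ` continuous, let `U ⊆ G/Q` be open and
`H`-invariant, and let `A ∈ Hom_H(σ, τ)`. Then `f ↦ (g ↦ A (J (1_U · g⁻¹f)))` is such an operator
(`IsParabolic.exists_mem_homG`): the equivariance under `H` holds because multiplication by `1_U`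
commutes with `H`. Disjoint sets `U` with `J(1_U ·)` onto `σ` and a basis of `Hom_H(σ, τ)` give
linearly independent operators (`IsParabolic.le_rank_homG`).

The surjectivity of `J(1_U ·)` for connected `G/Q` is `IsParabolic.localRange_eq_top`. The range
`V(N)` of `J` on sections supported in an open set `N` satisfies `V(gN) = σ(g) V(N)`. If `V(N)` has
minimal dimension among the non-empty open sets, then it does not change when `N` shrinks, so, by
connectedness, it is the same for a covering of `G/Q` by translates of `N`. As `G/Q` is compact, it is
then the whole range of `J`, and by minimality all `V(N)` are the whole of `σ`.

The functional `J` comes from the quotient map of the `(𝔤, K)`-module `E(G/Q; ζ)` onto `σ`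
(`IsParabolic.exists_equivariant_pairing`). By its `K`-equivariance, this map is determined by its
values on the convolutions with one representative function of `K`. They form a finite-dimensional
space, on which every linear map is a combination of values at points, and this gives a continuous
kernel `Θ` on `K` (`IsParabolic.exists_pairing`). For smooth sections the equivariance under `𝔤`
integrates to one-parameter subgroups, and these generate `G` together with `K` by the polar
decomposition (`IsRealReductive.exists_polar`); continuous sections are approximated by convolutions
with representative functions of `K`, by the Peter–Weyl theorem (`denseRange_representative`,
`IsParabolic.pairing_leftReg`).

For the bundle of densities, `J` is
integration over `K`: the integral of a Lie derivative vanishes (`IsParabolic.integral_lieDeriv`), so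
that the integral is invariant under `G` (`IsParabolic.integral_density`). In that case `J` is
positive on the `K`-invariant density cut off to any non-empty open set, and no connectedness is
needed.

The extension to square integrable sections rests on a bound of translation by `G` in the `L¹`
norm over `K`. The norm of a section is comparable to a density, whose integral is
invariant, and continuous sections are dense (`IsParabolic.exists_integral_norm_le`).
The structure of `G` enters through `G = KQ` (`IsParabolic.exists_eq_mul`) and
through smooth coordinates adapted to `𝔤 = 𝔨 + 𝔮`, in which continuous `K`-finite sections are smooth
(`IsParabolic.isSmooth_of_isKFinite`).
-/

open Topology Filter MeasureTheory
open scoped ContDiff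

noncomputable section

namespace RealFlag

open scoped Matrix.Norms.Operator

/-! ### Powers of elements close to one -/

/-- If `a → 0` and `m • a → S`, then `(1 + a) ^ m → exp S`: this is `exp (m • log (1 + a))` for the
local inverse `log` of the exponential. -/
theorem tendsto_one_add_pow {𝔸 ι : Type*} [NormedRing 𝔸] [NormedAlgebra ℝ 𝔸] [CompleteSpace 𝔸]
    {l : Filter ι} {a : ι → 𝔸} {m : ι → ℕ} {S : 𝔸} (ha : Tendsto a l (𝓝 0))
    (h : Tendsto (fun i => (m i : ℝ) • a i) l (𝓝 S)) :
    Tendsto (fun i => (1 + a i) ^ m i) l (𝓝 (NormedSpace.exp S)) := by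
  have hs : HasStrictFDerivAt (NormedSpace.exp : 𝔸 → 𝔸)
      ((ContinuousLinearEquiv.refl ℝ 𝔸 : 𝔸 ≃L[ℝ] 𝔸) : 𝔸 →L[ℝ] 𝔸) 0 := hasStrictFDerivAt_exp_zero
  set L := hs.localInverse NormedSpace.exp _ 0 with hL
  have hL1 : L 1 = 0 := by
    have := hs.localInverse_apply_image
    rwa [NormedSpace.exp_zero] at this
  have hLd : HasFDerivAt L (ContinuousLinearMap.id ℝ 𝔸) (1 : 𝔸) := by
    have := hs.to_localInverse.hasFDerivAt
    rw [NormedSpace.exp_zero] at this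
    exact this
  have hLr : ∀ᶠ y in 𝓝 (1 : 𝔸), NormedSpace.exp (L y) = y := by
    have := hs.eventually_right_inverse
    rwa [NormedSpace.exp_zero] at this
  have h1 : Tendsto (fun i => 1 + a i) l (𝓝 1) := by simpa using ha.const_add 1
  have hlo : (fun i => L (1 + a i) - a i) =o[l] a := by
    have := (hasFDerivAt_iff_isLittleO_nhds_zero.1 hLd).comp_tendsto ha
    refine this.congr_left fun i => ?_
    simp [hL1]
  have hm : Tendsto (fun i => (m i : ℝ) • L (1 + a i)) l (𝓝 S) := by
    have h2 : (fun i => (m i : ℝ) • (L (1 + a i) - a i)) =o[l] fun i => (m i : ℝ) • a i :=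
      (Asymptotics.isBigO_refl _ _).smul_isLittleO hlo
    have h3 : Tendsto (fun i => (m i : ℝ) • (L (1 + a i) - a i)) l (𝓝 0) := by
      have := h2.trans_isBigO (h.isBigO_one ℝ)
      exact (Asymptotics.isLittleO_one_iff ℝ).1 this
    have := h3.add h
    rw [zero_add] at this
    refine this.congr fun i => ?_
    rw [← smul_add, sub_add_cancel]
  have hexp : Continuous (NormedSpace.exp : 𝔸 → 𝔸) := by
    let _ : NormedAlgebra ℚ 𝔸 := NormedAlgebra.restrictScalars ℚ ℝ 𝔸
    exact NormedSpace.exp_continuous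
  refine ((hexp.tendsto S).comp hm).congr' ?_
  filter_upwards [h1.eventually hLr] with i hi
  let _ : NormedAlgebra ℚ 𝔸 := NormedAlgebra.restrictScalars ℚ ℝ 𝔸
  simp only [Function.comp_apply]
  rw [Nat.cast_smul_eq_nsmul, NormedSpace.exp_nsmul, hi]

theorem lieSet_smul {n : ℕ} {G : Type*} [Group G] {p : G →* GL (Fin n) ℝ} {Γ : Subgroup G}
    {A : Matrix (Fin n) (Fin n) ℝ}
    (hA : A ∈ lieSet p Γ) (c : ℝ) : c • A ∈ lieSet p Γ := by
  intro t
  obtain ⟨x, hx, h⟩ := hA (t * c)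
  exact ⟨x, hx, by rw [h, smul_smul]⟩

section Group

variable {n : ℕ} {G : Type*} [Group G] [TopologicalSpace G]

theorem tendsto_GL_iff {ι : Type*} {l : Filter ι} {g : ι → GL (Fin n) ℝ} {u : GL (Fin n) ℝ} :
    Tendsto g l (𝓝 u) ↔ Tendsto (fun i => (g i).val) l (𝓝 u.val) :=
  (Units.isOpenEmbedding_val (R := Matrix (Fin n) (Fin n) ℝ)).isInducing.tendsto_nhds_iff

theorem IsRealReductive.continuous_val {p : G →* GL (Fin n) ℝ} (hp : IsRealReductive p) :
    Continuous fun g => (p g).val :=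
  Units.continuous_val.comp hp.continuous

/-- `p` is a proper map: a net whose image converges has a cluster point. -/
theorem IsRealReductive.exists_mapClusterPt [IsTopologicalGroup G] {p : G →* GL (Fin n) ℝ}
    (hp : IsRealReductive p)
    {ι : Type*} {l : Filter ι} [l.NeBot] {g : ι → G} {u : GL (Fin n) ℝ}
    (h : Tendsto (fun i => (p (g i)).val) l (𝓝 u.val)) :
    ∃ x : G, p x = u ∧ MapClusterPt x l g := by
  have hu : Tendsto (fun i => p (g i)) l (𝓝 u) := tendsto_GL_iff.2 h
  have hmem : u ∈ (p.range : Set (GL (Fin n) ℝ)) :=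
    hp.isClosed_range.mem_of_tendsto hu (Eventually.of_forall fun i => ⟨g i, rfl⟩)
  obtain ⟨x, rfl⟩ := hmem
  by_contra! hcon
  -- Along an ultrafilter, `g` leaves some neighbourhood of each of the finitely many points of the
  -- fibre of `x`; this contradicts that `p` is open onto its image.
  let U : Ultrafilter ι := Ultrafilter.of l
  have hUl : (U : Filter ι) ≤ l := Ultrafilter.of_le l
  have hz : ∀ z : p.ker, ∃ N ∈ 𝓝 (x * (z : G)), ∀ᶠ i in (U : Filter ι), g i ∉ N := by
    intro z
    have h1 : ¬ MapClusterPt (x * (z : G)) l g := by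
      apply hcon
      rw [map_mul, z.2, mul_one]
    have h2 : ¬ Tendsto g (U : Filter ι) (𝓝 (x * (z : G))) := fun h2 =>
      h1 (MapClusterPt.mono h2.mapClusterPt hUl)
    rw [Filter.tendsto_def] at h2
    push Not at h2
    obtain ⟨N, hN, hNU⟩ := h2
    exact ⟨N, hN, Ultrafilter.eventually_not.2 hNU⟩
  choose N hN hNU using hz
  have := hp.finite_ker
  have hN1 : (⋂ z : p.ker, (fun y => y * (z : G)) ⁻¹' N z) ∈ 𝓝 x := by
    rw [Filter.iInter_mem]
    intro z
    exact (continuous_mul_const (z : G)).continuousAt.preimage_mem_nhds (hN z)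
  have hN2 := hp.isOpenMap.image_mem_nhds hN1
  have hu2 : Tendsto (fun i => p.rangeRestrict (g i)) (U : Filter ι) (𝓝 (p.rangeRestrict x)) := by
    rw [tendsto_subtype_rng]
    exact hu.mono_left hUl
  obtain ⟨i, hi1, hi2⟩ := ((hu2.eventually hN2).and (eventually_all.2 hNU)).exists
  obtain ⟨y, hy, hyg⟩ := hi1
  have hyg' : p y = p (g i) := congrArg Subtype.val hyg
  have hk : y⁻¹ * g i ∈ p.ker := by
    rw [MonoidHom.mem_ker, map_mul, map_inv, hyg', inv_mul_cancel]
  refine hi2 ⟨_, hk⟩ ?_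
  have := Set.mem_iInter.1 hy ⟨_, hk⟩
  simpa using this

theorem IsRealReductive.exists_mem_of_tendsto [IsTopologicalGroup G] {p : G →* GL (Fin n) ℝ}
    (hp : IsRealReductive p) {Γ : Subgroup G} (hΓ : IsClosed (Γ : Set G))
    {ι : Type*} {l : Filter ι} [l.NeBot] {g : ι → G} (hg : ∀ᶠ i in l, g i ∈ Γ)
    {u : GL (Fin n) ℝ} (h : Tendsto (fun i => (p (g i)).val) l (𝓝 u.val)) :
    ∃ x ∈ Γ, p x = u := by
  obtain ⟨x, hx, hc⟩ := hp.exists_mapClusterPt h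
  exact ⟨x, isClosed_iff_clusterPt.1 hΓ x (ClusterPt.mono hc (le_principal_iff.2 hg)), hx⟩

/-- The exponential of a matrix, as an invertible matrix. -/
def expGL (A : Matrix (Fin n) (Fin n) ℝ) : GL (Fin n) ℝ :=
  ⟨NormedSpace.exp A, NormedSpace.exp (-A), by
    rw [← Matrix.exp_add_of_commute _ _ (Commute.refl A).neg_right, add_neg_cancel,
      NormedSpace.exp_zero], by
    rw [← Matrix.exp_add_of_commute _ _ (Commute.refl A).neg_left, neg_add_cancel,
      NormedSpace.exp_zero]⟩

@[simp] theorem expGL_val (A : Matrix (Fin n) (Fin n) ℝ) :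
    (expGL A).val = NormedSpace.exp A := rfl

theorem expGL_inv (A : Matrix (Fin n) (Fin n) ℝ) : (expGL A)⁻¹ = expGL (-A) := by
  ext1; rfl

theorem expGL_add_smul (s t : ℝ) (A : Matrix (Fin n) (Fin n) ℝ) :
    expGL ((s + t) • A) = expGL (s • A) * expGL (t • A) := by
  ext1
  rw [add_smul]
  exact Matrix.exp_add_of_commute _ _ (((Commute.refl A).smul_left s).smul_right t)

/-- A limit of secant directions of a closed subgroup at the identity is in its Lie algebra. -/
theorem IsRealReductive.mem_lieSet_of_tendsto [IsTopologicalGroup G] {p : G →* GL (Fin n) ℝ}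
    (hp : IsRealReductive p) {Γ : Subgroup G} (hΓ : IsClosed (Γ : Set G))
    {ι : Type*} {l : Filter ι} [l.NeBot] {g : ι → G} (hg : ∀ᶠ i in l, g i ∈ Γ)
    {r : ι → ℝ} (hr : ∀ᶠ i in l, 0 ≤ r i) {S : Matrix (Fin n) (Fin n) ℝ}
    (h1 : Tendsto (fun i => (p (g i)).val) l (𝓝 1))
    (h2 : Tendsto (fun i => r i • ((p (g i)).val - 1)) l (𝓝 S)) : S ∈ lieSet p Γ := by
  have ha : Tendsto (fun i => (p (g i)).val - 1) l (𝓝 0) := by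
    simpa using h1.sub_const 1
  have key : ∀ t : ℝ, 0 ≤ t → ∃ x ∈ Γ, p x = expGL (t • S) := by
    intro t ht
    -- The powers `g i ^ ⌊t (r i)⌋` have `exp(tS)` as limit of their images.
    have hm : Tendsto (fun i => ((⌊t * r i⌋₊ : ℕ) : ℝ) • ((p (g i)).val - 1)) l (𝓝 (t • S)) := by
      have h3 : Tendsto (fun i => (((⌊t * r i⌋₊ : ℕ) : ℝ) - t * r i) • ((p (g i)).val - 1)) l
          (𝓝 0) := by
        refine squeeze_zero_norm' ?_ (by simpa using ha.norm)
        filter_upwards [hr] with i hi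
        rw [norm_smul]
        refine mul_le_of_le_one_left (norm_nonneg _) ?_
        rw [Real.norm_eq_abs, abs_le]
        have h0 : 0 ≤ t * r i := mul_nonneg ht hi
        constructor
        · have := Nat.lt_floor_add_one (t * r i); linarith
        · have := Nat.floor_le h0; linarith
      have := h3.add (h2.const_smul t)
      rw [zero_add] at this
      refine this.congr fun i => ?_
      rw [smul_smul, ← add_smul, sub_add_cancel]
    have hpow := tendsto_one_add_pow ha hm
    refine hp.exists_mem_of_tendsto hΓ (g := fun i => g i ^ ⌊t * r i⌋₊) (l := l) ?_ ?_
    · filter_upwards [hg] with i hi using Γ.pow_mem hi _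
    · refine hpow.congr fun i => ?_
      simp
  intro t
  rcases le_total 0 t with ht | ht
  · obtain ⟨x, hx, hxt⟩ := key t ht
    exact ⟨x, hx, by rw [hxt]; rfl⟩
  · obtain ⟨x, hx, hxt⟩ := key (-t) (by linarith)
    refine ⟨x⁻¹, Γ.inv_mem hx, ?_⟩
    rw [map_inv, hxt, expGL_inv]
    simp

theorem hasDerivAt_exp_smul_zero (A : Matrix (Fin n) (Fin n) ℝ) :
    HasDerivAt (fun t : ℝ => NormedSpace.exp (t • A)) A 0 := by
  have := hasDerivAt_exp_smul_const (𝕂 := ℝ) A 0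
  rw [zero_smul, NormedSpace.exp_zero, one_mul] at this
  exact this

theorem hasDerivAt_exp_smul (A : Matrix (Fin n) (Fin n) ℝ) (t : ℝ) :
    HasDerivAt (fun t : ℝ => NormedSpace.exp (t • A)) (NormedSpace.exp (t • A) * A) t :=
  hasDerivAt_exp_smul_const (𝕂 := ℝ) A t

/-- For a closed subgroup the set `lieSet` is closed under addition: the product of two
one-parameter groups has the sum of the generators as velocity at the identity. -/
theorem IsRealReductive.lieSet_add [IsTopologicalGroup G] {p : G →* GL (Fin n) ℝ}
    (hp : IsRealReductive p) {Γ : Subgroup G} (hΓ : IsClosed (Γ : Set G))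
    {A B : Matrix (Fin n) (Fin n) ℝ} (hA : A ∈ lieSet p Γ) (hB : B ∈ lieSet p Γ) :
    A + B ∈ lieSet p Γ := by
  choose x hx hxA using hA
  choose y hy hyB using hB
  have hd : HasDerivAt (fun t : ℝ => NormedSpace.exp (t • A) * NormedSpace.exp (t • B))
      (A + B) 0 := by
    have := HasDerivAt.mul (𝔸 := Matrix (Fin n) (Fin n) ℝ) (hasDerivAt_exp_smul_zero A)
      (hasDerivAt_exp_smul_zero B)
    rw [zero_smul, zero_smul, NormedSpace.exp_zero, one_mul, mul_one] at this
    exact this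
  have hs := hd.tendsto_slope
  have hl : (𝓝[>] (0 : ℝ)) ≤ 𝓝[≠] 0 := nhdsWithin_mono _ fun t ht => ne_of_gt ht
  refine hp.mem_lieSet_of_tendsto hΓ (l := 𝓝[>] (0 : ℝ)) (g := fun t => x t * y t)
    (r := fun t => t⁻¹) (Eventually.of_forall fun t => Γ.mul_mem (hx t) (hy t)) ?_ ?_ ?_
  · filter_upwards [self_mem_nhdsWithin] with t ht
    exact inv_nonneg.2 (le_of_lt ht)
  · have := hd.continuousAt.tendsto.mono_left (nhdsWithin_le_nhds (s := Set.Ioi 0))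
    simp only [zero_smul, NormedSpace.exp_zero, mul_one] at this
    refine this.congr fun t => ?_
    rw [map_mul, Units.val_mul, hxA, hyB]
  · refine (hs.mono_left hl).congr fun t => ?_
    rw [slope_def_module, map_mul, Units.val_mul, hxA, hyB]
    simp

theorem IsRealReductive.mem_lieAlg [IsTopologicalGroup G] {p : G →* GL (Fin n) ℝ}
    (hp : IsRealReductive p) {Γ : Subgroup G} (hΓ : IsClosed (Γ : Set G))
    {A : Matrix (Fin n) (Fin n) ℝ} : A ∈ lieAlg p Γ ↔ A ∈ lieSet p Γ := by
  refine ⟨fun h => ?_, fun h => Submodule.subset_span h⟩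
  induction h using Submodule.span_induction with
  | mem _ h => exact h
  | zero => exact fun t => ⟨1, Γ.one_mem, by simp [NormedSpace.exp_zero]⟩
  | add _ _ _ _ h1 h2 => exact hp.lieSet_add hΓ h1 h2
  | smul c _ _ h => exact lieSet_smul h c

end Group

/-! ### Entrywise multipliers in an orthonormal eigenbasis -/

section Multiplier

variable {n : ℕ}

/-- Multiplication of the entries of a matrix, read in the basis given by `U`, by weights `w`. -/
def entryMul (U : Matrix (Fin n) (Fin n) ℝ) (w : Fin n → Fin n → ℝ) :
    Matrix (Fin n) (Fin n) ℝ →ₗ[ℝ] Matrix (Fin n) (Fin n) ℝ where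
  toFun A := U * Matrix.of (fun i j => w i j * (U.transpose * A * U) i j) * U.transpose
  map_add' A B := by
    rw [← add_mul, ← mul_add]
    congr 2
    ext i j
    simp [mul_add, add_mul]
  map_smul' c A := by
    rw [RingHom.id_apply, ← smul_mul_assoc, ← mul_smul_comm]
    congr 2
    ext i j
    simp [mul_left_comm]

theorem transpose_entryMul_apply {U : Matrix (Fin n) (Fin n) ℝ} (hU : U.transpose * U = 1)
    (w : Fin n → Fin n → ℝ) (A : Matrix (Fin n) (Fin n) ℝ) :
    U.transpose * entryMul U w A * U =
      Matrix.of fun i j => w i j * (U.transpose * A * U) i j := by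
  simp only [entryMul, LinearMap.coe_mk, AddHom.coe_mk]
  calc _ = (U.transpose * U) * Matrix.of (fun i j => w i j * (U.transpose * A * U) i j) *
        (U.transpose * U) := by simp only [mul_assoc]
    _ = _ := by rw [hU, one_mul, mul_one]

theorem eq_of_conj_eq {U A B : Matrix (Fin n) (Fin n) ℝ} (hU : U.transpose * U = 1)
    (h : U.transpose * A * U = U.transpose * B * U) : A = B := by
  have hU' : U * U.transpose = 1 := mul_eq_one_comm.1 hU
  calc A = (U * U.transpose) * A * (U * U.transpose) := by rw [hU', one_mul, mul_one]
    _ = U * (U.transpose * A * U) * U.transpose := by simp only [mul_assoc]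
    _ = (U * U.transpose) * B * (U * U.transpose) := by rw [h]; simp only [mul_assoc]
    _ = B := by rw [hU', one_mul, mul_one]

theorem entryMul_eq_iff {U : Matrix (Fin n) (Fin n) ℝ} (hU : U.transpose * U = 1)
    {w : Fin n → Fin n → ℝ} {A B : Matrix (Fin n) (Fin n) ℝ} :
    entryMul U w A = B ↔
      ∀ i j, w i j * (U.transpose * A * U) i j = (U.transpose * B * U) i j := by
  refine ⟨fun h i j => ?_, fun h => eq_of_conj_eq hU ?_⟩
  · rw [← h, transpose_entryMul_apply hU]; rfl
  · rw [transpose_entryMul_apply hU]; ext i j; exact h i j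

/-- A subspace stable under the multiplier `w` is stable under the multiplier `φ ∘ w` for every
function `φ`, since on the finitely many values of `w` the function `φ` is a polynomial. -/
theorem entryMul_comp_mem {U : Matrix (Fin n) (Fin n) ℝ} (hU : U.transpose * U = 1)
    {𝔤 : Submodule ℝ (Matrix (Fin n) (Fin n) ℝ)} {w : Fin n → Fin n → ℝ}
    (hw : ∀ A ∈ 𝔤, entryMul U w A ∈ 𝔤) (φ : ℝ → ℝ) :
    ∀ A ∈ 𝔤, entryMul U (fun i j => φ (w i j)) A ∈ 𝔤 := by
  let S : Subalgebra ℝ (Fin n → Fin n → ℝ) :=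
    { carrier := {w | ∀ A ∈ 𝔤, entryMul U w A ∈ 𝔤}
      mul_mem' := by
        intro v v' hv hv' A hA
        have : entryMul U (v * v') A = entryMul U v (entryMul U v' A) := by
          rw [entryMul_eq_iff hU]
          intro i j
          rw [transpose_entryMul_apply hU, transpose_entryMul_apply hU]
          simp [mul_assoc]
        rw [this]
        exact hv _ (hv' _ hA)
      add_mem' := by
        intro v v' hv hv' A hA
        have : entryMul U (v + v') A = entryMul U v A + entryMul U v' A := by
          rw [entryMul_eq_iff hU]
          intro i j
          rw [mul_add, add_mul, transpose_entryMul_apply hU, transpose_entryMul_apply hU]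
          simp [add_mul]
        rw [this]
        exact 𝔤.add_mem (hv _ hA) (hv' _ hA)
      algebraMap_mem' := by
        intro r A hA
        have : entryMul U (algebraMap ℝ (Fin n → Fin n → ℝ) r) A = r • A := by
          rw [entryMul_eq_iff hU]
          intro i j
          simp
        rw [this]
        exact 𝔤.smul_mem _ hA }
  let s : Finset ℝ := Finset.univ.image fun ij : Fin n × Fin n => w ij.1 ij.2
  let P := Lagrange.interpolate s id φ
  have hP : Polynomial.aeval w P ∈ S :=
    Algebra.adjoin_le (S := S) (s := {w}) (Set.singleton_subset_iff.2 hw)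
      (Polynomial.aeval_mem_adjoin_singleton ℝ w)
  have hPw : Polynomial.aeval w P = fun i j => φ (w i j) := by
    ext i j
    have h1 : Polynomial.aeval w P i j = Polynomial.eval (w i j) P := by
      have := Polynomial.aeval_algHom_apply
        ((Pi.evalAlgHom ℝ (fun _ : Fin n => ℝ) j).comp
          (Pi.evalAlgHom ℝ (fun _ : Fin n => Fin n → ℝ) i)) w P
      rw [← Polynomial.coe_aeval_eq_eval]
      exact this.symm
    rw [h1]
    exact Lagrange.eval_interpolate_at_node φ (Set.injOn_id _)
      (Finset.mem_image.2 ⟨(i, j), Finset.mem_univ _, rfl⟩)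
  rw [hPw] at hP
  exact hP

theorem exists_orthogonal_diagonal {X : Matrix (Fin n) (Fin n) ℝ} (hX : X.IsSymm) :
    ∃ (U : Matrix (Fin n) (Fin n) ℝ) (d : Fin n → ℝ), U.transpose * U = 1 ∧
      X = U * Matrix.diagonal d * U.transpose := by
  have hH : X.IsHermitian := by
    rw [Matrix.IsHermitian, Matrix.conjTranspose_eq_transpose_of_trivial]; exact hX
  refine ⟨hH.eigenvectorUnitary, hH.eigenvalues, ?_, ?_⟩
  · have := Unitary.coe_star_mul_self hH.eigenvectorUnitary
    rwa [Matrix.star_eq_conjTranspose, Matrix.conjTranspose_eq_transpose_of_trivial] at this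
  · have := hH.spectral_theorem
    rw [Unitary.conjStarAlgAut_apply, Matrix.star_eq_conjTranspose,
      Matrix.conjTranspose_eq_transpose_of_trivial] at this
    exact this

theorem exp_smul_diagonalized {U : Matrix (Fin n) (Fin n) ℝ} (hU : U.transpose * U = 1)
    (d : Fin n → ℝ) (t : ℝ) :
    NormedSpace.exp (t • (U * Matrix.diagonal d * U.transpose)) =
      U * Matrix.diagonal (fun i => Real.exp (t * d i)) * U.transpose := by
  have hU' : U * U.transpose = 1 := mul_eq_one_comm.1 hU
  have hi : U⁻¹ = U.transpose := Matrix.inv_eq_right_inv hU'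
  have h1 : t • (U * Matrix.diagonal d * U.transpose) =
      U * Matrix.diagonal (fun i => t * d i) * U⁻¹ := by
    rw [hi, ← smul_mul_assoc, ← mul_smul_comm]
    congr 2
    ext i j
    simp [Matrix.diagonal_apply]
  rw [h1, Matrix.exp_conj _ _ ⟨⟨U, U.transpose, hU', hU⟩, rfl⟩, Matrix.exp_diagonal, hi]
  congr 3
  ext i
  rw [Pi.exp_def, Real.exp_eq_exp_ℝ]

/-- Conjugation by a diagonalizable one-parameter group is an entrywise multiplier. -/
theorem exp_conj_eq_entryMul {U : Matrix (Fin n) (Fin n) ℝ} (hU : U.transpose * U = 1)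
    (d : Fin n → ℝ) (t : ℝ) (A : Matrix (Fin n) (Fin n) ℝ) :
    NormedSpace.exp ((-t) • (U * Matrix.diagonal d * U.transpose)) * A *
      NormedSpace.exp (t • (U * Matrix.diagonal d * U.transpose)) =
      entryMul U (fun i j => Real.exp (t * (d j - d i))) A := by
  symm
  rw [entryMul_eq_iff hU, exp_smul_diagonalized hU, exp_smul_diagonalized hU]
  intro i j
  have : U.transpose * (U * Matrix.diagonal (fun i => Real.exp (-t * d i)) * U.transpose * A *
      (U * Matrix.diagonal (fun i => Real.exp (t * d i)) * U.transpose)) * U =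
      Matrix.diagonal (fun i => Real.exp (-t * d i)) * (U.transpose * A * U) *
        Matrix.diagonal (fun i => Real.exp (t * d i)) := by
    calc _ = (U.transpose * U) * Matrix.diagonal (fun i => Real.exp (-t * d i)) *
        (U.transpose * A * U) * Matrix.diagonal (fun i => Real.exp (t * d i)) *
          (U.transpose * U) := by simp only [mul_assoc]
      _ = _ := by rw [hU, one_mul, mul_one]
  rw [this, Matrix.mul_diagonal, Matrix.diagonal_mul,
    show t * (d j - d i) = -t * d i + t * d j by ring, Real.exp_add]
  ring

/-- `exp(-tX) A exp(tX)` converges exactly when, in an eigenbasis of `X`, the entries of `A` which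
would grow are zero. -/
theorem exists_tendsto_conj_iff {U : Matrix (Fin n) (Fin n) ℝ} (hU : U.transpose * U = 1)
    (d : Fin n → ℝ) (A : Matrix (Fin n) (Fin n) ℝ) :
    (∃ l, Tendsto (fun t : ℝ => NormedSpace.exp ((-t) • (U * Matrix.diagonal d * U.transpose)) * A *
      NormedSpace.exp (t • (U * Matrix.diagonal d * U.transpose))) atTop (𝓝 l)) ↔
      (U.transpose * A * U).BlockTriangular (fun i => -d i) := by
  simp only [exp_conj_eq_entryMul hU]
  have hcont : Continuous fun B : Matrix (Fin n) (Fin n) ℝ => U.transpose * B * U := by fun_prop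
  constructor
  · rintro ⟨l, hl⟩ i j hij
    have hij' : 0 < d j - d i := by linarith
    by_contra hne
    have h1 := (hcont.tendsto l).comp hl
    have h2 : Tendsto (fun t : ℝ => Real.exp (t * (d j - d i)) * (U.transpose * A * U) i j) atTop
        (𝓝 ((U.transpose * l * U) i j)) := by
      have h3 := ((continuous_id.matrix_elem i j).tendsto (U.transpose * l * U)).comp h1
      refine h3.congr fun t => ?_
      exact congrFun (congrFun (transpose_entryMul_apply hU _ A) i) j
    have h4 : Tendsto (fun t : ℝ => Real.exp (t * (d j - d i))) atTop
        (𝓝 ((U.transpose * l * U) i j / (U.transpose * A * U) i j)) := by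
      refine (h2.div_const ((U.transpose * A * U) i j)).congr fun t => ?_
      field_simp
    have h5 : Tendsto (fun t : ℝ => Real.exp (t * (d j - d i))) atTop atTop :=
      Real.tendsto_exp_atTop.comp (tendsto_id.atTop_mul_const hij')
    exact not_tendsto_nhds_of_tendsto_atTop h5 _ h4
  · intro hA
    let B : Matrix (Fin n) (Fin n) ℝ := Matrix.of fun i j =>
      if d i = d j then (U.transpose * A * U) i j else 0
    refine ⟨U * B * U.transpose, ?_⟩
    have hB : Tendsto (fun t : ℝ => Matrix.of fun i j =>
        Real.exp (t * (d j - d i)) * (U.transpose * A * U) i j) atTop (𝓝 B) := by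
      refine tendsto_pi_nhds.2 fun i => tendsto_pi_nhds.2 fun j => ?_
      simp only [Matrix.of_apply, B]
      rcases lt_trichotomy (d i) (d j) with h | h | h
      · rw [hA (show -d j < -d i by linarith), if_neg h.ne]
        simp
      · simp [h]
      · rw [if_neg h.ne']
        have h5 : Tendsto (fun t : ℝ => Real.exp (t * (d j - d i))) atTop (𝓝 0) :=
          Real.tendsto_exp_atBot.comp (tendsto_id.atTop_mul_const_of_neg (by linarith))
        simpa using h5.mul_const ((U.transpose * A * U) i j)
    have hc : Continuous fun C : Matrix (Fin n) (Fin n) ℝ => U * C * U.transpose := by fun_prop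
    exact (hc.tendsto B).comp hB

end Multiplier

/-! ### The Lie algebra of the group, of `K`, and of `Q` -/

section Group

variable {n : ℕ} {G : Type*} [Group G]

theorem conj_exp_mem_lieAlg {p : G →* GL (Fin n) ℝ} {X A : Matrix (Fin n) (Fin n) ℝ}
    (hX : X ∈ lieSet p ⊤) (hA : A ∈ lieAlg p ⊤) (t : ℝ) :
    NormedSpace.exp ((-t) • X) * A * NormedSpace.exp (t • X) ∈ lieAlg p ⊤ := by
  obtain ⟨g, -, hg⟩ := hX (-t)
  have h := conj_mem p ⊤ (Subgroup.mem_top g) hA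
  have hg' : p g = expGL ((-t) • X) := by ext1; exact hg
  rw [conj_apply, hg', expGL_inv, expGL_val, expGL_val] at h
  simpa using h

theorem mem_lieSet_maxCompact {p : G →* GL (Fin n) ℝ} {A : Matrix (Fin n) (Fin n) ℝ}
    (hA : A ∈ lieSet p ⊤) (h : A.transpose = -A) : A ∈ lieSet p (maxCompact p) := by
  intro t
  obtain ⟨g, -, hg⟩ := hA t
  refine ⟨g, ?_, hg⟩
  change (p g).val.transpose * (p g).val = 1
  rw [hg, ← Matrix.exp_transpose, Matrix.transpose_smul, h, smul_neg]
  exact (expGL (t • A)).inv_mul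

theorem IsParabolic.mem_of_map_eq {p : G →* GL (Fin n) ℝ} {Q : Subgroup G}
    (hQ : IsParabolic p Q) {g g' : G} (hg : g ∈ Q) (h : p g = p g') : g' ∈ Q := by
  obtain ⟨X, -, -, hX⟩ := hQ
  rw [hX] at hg ⊢
  rwa [← h]

variable [TopologicalSpace G]

theorem IsRealReductive.transpose_mem_lieSet {p : G →* GL (Fin n) ℝ} (hp : IsRealReductive p)
    {A : Matrix (Fin n) (Fin n) ℝ} (hA : A ∈ lieSet p ⊤) : A.transpose ∈ lieSet p ⊤ := by
  intro t
  obtain ⟨g, -, hg⟩ := hA t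
  obtain ⟨g', hg'⟩ := hp.transpose_mem g
  refine ⟨g', Subgroup.mem_top _, ?_⟩
  rw [hg', hg, ← Matrix.transpose_smul, Matrix.exp_transpose]

theorem IsRealReductive.transpose_mem_lieAlg {p : G →* GL (Fin n) ℝ} (hp : IsRealReductive p)
    {A : Matrix (Fin n) (Fin n) ℝ} (hA : A ∈ lieAlg p ⊤) : A.transpose ∈ lieAlg p ⊤ := by
  induction hA using Submodule.span_induction with
  | mem _ h => exact Submodule.subset_span (hp.transpose_mem_lieSet h)
  | zero => simp
  | add _ _ _ _ h1 h2 => rw [Matrix.transpose_add]; exact add_mem h1 h2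
  | smul c _ _ h => rw [Matrix.transpose_smul]; exact Submodule.smul_mem _ c h

theorem IsRealReductive.isClosed_maxCompact {p : G →* GL (Fin n) ℝ} (hp : IsRealReductive p) :
    IsClosed (maxCompact p : Set G) := by
  have h : Continuous fun g => (p g).val.transpose * (p g).val :=
    hp.continuous_val.matrix_transpose.matrix_mul hp.continuous_val
  exact isClosed_eq h continuous_const

theorem abs_apply_le_one_of_orthogonal {A : Matrix (Fin n) (Fin n) ℝ}
    (h : A.transpose * A = 1) (i j : Fin n) : |A i j| ≤ 1 := by
  have h1 : ∑ k, A k j * A k j = 1 := by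
    have := congrFun (congrFun h j) j
    simpa [Matrix.mul_apply] using this
  have h2 : A i j * A i j ≤ 1 := by
    rw [← h1]
    exact Finset.single_le_sum (f := fun k => A k j * A k j)
      (fun k _ => mul_self_nonneg _) (Finset.mem_univ i)
  exact abs_le_one_iff_mul_self_le_one.2 h2

theorem isCompact_orthogonal :
    IsCompact {A : Matrix (Fin n) (Fin n) ℝ | A.transpose * A = 1} := by
  have hc : IsCompact (Set.univ.pi fun _ : Fin n => Set.univ.pi fun _ : Fin n =>
      Set.Icc (-1 : ℝ) 1) :=
    isCompact_univ_pi fun _ => isCompact_univ_pi fun _ => isCompact_Icc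
  refine hc.of_isClosed_subset (isClosed_eq (by fun_prop) continuous_const) ?_
  intro A hA
  exact fun i _ j _ => abs_le.1 (abs_apply_le_one_of_orthogonal hA i j)

/-- `K` is compact. -/
theorem IsRealReductive.isCompact_maxCompact [IsTopologicalGroup G]
    {p : G →* GL (Fin n) ℝ} (hp : IsRealReductive p) : IsCompact (maxCompact p : Set G) := by
  intro f hf hfK
  have h1 : Filter.map (fun g => (p g).val) f ≤
      𝓟 {A : Matrix (Fin n) (Fin n) ℝ | A.transpose * A = 1} := by
    rw [le_principal_iff, mem_map]
    exact mem_of_superset (le_principal_iff.1 hfK) fun g hg => hg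
  obtain ⟨A, hA, hcl⟩ := isCompact_orthogonal h1
  let u : GL (Fin n) ℝ := ⟨A, A.transpose, mul_eq_one_comm.1 hA, hA⟩
  have hcl' : MapClusterPt u.val f fun g => (p g).val := hcl
  obtain ⟨U, hU, hUt⟩ := mapClusterPt_iff_ultrafilter.1 hcl'
  obtain ⟨x, hx, hxc⟩ := hp.exists_mapClusterPt (g := id) (l := (U : Filter G)) hUt
  refine ⟨x, ?_, ?_⟩
  · change (p x).val.transpose * (p x).val = 1
    rw [hx]; exact hA
  · have : ClusterPt x (U : Filter G) := by simpa [MapClusterPt] using hxc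
    exact this.mono hU

theorem IsParabolic.isClosed {p : G →* GL (Fin n) ℝ} (hp : IsRealReductive p) {Q : Subgroup G}
    (hQ : IsParabolic p Q) : IsClosed (Q : Set G) := by
  obtain ⟨X, -, hXs, hX⟩ := hQ
  obtain ⟨U, d, hU, rfl⟩ := exists_orthogonal_diagonal hXs
  have : (Q : Set G) = ⋂ i, ⋂ j, {g | -d j < -d i → (U.transpose * (p g).val * U) i j = 0} := by
    ext g
    simp only [SetLike.mem_coe, hX, exists_tendsto_conj_iff hU, Set.mem_iInter]
    rfl
  rw [this]
  refine isClosed_iInter fun i => isClosed_iInter fun j => ?_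
  by_cases h : -d j < -d i
  · simp only [h, forall_const]
    have hc : Continuous fun g => U.transpose * (p g).val * U :=
      (continuous_const.matrix_mul hp.continuous_val).matrix_mul continuous_const
    exact isClosed_eq (hc.matrix_elem i j) continuous_const
  · simp [h]

/-- `𝔤 = 𝔨 + 𝔮`: the components of `Y` in the negative eigenspaces of `ad X` can be removed by
subtracting a skew-symmetric matrix. -/
theorem IsParabolic.exists_add {p : G →* GL (Fin n) ℝ} [IsTopologicalGroup G]
    (hp : IsRealReductive p) {Q : Subgroup G}
    (hQ : IsParabolic p Q) {Y : Matrix (Fin n) (Fin n) ℝ} (hY : Y ∈ lieSet p ⊤) :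
    ∃ Z ∈ lieSet p (maxCompact p), ∃ W ∈ lieSet p Q, Y = Z + W := by
  obtain ⟨X, hXg, hXs, hX⟩ := hQ
  obtain ⟨U, d, hU, rfl⟩ := exists_orthogonal_diagonal hXs
  have hmem : ∀ {A}, A ∈ lieAlg p ⊤ ↔ A ∈ lieSet p ⊤ := hp.mem_lieAlg isClosed_univ
  have h1 : ∀ A ∈ lieAlg p ⊤, entryMul U (fun i j => Real.exp (1 * (d j - d i))) A ∈ lieAlg p ⊤ :=
    fun A hA => by
      rw [← exp_conj_eq_entryMul hU]
      exact conj_exp_mem_lieAlg hXg hA 1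
  let w : Fin n → Fin n → ℝ := fun i j => if 1 < Real.exp (1 * (d j - d i)) then 1 else 0
  have h2 : entryMul U w Y ∈ lieAlg p ⊤ :=
    entryMul_comp_mem hU h1 (fun x => if 1 < x then 1 else 0) Y (hmem.2 hY)
  -- `N` is the part of `Y` in the eigenspaces of `ad X` which are not in `𝔮`.
  set N := entryMul U w Y with hN
  have hZ : N - N.transpose ∈ lieAlg p ⊤ := sub_mem h2 (hp.transpose_mem_lieAlg h2)
  refine ⟨N - N.transpose, mem_lieSet_maxCompact (hmem.1 hZ) (by simp),
    Y - (N - N.transpose), ?_, by abel⟩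
  have hW : Y - (N - N.transpose) ∈ lieSet p ⊤ := hmem.1 (sub_mem (hmem.2 hY) hZ)
  have hbt : (U.transpose * (Y - (N - N.transpose)) * U).BlockTriangular fun i => -d i := by
    intro i j hij
    have hNt : U.transpose * N.transpose * U = (U.transpose * N * U).transpose := by
      simp [Matrix.transpose_mul, mul_assoc]
    have e1 : U.transpose * (Y - (N - N.transpose)) * U = U.transpose * Y * U -
        (U.transpose * N * U - (U.transpose * N * U).transpose) := by
      rw [← hNt]; simp only [mul_sub, sub_mul]
    rw [e1, hN, transpose_entryMul_apply hU]
    have a1 : 1 < Real.exp (1 * (d j - d i)) := Real.one_lt_exp_iff.2 (by linarith)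
    have a2 : ¬ 1 < Real.exp (1 * (d i - d j)) := by
      rw [Real.one_lt_exp_iff]; linarith
    simp only [Matrix.sub_apply, Matrix.of_apply, Matrix.transpose_apply, w, a1, a2, if_true,
      if_false]
    ring
  intro t
  obtain ⟨g, -, hg⟩ := hW t
  refine ⟨g, ?_, hg⟩
  rw [hX, exists_tendsto_conj_iff hU, hg]
  have hU' : U * U.transpose = 1 := mul_eq_one_comm.1 hU
  have hi : U.transpose⁻¹ = U := Matrix.inv_eq_right_inv hU
  have := Matrix.exp_conj U.transpose (t • (Y - (N - N.transpose)))
    ⟨⟨U.transpose, U, hU, hU'⟩, rfl⟩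
  rw [hi] at this
  rw [← this]
  refine Matrix.BlockTriangular.exp ?_
  have e2 : U.transpose * t • (Y - (N - N.transpose)) * U =
      t • (U.transpose * (Y - (N - N.transpose)) * U) := by
    rw [mul_smul_comm, smul_mul_assoc]
  rw [e2]
  intro i j hij
  rw [Matrix.smul_apply, hbt hij, smul_zero]

end Group

/-! ### Coordinates of the second kind -/

section Coordinates

variable {𝔸 : Type*} [NormedRing 𝔸] [NormedAlgebra ℝ 𝔸]

theorem hasFDerivAt_prod_exp [CompleteSpace 𝔸] {ι : Type*} [Fintype ι] (v : ι → 𝔸)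
    (L : List ι) :
    HasFDerivAt (fun z : ι → ℝ => (L.map fun i => NormedSpace.exp (z i • v i)).prod)
      (L.map fun i => (ContinuousLinearMap.proj (R := ℝ) (φ := fun _ : ι => ℝ) i).smulRight
        (v i)).sum 0 := by
  have hval : ∀ L : List ι, (L.map fun i => NormedSpace.exp ((0 : ι → ℝ) i • v i)).prod = 1 := by
    intro L
    induction L with
    | nil => rfl
    | cons a L ih => rw [List.map_cons, List.prod_cons, ih]; simp [NormedSpace.exp_zero]
  induction L with
  | nil => simpa using hasFDerivAt_const (1 : 𝔸) (0 : ι → ℝ)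
  | cons a L ih =>
    simp only [List.map_cons, List.prod_cons, List.sum_cons]
    have h1 : HasFDerivAt (fun z : ι → ℝ => NormedSpace.exp (z a • v a))
        ((ContinuousLinearMap.proj (R := ℝ) (φ := fun _ : ι => ℝ) a).smulRight (v a)) 0 := by
      have h2 : HasFDerivAt (fun z : ι → ℝ => z a • v a)
          ((ContinuousLinearMap.proj (R := ℝ) (φ := fun _ : ι => ℝ) a).smulRight (v a)) 0 :=
        ((ContinuousLinearMap.proj (R := ℝ) (φ := fun _ : ι => ℝ) a).smulRight
          (v a)).hasFDerivAt
      have h3 : HasFDerivAt (NormedSpace.exp : 𝔸 → 𝔸) (1 : 𝔸 →L[ℝ] 𝔸)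
          ((fun z : ι → ℝ => z a • v a) 0) := by
        simpa using hasFDerivAt_exp_zero (𝕂 := ℝ) (𝔸 := 𝔸)
      have := h3.comp 0 h2
      rwa [show (1 : 𝔸 →L[ℝ] 𝔸) = ContinuousLinearMap.id ℝ 𝔸 from rfl,
        ContinuousLinearMap.id_comp] at this
    have h4 := h1.mul' ih
    refine h4.congr_fderiv ?_
    ext z
    simp [NormedSpace.exp_zero, add_comm]

theorem contDiff_exp [CompleteSpace 𝔸] : ContDiff ℝ ∞ (NormedSpace.exp : 𝔸 → 𝔸) :=
  contDiff_iff_contDiffAt.2 fun x => (NormedSpace.exp_analytic (𝕂 := ℝ) x).contDiffAt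

theorem contDiff_list_prod {E ι : Type*} [NormedAddCommGroup E] [NormedSpace ℝ E]
    {f : ι → E → 𝔸} (hf : ∀ i, ContDiff ℝ ∞ (f i)) (L : List ι) :
    ContDiff ℝ ∞ fun z => (L.map fun i => f i z).prod := by
  induction L with
  | nil => simpa using contDiff_const
  | cons a L ih => simpa using (hf a).mul ih

/-- Near the identity, every element is uniquely a product of exponentials of multiples of given
linearly independent vectors and of an element `1 + s` with `s` in a complementary subspace, and
the coordinates are smooth. -/
theorem exists_local_coordinates [FiniteDimensional ℝ 𝔸] {ι : Type*} [Fintype ι] {v : ι → 𝔸}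
    (hv : LinearIndependent ℝ v) {L : List ι} (hL : (L : Multiset ι) = Finset.univ.val) :
    ∃ (S : Submodule ℝ 𝔸) (ξ : 𝔸 → ι → ℝ) (s : 𝔸 → 𝔸),
      Disjoint (Submodule.span ℝ (Set.range v)) S ∧ ContDiffAt ℝ ∞ ξ 1 ∧ ξ 1 = 0 ∧
      ContinuousAt s 1 ∧ s 1 = 0 ∧ (∀ y, s y ∈ S) ∧
      ∀ᶠ y in 𝓝 (1 : 𝔸), (L.map fun i => NormedSpace.exp (ξ y i • v i)).prod * (1 + s y) = y := by
  have hcompl : CompleteSpace 𝔸 := FiniteDimensional.complete ℝ 𝔸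
  obtain ⟨S, hS⟩ := Submodule.exists_isCompl (Submodule.span ℝ (Set.range v))
  have hScompl : CompleteSpace S := FiniteDimensional.complete ℝ S
  let Ψ : (ι → ℝ) × S → 𝔸 := fun x =>
    (L.map fun i => NormedSpace.exp (x.1 i • v i)).prod * (1 + (x.2 : 𝔸))
  let Λ : ((ι → ℝ) × S) →ₗ[ℝ] 𝔸 :=
    LinearMap.coprod (Fintype.linearCombination ℝ v) S.subtype
  have hΛ : Function.Bijective Λ := by
    constructor
    · rw [← LinearMap.ker_eq_bot, LinearMap.ker_coprod_of_disjoint_range]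
      · rw [Submodule.ker_subtype, LinearMap.ker_eq_bot.2
          ((linearIndependent_iff_injective_fintypeLinearCombination).1 hv), Submodule.prod_bot]
      · rw [Fintype.range_linearCombination, Submodule.range_subtype]
        exact hS.disjoint
    · rw [← LinearMap.range_eq_top, LinearMap.range_coprod, Fintype.range_linearCombination,
        Submodule.range_subtype]
      exact hS.sup_eq_top
  let e : ((ι → ℝ) × S) ≃L[ℝ] 𝔸 := (LinearEquiv.ofBijective Λ hΛ).toContinuousLinearEquiv
  have he : ∀ x, e x = ∑ i, x.1 i • v i + (x.2 : 𝔸) := fun x => by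
    change Λ x = _
    simp [Λ, Fintype.linearCombination_apply]
  have hΨ0 : Ψ 0 = 1 := by
    have : ∀ L : List ι, (L.map fun i => NormedSpace.exp ((0 : ι → ℝ) i • v i)).prod = 1 := by
      intro L
      induction L with
      | nil => rfl
      | cons a L ih => rw [List.map_cons, List.prod_cons, ih]; simp [NormedSpace.exp_zero]
    change (L.map fun i => NormedSpace.exp ((0 : ι → ℝ) i • v i)).prod * (1 + 0) = 1
    rw [this, add_zero, one_mul]
  have hΨc : ContDiff ℝ ∞ Ψ := by
    have h1 : ContDiff ℝ ∞ fun z : ι → ℝ => (L.map fun i => NormedSpace.exp (z i • v i)).prod :=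
      contDiff_list_prod (fun i => contDiff_exp.comp ((contDiff_apply ℝ ℝ i).smul contDiff_const)) L
    exact (h1.comp contDiff_fst).mul (contDiff_const.add (S.subtypeL.contDiff.comp contDiff_snd))
  have hΨd : HasFDerivAt Ψ (e : ((ι → ℝ) × S) →L[ℝ] 𝔸) 0 := by
    have h1 := HasFDerivAt.comp (f := fun x : (ι → ℝ) × S => x.1)
      (g := fun z : ι → ℝ => (L.map fun i => NormedSpace.exp (z i • v i)).prod)
      (0 : (ι → ℝ) × S) (hasFDerivAt_prod_exp v L) hasFDerivAt_fst
    have h2 : HasFDerivAt (fun x : (ι → ℝ) × S => 1 + (x.2 : 𝔸))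
        (S.subtypeL.comp (ContinuousLinearMap.snd ℝ (ι → ℝ) S)) 0 :=
      (S.subtypeL.comp (ContinuousLinearMap.snd ℝ (ι → ℝ) S)).hasFDerivAt.const_add 1
    refine (h1.mul' h2).congr_fderiv ?_
    have h3 : (L.map fun i => NormedSpace.exp ((0 : (ι → ℝ) × S).1 i • v i)).prod = 1 := by
      have : Ψ 0 = (L.map fun i => NormedSpace.exp ((0 : (ι → ℝ) × S).1 i • v i)).prod := by
        change _ * (1 + ((0 : S) : 𝔸)) = _
        simp
      rw [← this, hΨ0]
    have h4 : ∀ z : ι → ℝ, (L.map fun i => (ContinuousLinearMap.proj (R := ℝ)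
        (φ := fun _ : ι => ℝ) i).smulRight (v i)).sum z = ∑ i, z i • v i := by
      intro z
      rw [Finset.sum, ← hL, Multiset.map_coe, Multiset.sum_coe]
      clear hL h3 h1 hΨ0 hΨc
      induction L with
      | nil => simp
      | cons a L ih => simp [ih]
    refine ContinuousLinearMap.ext fun x => ?_
    have h5 : ((fun z : ι → ℝ => (L.map fun i => NormedSpace.exp (z i • v i)).prod) ∘
        fun x : (ι → ℝ) × S => x.1) 0 = 1 := h3
    rw [h5]
    change _ = e x
    rw [he]
    simp [h4, add_comm]
  have hne : (∞ : WithTop ℕ∞) ≠ 0 := by simp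
  have hs := hΨc.contDiffAt.hasStrictFDerivAt' hΨd hne
  set ℓ := hΨc.contDiffAt.localInverse hΨd hne with hℓ
  have hℓ1 : ℓ 1 = 0 := by
    have := hΨc.contDiffAt.localInverse_apply_image hΨd hne
    rwa [hΨ0] at this
  have hℓc : ContDiffAt ℝ ∞ ℓ 1 := by
    have := hΨc.contDiffAt.to_localInverse hΨd hne
    rwa [hΨ0] at this
  have hℓr : ∀ᶠ y in 𝓝 (1 : 𝔸), Ψ (ℓ y) = y := by
    have := hs.eventually_right_inverse
    rwa [hΨ0] at this
  refine ⟨S, fun y => (ℓ y).1, fun y => (ℓ y).2, hS.disjoint, hℓc.fst, by simp [hℓ1], ?_,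
    by simp [hℓ1], fun y => (ℓ y).2.2, hℓr⟩
  exact (continuous_subtype_val.comp continuous_snd).continuousAt.comp hℓc.continuousAt

end Coordinates

/-! ### One-parameter subgroups and local coordinates of the group -/

section Group

variable {n : ℕ} {G : Type*} [Group G] [TopologicalSpace G]

/-- `γ` is a one-parameter subgroup of `G` lying over `t ↦ exp(tY)`. -/
def IsOneParam (p : G →* GL (Fin n) ℝ) (Y : Matrix (Fin n) (Fin n) ℝ)
    (γ : Multiplicative ℝ →ₜ* G) : Prop :=
  ∀ t : ℝ, (p (γ (Multiplicative.ofAdd t))).val = NormedSpace.exp (t • Y)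

theorem IsOneParam.mem {p : G →* GL (Fin n) ℝ} {Y : Matrix (Fin n) (Fin n) ℝ}
    {γ : Multiplicative ℝ →ₜ* G} (h : IsOneParam p Y γ) {Γ : Subgroup G}
    (hΓ : ∀ g ∈ Γ, ∀ g', p g = p g' → g' ∈ Γ) (hY : Y ∈ lieSet p Γ) (t : ℝ) :
    γ (Multiplicative.ofAdd t) ∈ Γ := by
  obtain ⟨g, hg, hgt⟩ := hY t
  refine hΓ g hg _ ?_
  ext1
  rw [hgt, h t]

theorem IsOneParam.continuous {p : G →* GL (Fin n) ℝ} {Y : Matrix (Fin n) (Fin n) ℝ}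
    {γ : Multiplicative ℝ →ₜ* G} (_h : IsOneParam p Y γ) :
    Continuous fun t : ℝ => γ (Multiplicative.ofAdd t) :=
  γ.continuous_toFun.comp continuous_ofAdd

theorem oneParam_zero (γ : Multiplicative ℝ →ₜ* G) : γ (Multiplicative.ofAdd 0) = 1 := by
  rw [ofAdd_zero, map_one]

theorem oneParam_add (γ : Multiplicative ℝ →ₜ* G) (s t : ℝ) :
    γ (Multiplicative.ofAdd (s + t)) = γ (Multiplicative.ofAdd s) * γ (Multiplicative.ofAdd t) := by
  rw [ofAdd_add, map_mul]

theorem oneParam_neg (γ : Multiplicative ℝ →ₜ* G) (t : ℝ) :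
    γ (Multiplicative.ofAdd (-t)) = (γ (Multiplicative.ofAdd t))⁻¹ := by
  rw [ofAdd_neg, map_inv]

variable [IsTopologicalGroup G] [T2Space G]

theorem IsRealReductive.isCoveringMap {p : G →* GL (Fin n) ℝ} (hp : IsRealReductive p) :
    IsCoveringMap p.rangeRestrict := by
  have hq : IsQuotientMap p.rangeRestrict :=
    hp.isOpenMap.isQuotientMap (hp.continuous.subtype_mk _) p.rangeRestrict_surjective
  have hf : (p.rangeRestrict.ker : Set G).Finite := by
    rw [MonoidHom.ker_rangeRestrict]
    exact hp.finite_ker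
  exact (hq.isQuotientCoveringMap_of_isDiscrete_ker_monoidHom hf.isDiscrete).isCoveringMap

/-- One-parameter subgroups of `p(G)` lift to `G`, as `p` is a covering of its image. -/
theorem IsRealReductive.exists_isOneParam {p : G →* GL (Fin n) ℝ} (hp : IsRealReductive p)
    {Y : Matrix (Fin n) (Fin n) ℝ} (hY : Y ∈ lieSet p ⊤) :
    ∃ γ : Multiplicative ℝ →ₜ* G, IsOneParam p Y γ := by
  have hmem : ∀ t : ℝ, expGL (t • Y) ∈ p.range := fun t => by
    obtain ⟨g, -, hg⟩ := hY t
    exact ⟨g, by ext1; exact hg⟩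
  have hexp : Continuous fun t : ℝ => NormedSpace.exp (t • Y) :=
    continuous_iff_continuousAt.2 fun t => (hasDerivAt_exp_smul Y t).continuousAt
  have hcont : Continuous fun t : ℝ => expGL (t • Y) := by
    rw [continuous_iff_continuousAt]
    intro t
    exact tendsto_GL_iff.2 (hexp.tendsto t)
  let f : C(ℝ, p.range) := ⟨fun t => ⟨expGL (t • Y), hmem t⟩, hcont.subtype_mk _⟩
  have hf0 : p.rangeRestrict 1 = f 0 := by
    ext1; ext1
    simp [f, NormedSpace.exp_zero]
  have hcov := hp.isCoveringMap
  obtain ⟨F, ⟨hF0, hF⟩, -⟩ := hcov.existsUnique_continuousMap_lifts f 0 1 hf0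
  have hF' : ∀ t, p (F t) = expGL (t • Y) := fun t => congrArg Subtype.val (congrFun hF t)
  have hadd : ∀ s t, F (s + t) = F s * F t := by
    intro s
    refine congrFun (hcov.eq_of_comp_eq (g₁ := fun t => F (s + t)) (g₂ := fun t => F s * F t)
      (F.continuous.comp (by fun_prop)) (continuous_const.mul F.continuous) ?_ 0 ?_)
    · ext1 t
      apply Subtype.ext
      change p (F (s + t)) = p (F s * F t)
      rw [map_mul, hF', hF', hF', expGL_add_smul]
    · simp [hF0]
  refine ⟨⟨⟨⟨fun t => F (Multiplicative.toAdd t), ?_⟩, ?_⟩, ?_⟩, ?_⟩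
  · exact hF0
  · exact fun s t => hadd _ _
  · exact F.continuous.comp continuous_toAdd
  · intro t
    exact congrArg Units.val (hF' t)

theorem IsRealReductive.eventually_eq {p : G →* GL (Fin n) ℝ} (hp : IsRealReductive p)
    {ι : Type*} {l : Filter ι} {a b : ι → G} {x : G} (ha : Tendsto a l (𝓝 x))
    (hb : Tendsto b l (𝓝 x)) (h : ∀ᶠ i in l, p (a i) = p (b i)) : ∀ᶠ i in l, a i = b i := by
  have h1 : Tendsto (fun i => (a i)⁻¹ * b i) l (𝓝 1) := by
    simpa using ha.inv.mul hb
  have hfin : ((p.ker : Set G) \ {1}).Finite :=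
    Set.Finite.subset (show (p.ker : Set G).Finite from hp.finite_ker) Set.sdiff_subset
  have h2 : ((p.ker : Set G) \ {1})ᶜ ∈ 𝓝 (1 : G) :=
    hfin.isClosed.isOpen_compl.mem_nhds (by simp)
  filter_upwards [h, h1.eventually h2] with i hi hi2
  have h3 : (a i)⁻¹ * b i ∈ p.ker := by
    rw [MonoidHom.mem_ker, map_mul, map_inv, hi, inv_mul_cancel]
  by_contra hne
  refine hi2 ⟨h3, fun h4 => hne ?_⟩
  exact inv_mul_eq_one.1 h4

/-- Coordinates of the second kind near the identity of `G`: an element is a product of values of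
one-parameter subgroups whose generators form a basis of the Lie algebra, and the coordinates are
smooth functions of its image in `M(n, ℝ)`. -/
theorem IsRealReductive.exists_coordinates {p : G →* GL (Fin n) ℝ} (hp : IsRealReductive p)
    {ι : Type*} [Fintype ι] {v : ι → Matrix (Fin n) (Fin n) ℝ} (hv : LinearIndependent ℝ v)
    (hspan : lieAlg p ⊤ ≤ Submodule.span ℝ (Set.range v))
    {γ : ι → Multiplicative ℝ →ₜ* G} (hγ : ∀ i, IsOneParam p (v i) (γ i))
    {L : List ι} (hL : (L : Multiset ι) = Finset.univ.val) :
    ∃ ξ : Matrix (Fin n) (Fin n) ℝ → ι → ℝ, ContDiffAt ℝ ∞ ξ 1 ∧ ξ 1 = 0 ∧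
      ∀ᶠ g in 𝓝 (1 : G),
        g = (L.map fun i => γ i (Multiplicative.ofAdd (ξ (p g).val i))).prod := by
  obtain ⟨S, ξ, s, hdisj, hξ, hξ1, hs, hs1, hsS, hprod⟩ := exists_local_coordinates hv hL
  refine ⟨ξ, hξ, hξ1, ?_⟩
  have hp1 : Tendsto (fun g => (p g).val) (𝓝 1) (𝓝 (1 : Matrix (Fin n) (Fin n) ℝ)) := by
    have := hp.continuous_val.tendsto 1
    simpa using this
  set Γ : G → G := fun g =>
    (L.map fun i => γ i (Multiplicative.ofAdd (ξ (p g).val i))).prod with hΓ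
  have hpΓ : ∀ g, (p (Γ g)).val =
      (L.map fun i => NormedSpace.exp (ξ (p g).val i • v i)).prod := by
    intro g
    rw [hΓ]
    clear hL hprod hΓ
    induction L with
    | nil => simp
    | cons a L ih => simp only [List.map_cons, List.prod_cons, map_mul, Units.val_mul, ih, hγ a _]
  have hΓ1 : Tendsto Γ (𝓝 1) (𝓝 1) := by
    have h1 : ∀ i, Tendsto (fun g => γ i (Multiplicative.ofAdd (ξ (p g).val i))) (𝓝 1) (𝓝 1) := by
      intro i
      have h2 : Tendsto (fun g => ξ (p g).val i) (𝓝 1) (𝓝 0) := by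
        have h3 := hξ.continuousAt.tendsto
        rw [hξ1] at h3
        exact ((continuous_apply i).tendsto _).comp (h3.comp hp1)
      have h4 := ((hγ i).continuous.tendsto 0).comp h2
      rw [oneParam_zero] at h4
      exact h4
    rw [hΓ]
    clear hL hprod hpΓ hΓ
    induction L with
    | nil => simp
    | cons a L ih => simpa using (h1 a).mul ih
  have hev : ∀ᶠ g in 𝓝 (1 : G), (p (Γ g)).val * (1 + s (p g).val) = (p g).val := by
    filter_upwards [hp1.eventually hprod] with g hg
    rw [hpΓ]
    exact hg
  have hs0 : ∀ᶠ g in 𝓝 (1 : G), s (p g).val = 0 := by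
    by_contra hcon
    have hfreq : ∃ᶠ g in 𝓝 (1 : G), s (p g).val ≠ 0 := not_eventually.1 hcon
    set l := 𝓝 (1 : G) ⊓ 𝓟 {g | s (p g).val ≠ 0} with hl
    have hne : l.NeBot := frequently_mem_iff_neBot.1 hfreq
    have hl1 : l ≤ 𝓝 1 := inf_le_left
    have hl2 : ∀ᶠ g in l, s (p g).val ≠ 0 := mem_inf_of_right (mem_principal_self _)
    let u : G → Matrix (Fin n) (Fin n) ℝ := fun g => ‖s (p g).val‖⁻¹ • s (p g).val
    have hu : ∀ᶠ g in l, u g ∈ Metric.sphere (0 : Matrix (Fin n) (Fin n) ℝ) 1 := by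
      filter_upwards [hl2] with g hg
      rw [mem_sphere_zero_iff_norm, norm_smul, norm_inv, norm_norm,
        inv_mul_cancel₀ (norm_ne_zero_iff.2 hg)]
    have hprop : ProperSpace (Matrix (Fin n) (Fin n) ℝ) := FiniteDimensional.proper ℝ _
    obtain ⟨A, hA, hcl⟩ := (isCompact_sphere (0 : Matrix (Fin n) (Fin n) ℝ) 1)
      (f := Filter.map u l) (le_principal_iff.2 hu)
    obtain ⟨U, hU, hUt⟩ := mapClusterPt_iff_ultrafilter.1 (show MapClusterPt A l u from hcl)
    have hU1 : (U : Filter G) ≤ 𝓝 1 := hU.trans hl1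
    have hpe : ∀ᶠ g in (U : Filter G), (p ((Γ g)⁻¹ * g)).val = 1 + s (p g).val := by
      filter_upwards [hU1 hev] with g hg
      have h1 : (p ((Γ g)⁻¹ * g)).val = ((p (Γ g))⁻¹).val * (p g).val := by
        simp only [map_mul, map_inv, Units.val_mul]
      rw [h1]
      exact (Units.inv_mul_eq_iff_eq_mul _).2 hg.symm
    have hAlie : A ∈ lieSet p ⊤ := by
      refine hp.mem_lieSet_of_tendsto (Γ := ⊤) isClosed_univ (l := (U : Filter G))
        (g := fun g => (Γ g)⁻¹ * g) (r := fun g => ‖s (p g).val‖⁻¹)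
        (Eventually.of_forall fun g => Subgroup.mem_top _)
        (Eventually.of_forall fun g => inv_nonneg.2 (norm_nonneg _)) ?_ ?_
      · have h1 : Tendsto (fun g => (Γ g)⁻¹ * g) (𝓝 1) (𝓝 1) := by
          simpa using hΓ1.inv.mul tendsto_id
        exact hp1.comp (h1.mono_left hU1)
      · refine hUt.congr' ?_
        filter_upwards [hpe] with g hg
        rw [hg, add_sub_cancel_left]
    have hAS : A ∈ S := by
      have hcl : IsClosed (S : Set (Matrix (Fin n) (Fin n) ℝ)) := S.closed_of_finiteDimensional
      exact hcl.mem_of_tendsto hUt (Eventually.of_forall fun g => S.smul_mem _ (hsS _))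
    have hA0 : A = 0 := (Submodule.disjoint_def.1 hdisj) A
      (hspan (Submodule.subset_span hAlie)) hAS
    rw [hA0] at hA
    simp at hA
  refine hp.eventually_eq (x := 1) tendsto_id hΓ1 ?_
  filter_upwards [hev, hs0] with g hg hg0
  rw [hg0, add_zero, mul_one] at hg
  ext1
  exact hg.symm

end Group

/-! ### Determinants of exponentials and the trace form -/

section Det

/-- The derivative of the determinant at the identity is the trace. -/
theorem hasDerivAt_det {m : Type*} [Fintype m] [DecidableEq m] {c : ℝ → Matrix m m ℝ}
    {A : Matrix m m ℝ} (hc : HasDerivAt c A 0) (h0 : c 0 = 1) :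
    HasDerivAt (fun t => (c t).det) A.trace 0 := by
  have hdiff : Differentiable ℝ fun M : Matrix m m ℝ => M.det := by
    have hentry : ∀ i j, Differentiable ℝ fun M : Matrix m m ℝ => M i j := fun i j =>
      (LinearMap.toContinuousLinearMap (Matrix.entryLinearMap ℝ ℝ i j)).differentiable
    simp only [Matrix.det_apply']
    fun_prop
  have hD := (hdiff (1 : Matrix m m ℝ)).hasFDerivAt
  set D := fderiv ℝ (fun M : Matrix m m ℝ => M.det) 1 with hDdef
  have h1 : HasDerivAt (fun t : ℝ => (1 + t • A).det) (D A) 0 := by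
    have h2 : HasDerivAt (fun t : ℝ => 1 + t • A) A 0 := by
      have := ((hasDerivAt_id (0 : ℝ)).smul_const A).const_add (1 : Matrix m m ℝ)
      rw [one_smul] at this
      exact this
    have h3 : HasFDerivAt (fun M : Matrix m m ℝ => M.det) D (1 + (0 : ℝ) • A) := by simpa using hD
    exact h3.comp_hasDerivAt 0 h2
  have h4 : HasDerivAt (fun t : ℝ => (1 + t • A).det) A.trace 0 := by
    have hexpand := funext fun t : ℝ => Matrix.det_one_add_smul t A
    rw [hexpand]
    set P := ((1 + (Polynomial.X : Polynomial ℝ) •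
      A.map Polynomial.C).det).divX.divX with hP
    have h5 : HasDerivAt (fun t : ℝ => Polynomial.eval t P * t ^ 2) 0 0 := by
      refine ((P.hasDerivAt 0).mul (hasDerivAt_pow 2 (0 : ℝ))).congr_deriv ?_
      simp
    have h6 : HasDerivAt (fun t : ℝ => 1 + A.trace * t) A.trace 0 := by
      have := ((hasDerivAt_id (0 : ℝ)).const_mul A.trace).const_add 1
      rw [mul_one] at this
      exact this
    have := h6.add h5
    rw [add_zero] at this
    exact this
  have h7 : D A = A.trace := h1.unique h4
  have h8 : HasFDerivAt (fun M : Matrix m m ℝ => M.det) D (c 0) := by rw [h0]; exact hD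
  rw [← h7]
  exact h8.comp_hasDerivAt 0 hc

/-- `det (exp A) = exp (tr A)`. -/
theorem det_exp_eq {n : ℕ} (A : Matrix (Fin n) (Fin n) ℝ) :
    (NormedSpace.exp A).det = Real.exp A.trace := by
  let D : ℝ → ℝ := fun t => (NormedSpace.exp (t • A)).det
  have hadd : ∀ s t, D (s + t) = D s * D t := fun s t => by
    have := congrArg (fun u : GL (Fin n) ℝ => u.val.det) (expGL_add_smul s t A)
    simpa using this
  have h0 : HasDerivAt D A.trace 0 :=
    hasDerivAt_det (hasDerivAt_exp_smul_zero A) (by simp [NormedSpace.exp_zero])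
  have hD : ∀ t, HasDerivAt D (D t * A.trace) t := fun t => by
    have h1 : HasDerivAt (fun s => D (t + (s - t))) (D t * A.trace) t := by
      simp only [hadd]
      have h2 : HasDerivAt D A.trace (t - t) := by rwa [sub_self]
      exact (h2.comp_sub_const t t).const_mul (D t)
    simpa using h1
  have hE : ∀ t, HasDerivAt (fun t => D t * Real.exp (-(t * A.trace))) 0 t := fun t => by
    have h1 : HasDerivAt (fun t : ℝ => Real.exp (-(t * A.trace)))
        (Real.exp (-(t * A.trace)) * (-(1 * A.trace))) t :=
      ((hasDerivAt_id t).mul_const A.trace).neg.exp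
    refine ((hD t).mul h1).congr_deriv ?_
    ring
  have hconst := is_const_of_deriv_eq_zero (fun t => (hE t).differentiableAt)
    (fun t => (hE t).deriv) 1 0
  have hD0 : D 0 = 1 := by simp [D, NormedSpace.exp_zero]
  have hD1 : D 1 = (NormedSpace.exp A).det := by simp [D]
  simp only [hD0, hD1, one_mul, zero_mul, neg_zero, Real.exp_zero] at hconst
  rw [Real.exp_neg, mul_inv_eq_one₀ (Real.exp_pos _).ne'] at hconst
  exact hconst

variable {n : ℕ}

/-- Square matrices with the trace form `tr(A Bᵀ)`, as a Euclidean space. -/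
def toEuclid : Matrix (Fin n) (Fin n) ℝ ≃ₗ[ℝ] EuclideanSpace ℝ (Fin n × Fin n) where
  toFun A := WithLp.toLp 2 fun ij => A ij.1 ij.2
  invFun x := Matrix.of fun i j => x (i, j)
  map_add' _ _ := rfl
  map_smul' _ _ := rfl
  left_inv _ := rfl
  right_inv _ := rfl

theorem inner_toEuclid (A B : Matrix (Fin n) (Fin n) ℝ) :
    inner ℝ (toEuclid A) (toEuclid B) = (A * B.transpose).trace := by
  rw [PiLp.inner_apply, Fintype.sum_prod_type]
  simp only [Matrix.trace, Matrix.mul_apply, Matrix.diag_apply, Matrix.transpose_apply]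
  exact Finset.sum_congr rfl fun i _ => Finset.sum_congr rfl fun j _ => mul_comm (B i j) (A i j)

theorem eq_zero_of_trace_mul_transpose {A : Matrix (Fin n) (Fin n) ℝ}
    (h : (A * A.transpose).trace = 0) : A = 0 := by
  rw [← inner_toEuclid, inner_self_eq_zero] at h
  exact toEuclid.map_eq_zero_iff.1 h

theorem exists_trace_orthogonal (𝔤 : Submodule ℝ (Matrix (Fin n) (Fin n) ℝ))
    (A : Matrix (Fin n) (Fin n) ℝ) :
    ∃ B ∈ 𝔤, ∀ C ∈ 𝔤, ((A - B) * C.transpose).trace = 0 := by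
  obtain ⟨y, hy, z, hz, h⟩ := Submodule.exists_add_mem_mem_orthogonal
    (K := 𝔤.map toEuclid.toLinearMap) (toEuclid A)
  obtain ⟨B, hB, rfl⟩ := hy
  refine ⟨B, hB, fun C hC => ?_⟩
  rw [← inner_toEuclid, map_sub, h]
  rw [Submodule.mem_orthogonal] at hz
  have := hz (toEuclid C) ⟨C, hC, rfl⟩
  rw [real_inner_comm] at this
  simpa using this

theorem commute_diagonalized_iff {U : Matrix (Fin n) (Fin n) ℝ} (hU : U.transpose * U = 1)
    (f : Fin n → ℝ) (A : Matrix (Fin n) (Fin n) ℝ) :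
    Commute A (U * Matrix.diagonal f * U.transpose) ↔
      ∀ i j, (U.transpose * A * U) i j * f j = f i * (U.transpose * A * U) i j := by
  have h1 : U.transpose * (A * (U * Matrix.diagonal f * U.transpose)) * U =
      (U.transpose * A * U) * Matrix.diagonal f := by
    calc _ = (U.transpose * A * U) * Matrix.diagonal f * (U.transpose * U) := by
          simp only [mul_assoc]
      _ = _ := by rw [hU, mul_one]
  have h2 : U.transpose * ((U * Matrix.diagonal f * U.transpose) * A) * U =
      Matrix.diagonal f * (U.transpose * A * U) := by
    calc _ = (U.transpose * U) * Matrix.diagonal f * (U.transpose * A * U) := by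
          simp only [mul_assoc]
      _ = _ := by rw [hU, one_mul]
  constructor
  · intro h i j
    have h3 : (U.transpose * A * U) * Matrix.diagonal f =
        Matrix.diagonal f * (U.transpose * A * U) := by rw [← h1, h.eq, h2]
    have := congrFun (congrFun h3 i) j
    rwa [Matrix.mul_diagonal, Matrix.diagonal_mul] at this
  · intro h
    refine eq_of_conj_eq hU ?_
    rw [h1, h2]
    ext i j
    rw [Matrix.mul_diagonal, Matrix.diagonal_mul]
    exact h i j

theorem exp_mul_of_mul_eq_zero {M N : Matrix (Fin n) (Fin n) ℝ} (h : M * N = 0) :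
    NormedSpace.exp M * N = N := by
  have h1 : ∀ t : ℝ, HasDerivAt (fun t : ℝ => NormedSpace.exp (t • M) * N) 0 t := fun t => by
    have h2 := HasDerivAt.mul_const (𝔸 := Matrix (Fin n) (Fin n) ℝ) (hasDerivAt_exp_smul M t) N
    rw [mul_assoc, h, mul_zero] at h2
    exact h2
  have := is_const_of_deriv_eq_zero (fun t => (h1 t).differentiableAt)
    (fun t => (h1 t).deriv) 1 0
  simpa [NormedSpace.exp_zero] using this

/-- For a projection `E` commuting with `A`, the matrix which is `exp A` on the range of `E` and
the identity on its kernel is `exp (A E)`. -/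
theorem exp_mul_proj {A E : Matrix (Fin n) (Fin n) ℝ} (hE : E * E = E) (h : Commute A E) :
    NormedSpace.exp A * E + (1 - E) = NormedSpace.exp (A * E) := by
  have hc : Commute (A * E) (A * (1 - E)) := by
    have h1 : A * E * (A * (1 - E)) = 0 := by
      calc _ = A * (E * A) * (1 - E) := by simp only [mul_assoc]
        _ = A * A * (E - E * E) := by rw [← h.eq]; simp only [mul_assoc, mul_sub, mul_one]
        _ = 0 := by rw [hE, sub_self, mul_zero]
    have h2 : A * (1 - E) * (A * E) = 0 := by
      calc _ = A * ((1 - E) * (A * E)) := by simp only [mul_assoc]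
        _ = A * ((1 - E) * (E * A)) := by rw [h.eq]
        _ = A * ((E - E * E) * A) := by simp only [sub_mul, one_mul, mul_assoc]
        _ = 0 := by rw [hE, sub_self, zero_mul, mul_zero]
    exact h1.trans h2.symm
  have h1 : NormedSpace.exp A = NormedSpace.exp (A * E) * NormedSpace.exp (A * (1 - E)) := by
    rw [← Matrix.exp_add_of_commute _ _ hc]
    congr 1
    rw [mul_sub, mul_one, add_sub_cancel]
  have h2 : NormedSpace.exp (A * (1 - E)) * E = E := by
    apply exp_mul_of_mul_eq_zero
    rw [mul_assoc, sub_mul, one_mul, hE, sub_self, mul_zero]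
  have h3 : NormedSpace.exp (A * E) * (1 - E) = 1 - E := by
    apply exp_mul_of_mul_eq_zero
    rw [mul_assoc, mul_sub, mul_one, hE, sub_self, mul_zero]
  calc _ = NormedSpace.exp (A * E) * E + NormedSpace.exp (A * E) * (1 - E) := by
        rw [h1, mul_assoc, h2, h3]
    _ = _ := by rw [← mul_add, add_sub_cancel, mul_one]

end Det

/-! ### The polar decomposition -/

section Polar

variable {n : ℕ} {G : Type*} [Group G] [TopologicalSpace G]

/-- The subgroup generated by all one-parameter subgroups. -/
def expSubgroup (p : G →* GL (Fin n) ℝ) : Subgroup G :=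
  Subgroup.closure {g | ∃ Y ∈ lieSet p ⊤, ∃ γ : Multiplicative ℝ →ₜ* G, IsOneParam p Y γ ∧
    ∃ t : ℝ, g = γ (Multiplicative.ofAdd t)}

theorem IsOneParam.mem_expSubgroup {p : G →* GL (Fin n) ℝ} {Y : Matrix (Fin n) (Fin n) ℝ}
    {γ : Multiplicative ℝ →ₜ* G} (h : IsOneParam p Y γ) (hY : Y ∈ lieSet p ⊤) (t : ℝ) :
    γ (Multiplicative.ofAdd t) ∈ expSubgroup p :=
  Subgroup.subset_closure ⟨Y, hY, γ, h, t, rfl⟩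

variable [IsTopologicalGroup G] [T2Space G]

/-- Coordinates near the identity adapted to a decomposition of the Lie algebra into two
subspaces. -/
theorem IsRealReductive.exists_adapted_coordinates {p : G →* GL (Fin n) ℝ}
    (hp : IsRealReductive p) {𝔞 𝔟 : Submodule ℝ (Matrix (Fin n) (Fin n) ℝ)}
    (ha : ∀ Y ∈ 𝔞, Y ∈ lieSet p ⊤) (hb : ∀ Y ∈ 𝔟, Y ∈ lieSet p ⊤) (hd : Disjoint 𝔞 𝔟)
    (hs : lieAlg p ⊤ ≤ 𝔞 ⊔ 𝔟) :
    ∃ (r s : ℕ) (a : Fin r → Matrix (Fin n) (Fin n) ℝ) (b : Fin s → Matrix (Fin n) (Fin n) ℝ)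
      (γa : Fin r → Multiplicative ℝ →ₜ* G) (γb : Fin s → Multiplicative ℝ →ₜ* G)
      (ξ : Matrix (Fin n) (Fin n) ℝ → Fin r → ℝ) (η : Matrix (Fin n) (Fin n) ℝ → Fin s → ℝ),
      (∀ i, a i ∈ 𝔞 ∧ IsOneParam p (a i) (γa i)) ∧ (∀ i, b i ∈ 𝔟 ∧ IsOneParam p (b i) (γb i)) ∧
      ContDiffAt ℝ ∞ ξ 1 ∧ ContDiffAt ℝ ∞ η 1 ∧ ξ 1 = 0 ∧ η 1 = 0 ∧
      ∀ᶠ g in 𝓝 (1 : G), g =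
        ((List.finRange r).map fun i => γa i (Multiplicative.ofAdd (ξ (p g).val i))).prod *
        ((List.finRange s).map fun i => γb i (Multiplicative.ofAdd (η (p g).val i))).prod := by
  let ba := Module.finBasis ℝ 𝔞
  let bb := Module.finBasis ℝ 𝔟
  have hspan : ∀ (𝔠 : Submodule ℝ (Matrix (Fin n) (Fin n) ℝ)),
      Submodule.span ℝ (Set.range fun i => ((Module.finBasis ℝ 𝔠 i : 𝔠) :
        Matrix (Fin n) (Fin n) ℝ)) = 𝔠 := fun 𝔠 => by
    have h1 := congrArg (Submodule.map 𝔠.subtype) (Module.finBasis ℝ 𝔠).span_eq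
    rw [Submodule.map_span, Submodule.map_subtype_top, ← Set.range_comp] at h1
    exact h1
  have hli : ∀ (𝔠 : Submodule ℝ (Matrix (Fin n) (Fin n) ℝ)),
      LinearIndependent ℝ fun i => ((Module.finBasis ℝ 𝔠 i : 𝔠) : Matrix (Fin n) (Fin n) ℝ) :=
    fun 𝔠 => (Module.finBasis ℝ 𝔠).linearIndependent.map' 𝔠.subtype (Submodule.ker_subtype _)
  let v : Fin (Module.finrank ℝ 𝔞) ⊕ Fin (Module.finrank ℝ 𝔟) → Matrix (Fin n) (Fin n) ℝ :=
    Sum.elim (fun i => (ba i : Matrix (Fin n) (Fin n) ℝ)) fun i => (bb i : Matrix (Fin n) (Fin n) ℝ)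
  have hv : LinearIndependent ℝ v :=
    (hli 𝔞).sum_type (hli 𝔟) (by rw [hspan, hspan]; exact hd)
  have hvs : lieAlg p ⊤ ≤ Submodule.span ℝ (Set.range v) := by
    rw [Set.Sum.elim_range, Submodule.span_union]
    change _ ≤ Submodule.span ℝ (Set.range fun i => ((Module.finBasis ℝ 𝔞 i : 𝔞) :
        Matrix (Fin n) (Fin n) ℝ)) ⊔ Submodule.span ℝ (Set.range fun i =>
          ((Module.finBasis ℝ 𝔟 i : 𝔟) : Matrix (Fin n) (Fin n) ℝ))
    rw [hspan, hspan]
    exact hs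
  have hmem : ∀ i, v i ∈ lieSet p ⊤ := by
    rintro (i | i)
    · exact ha _ (ba i).2
    · exact hb _ (bb i).2
  choose γ hγ using fun i => hp.exists_isOneParam (hmem i)
  let L : List (Fin (Module.finrank ℝ 𝔞) ⊕ Fin (Module.finrank ℝ 𝔟)) :=
    (List.finRange _).map Sum.inl ++ (List.finRange _).map Sum.inr
  have hL : (L : Multiset (Fin (Module.finrank ℝ 𝔞) ⊕ Fin (Module.finrank ℝ 𝔟))) =
      Finset.univ.val := by
    have hnd : L.Nodup := by
      refine List.Nodup.append ((List.nodup_finRange _).map Sum.inl_injective)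
        ((List.nodup_finRange _).map Sum.inr_injective) ?_
      intro x hx hx'
      simp only [List.mem_map] at hx hx'
      obtain ⟨i, -, rfl⟩ := hx
      obtain ⟨j, -, h⟩ := hx'
      cases h
    have : Finset.mk (Multiset.ofList L) (Multiset.coe_nodup.2 hnd) = Finset.univ := by
      rw [Finset.eq_univ_iff_forall]
      rintro (i | i)
      · exact List.mem_append_left _ (List.mem_map_of_mem (List.mem_finRange i))
      · exact List.mem_append_right _ (List.mem_map_of_mem (List.mem_finRange i))
    rw [← this]
  obtain ⟨ξ, hξ, hξ1, hev⟩ := hp.exists_coordinates hv hvs hγ hL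
  refine ⟨_, _, fun i => ba i, fun i => bb i, fun i => γ (Sum.inl i), fun i => γ (Sum.inr i),
    fun y i => ξ y (Sum.inl i), fun y i => ξ y (Sum.inr i), fun i => ⟨(ba i).2, hγ (Sum.inl i)⟩,
    fun i => ⟨(bb i).2, hγ (Sum.inr i)⟩, ?_, ?_, ?_, ?_, ?_⟩
  · exact contDiffAt_pi.2 fun i => contDiffAt_pi.1 hξ _
  · exact contDiffAt_pi.2 fun i => contDiffAt_pi.1 hξ _
  · ext i; exact congrFun hξ1 _
  · ext i; exact congrFun hξ1 _
  · filter_upwards [hev] with g hg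
    simpa [L, Function.comp_def] using hg

theorem IsRealReductive.isOpen_expSubgroup {p : G →* GL (Fin n) ℝ} (hp : IsRealReductive p) :
    IsOpen (expSubgroup p : Set G) := by
  obtain ⟨r, s, a, b, γa, γb, ξ, η, hγa, hγb, -, -, -, -, hev⟩ :=
    hp.exists_adapted_coordinates (𝔞 := lieAlg p ⊤) (𝔟 := ⊥)
      (fun Y hY => (hp.mem_lieAlg isClosed_univ).1 hY)
      (fun Y hY => (hp.mem_lieAlg isClosed_univ).1 (by
        rw [(Submodule.mem_bot ℝ).1 hY]; exact zero_mem _))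
      disjoint_bot_right le_sup_left
  have hbot : ∀ Y ∈ (⊥ : Submodule ℝ (Matrix (Fin n) (Fin n) ℝ)), Y ∈ lieSet p ⊤ :=
    fun Y hY => (hp.mem_lieAlg isClosed_univ).1 (by
        rw [(Submodule.mem_bot ℝ).1 hY]; exact zero_mem _)
  refine Subgroup.isOpen_of_mem_nhds _ (g := 1) ?_
  filter_upwards [hev] with g hg
  rw [hg]
  refine Subgroup.mul_mem _ (Subgroup.list_prod_mem _ ?_) (Subgroup.list_prod_mem _ ?_)
  · intro x hx
    obtain ⟨i, -, rfl⟩ := List.mem_map.1 hx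
    exact (hγa i).2.mem_expSubgroup ((hp.mem_lieAlg isClosed_univ).1 (hγa i).1) _
  · intro x hx
    obtain ⟨i, -, rfl⟩ := List.mem_map.1 hx
    exact (hγb i).2.mem_expSubgroup (hbot _ (hγb i).1) _

/-- The open subgroup generated by one-parameter subgroups has finite index, as `G` has finitely
many components. -/
theorem IsRealReductive.exists_pow_mem_expSubgroup {p : G →* GL (Fin n) ℝ}
    (hp : IsRealReductive p) (g : G) : ∃ N, 0 < N ∧ g ^ N ∈ expSubgroup p := by
  have hop := hp.isOpen_expSubgroup
  have hcont : Continuous (QuotientGroup.mk : G → G ⧸ expSubgroup p) :=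
    QuotientGroup.continuous_mk
  have hdisc : DiscreteTopology (G ⧸ expSubgroup p) := QuotientGroup.discreteTopology hop
  have hfin : Finite (G ⧸ expSubgroup p) := by
    have := hp.finite_components
    refine Finite.of_surjective hcont.connectedComponentsLift ?_
    intro x
    obtain ⟨y, rfl⟩ := QuotientGroup.mk_surjective x
    exact ⟨(y : ConnectedComponents G), by simp⟩
  have hidx : (expSubgroup p).index ≠ 0 := by
    have : Fintype (G ⧸ expSubgroup p) := Fintype.ofFinite _
    rw [Subgroup.index, Nat.card_eq_fintype_card]
    exact Fintype.card_ne_zero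
  obtain ⟨N, hN, -, h⟩ := Subgroup.exists_pow_mem_of_index_ne_zero hidx g
  exact ⟨N, hN, h⟩

end Polar

section PolarDecomposition

variable {n : ℕ} {G : Type*} [Group G]

/-- The Lie algebra is closed under commutators: differentiate `exp(-tA) C exp(tA)` at `0`. -/
theorem mul_sub_mul_mem_lieAlg {p : G →* GL (Fin n) ℝ} {A C : Matrix (Fin n) (Fin n) ℝ}
    (hA : A ∈ lieSet p ⊤) (hC : C ∈ lieAlg p ⊤) : C * A - A * C ∈ lieAlg p ⊤ := by
  have h1 : HasDerivAt (fun t : ℝ => NormedSpace.exp ((-t) • A)) (-A) 0 := by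
    have h := hasDerivAt_exp_smul_zero (-A)
    simpa only [smul_neg, ← neg_smul] using h
  have h2 : HasDerivAt (fun t : ℝ => NormedSpace.exp ((-t) • A) * C * NormedSpace.exp (t • A))
      (C * A - A * C) 0 := by
    refine (HasDerivAt.mul (𝔸 := Matrix (Fin n) (Fin n) ℝ) (HasDerivAt.mul_const
      (𝔸 := Matrix (Fin n) (Fin n) ℝ) h1 C) (hasDerivAt_exp_smul_zero A)).congr_deriv ?_
    simp only [zero_smul, NormedSpace.exp_zero, neg_zero]
    noncomm_ring
  have hcl : IsClosed (lieAlg p ⊤ : Set (Matrix (Fin n) (Fin n) ℝ)) :=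
    (lieAlg p ⊤).closed_of_finiteDimensional
  refine hcl.mem_of_tendsto h2.tendsto_slope_zero (Eventually.of_forall fun t => ?_)
  refine Submodule.smul_mem _ _ (sub_mem ?_ ?_)
  · exact conj_exp_mem_lieAlg hA hC _
  · exact conj_exp_mem_lieAlg hA hC _

variable [TopologicalSpace G] [IsTopologicalGroup G] [T2Space G]

/-- A symmetric matrix which commutes with the Lie algebra, is orthogonal to it for the trace form,
and whose exponential lies in the group, vanishes. The characters `∏ |det(x on ker(T - μ))|^μ` of
the centralizer of `T` are trivial on the subgroup generated by exponentials, which contains a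
power of `exp T`; on `exp T` the product is `exp(tr T²)`. -/
theorem IsRealReductive.eq_zero_of_orthogonal {p : G →* GL (Fin n) ℝ} (hp : IsRealReductive p)
    {T : Matrix (Fin n) (Fin n) ℝ} (hT : T.IsSymm) (hcomm : ∀ A ∈ lieSet p ⊤, Commute A T)
    (htr : ∀ A ∈ lieSet p ⊤, (A * T).trace = 0) {z : G}
    (hz : (p z).val = NormedSpace.exp T) : T = 0 := by
  obtain ⟨V, e, hV, hTe⟩ := exists_orthogonal_diagonal hT
  let s : Finset ℝ := Finset.univ.image e
  -- the spectral projections of `T`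
  let Pr : ℝ → Matrix (Fin n) (Fin n) ℝ := fun μ =>
    V * Matrix.diagonal (fun j => if e j = μ then (1 : ℝ) else 0) * V.transpose
  have hPr : ∀ μ, Pr μ * Pr μ = Pr μ := fun μ => by
    have h1 : Matrix.diagonal (fun j => if e j = μ then (1 : ℝ) else 0) *
        Matrix.diagonal (fun j => if e j = μ then (1 : ℝ) else 0) =
        Matrix.diagonal (fun j => if e j = μ then (1 : ℝ) else 0) := by
      rw [Matrix.diagonal_mul_diagonal]
      congr 1
      ext j
      split_ifs <;> simp
    calc Pr μ * Pr μ = V * (Matrix.diagonal (fun j => if e j = μ then (1 : ℝ) else 0) *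
          (V.transpose * V) * Matrix.diagonal (fun j => if e j = μ then (1 : ℝ) else 0)) *
          V.transpose := by simp only [Pr, mul_assoc]
      _ = _ := by rw [hV, mul_one, h1]
  have hsum : ∑ μ ∈ s, μ • Pr μ = T := by
    simp only [Pr]
    have h1 : ∀ μ : ℝ, μ • (V * Matrix.diagonal (fun j => if e j = μ then (1 : ℝ) else 0) *
        V.transpose) = V * (μ • Matrix.diagonal (fun j => if e j = μ then (1 : ℝ) else 0)) *
        V.transpose := fun μ => by rw [mul_smul_comm, smul_mul_assoc]
    rw [hTe, Finset.sum_congr rfl fun μ _ => h1 μ, ← Finset.sum_mul, ← Finset.mul_sum]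
    congr 2
    ext i j
    rw [Matrix.sum_apply]
    simp only [Matrix.smul_apply, Matrix.diagonal_apply, smul_eq_mul]
    by_cases hij : i = j
    · simp only [hij, if_true, mul_ite, mul_one, mul_zero]
      rw [Finset.sum_ite_eq]
      simp [s]
    · simp [hij]
  have hcommPr : ∀ A, Commute A T → ∀ μ, Commute A (Pr μ) := fun A hA μ => by
    rw [hTe, commute_diagonalized_iff hV] at hA
    rw [commute_diagonalized_iff hV]
    intro i j
    by_cases hij : e i = e j
    · rw [hij, mul_comm]
    · have h1 := hA i j
      have h2 : (V.transpose * A * V) i j = 0 := by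
        have h3 : (V.transpose * A * V) i j * (e j - e i) = 0 := by linear_combination h1
        rcases mul_eq_zero.1 h3 with h | h
        · exact h
        · exact absurd (sub_eq_zero.1 h).symm hij
      rw [h2, zero_mul, mul_zero]
  clear_value Pr
  -- the determinant of `x` on the `μ`-eigenspace of `T`
  let D : ℝ → Matrix (Fin n) (Fin n) ℝ → ℝ := fun μ x => (x * Pr μ + (1 - Pr μ)).det
  have hDexp : ∀ A, Commute A T → ∀ μ, D μ (NormedSpace.exp A) = Real.exp (A * Pr μ).trace :=
    fun A hA μ => by
      rw [← det_exp_eq, ← exp_mul_proj (hPr μ) (hcommPr A hA μ)]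
  have hDmul : ∀ μ x y, Commute y (Pr μ) → D μ (x * y) = D μ x * D μ y := fun μ x y hy => by
    simp only [D]
    rw [← Matrix.det_mul]
    congr 1
    have h1 : Pr μ * y * Pr μ = y * Pr μ := by rw [← hy.eq, mul_assoc, hPr]
    have h2 : (1 - Pr μ) * (y * Pr μ) = 0 := by
      rw [sub_mul, one_mul, ← mul_assoc (Pr μ), h1, sub_self]
    have h3 : Pr μ * (1 - Pr μ) = 0 := by rw [mul_sub, mul_one, hPr, sub_self]
    have h4 : (1 - Pr μ) * (1 - Pr μ) = 1 - Pr μ := by rw [sub_mul, one_mul, h3, sub_zero]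
    calc x * y * Pr μ + (1 - Pr μ) = x * (Pr μ * y * Pr μ) + x * (Pr μ * (1 - Pr μ)) +
          (1 - Pr μ) * (y * Pr μ) + (1 - Pr μ) * (1 - Pr μ) := by
            rw [h1, h2, h3, h4, mul_zero, add_zero, add_zero, mul_assoc]
      _ = _ := by simp only [add_mul, mul_add, mul_assoc]; abel
  have hD1 : ∀ μ, D μ 1 = 1 := fun μ => by simp [D]
  have hlog : ∀ A, Commute A T →
      ∑ μ ∈ s, μ * Real.log |D μ (NormedSpace.exp A)| = (A * T).trace := fun A hA => by
    rw [← hsum, Finset.mul_sum, Matrix.trace_sum]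
    refine Finset.sum_congr rfl fun μ _ => ?_
    rw [hDexp A hA, abs_of_pos (Real.exp_pos _), Real.log_exp, mul_smul_comm, Matrix.trace_smul,
      smul_eq_mul]
  have hclos : ∀ g ∈ expSubgroup p, (∀ μ, Commute (p g).val (Pr μ)) ∧ (∀ μ, D μ (p g).val ≠ 0) ∧
      ∑ μ ∈ s, μ * Real.log |D μ (p g).val| = 0 := by
    intro g hg
    induction hg using Subgroup.closure_induction with
    | mem g hg =>
      obtain ⟨Y, hY, γ, hγ, t, rfl⟩ := hg
      have hc : Commute (t • Y) T := (hcomm Y hY).smul_left t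
      rw [hγ t]
      refine ⟨fun μ => (hcommPr _ hc μ).exp_left, fun μ => ?_, ?_⟩
      · rw [hDexp _ hc]; exact (Real.exp_pos _).ne'
      · rw [hlog _ hc, smul_mul_assoc, Matrix.trace_smul, htr Y hY, smul_zero]
    | one => simp [hD1]
    | mul a b _ _ ha hb =>
      rw [map_mul, Units.val_mul]
      refine ⟨fun μ => (ha.1 μ).mul_left (hb.1 μ), fun μ => ?_, ?_⟩
      · rw [hDmul _ _ _ (hb.1 μ)]; exact mul_ne_zero (ha.2.1 μ) (hb.2.1 μ)
      · have : ∀ μ ∈ s, μ * Real.log |D μ ((p a).val * (p b).val)| =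
            μ * Real.log |D μ (p a).val| + μ * Real.log |D μ (p b).val| := fun μ _ => by
          rw [hDmul _ _ _ (hb.1 μ), abs_mul, Real.log_mul (abs_ne_zero.2 (ha.2.1 μ))
            (abs_ne_zero.2 (hb.2.1 μ)), mul_add]
        rw [Finset.sum_congr rfl this, Finset.sum_add_distrib, ha.2.2, hb.2.2, add_zero]
    | inv a _ ha =>
      have h1 : ∀ μ, D μ (p a⁻¹).val * D μ (p a).val = 1 := fun μ => by
        rw [← hDmul _ _ _ (ha.1 μ), ← Units.val_mul, ← map_mul, inv_mul_cancel]
        simp [hD1]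
      have h2 : ∀ μ, D μ (p a⁻¹).val = (D μ (p a).val)⁻¹ := fun μ =>
        eq_inv_of_mul_eq_one_left (h1 μ)
      refine ⟨fun μ => ?_, fun μ => ?_, ?_⟩
      · rw [map_inv]; exact (ha.1 μ).units_inv_left
      · rw [h2]; exact inv_ne_zero (ha.2.1 μ)
      · simp only [h2, abs_inv, Real.log_inv, mul_neg, Finset.sum_neg_distrib, ha.2.2, neg_zero]
  obtain ⟨N, hN, hzN⟩ := hp.exists_pow_mem_expSubgroup z
  have h1 : (p (z ^ N)).val = NormedSpace.exp ((N : ℝ) • T) := by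
    rw [map_pow, Units.val_pow_eq_pow_val, hz, ← Matrix.exp_nsmul, Nat.cast_smul_eq_nsmul]
  have h2 := (hclos _ hzN).2.2
  rw [h1, hlog _ ((Commute.refl T).smul_left _), smul_mul_assoc, Matrix.trace_smul,
    smul_eq_mul] at h2
  have h3 : (T * T).trace = 0 := by
    rcases mul_eq_zero.1 h2 with h | h
    · exact absurd (Nat.cast_eq_zero.1 h) hN.ne'
    · exact h
  exact eq_zero_of_trace_mul_transpose (by rwa [hT.eq])

/-- The polar decomposition `G = K exp(𝔭)`. -/
theorem IsRealReductive.exists_polar {p : G →* GL (Fin n) ℝ} (hp : IsRealReductive p) (g : G) :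
    ∃ k ∈ maxCompact p, ∃ Y ∈ lieSet p ⊤, ∃ γ : Multiplicative ℝ →ₜ* G, IsOneParam p Y γ ∧
      g = k * γ (Multiplicative.ofAdd 1) := by
  have hmem : ∀ {A}, A ∈ lieAlg p ⊤ ↔ A ∈ lieSet p ⊤ := hp.mem_lieAlg isClosed_univ
  obtain ⟨g', hg'⟩ := hp.transpose_mem g
  set a := (p g).val with ha
  have hP : (p (g' * g)).val = a.transpose * a := by rw [map_mul, Units.val_mul, hg']
  obtain ⟨U, d, hU, hPd⟩ := exists_orthogonal_diagonal
    (X := a.transpose * a) (Matrix.isSymm_transpose_mul_self a)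
  have hU' : U * U.transpose = 1 := mul_eq_one_comm.1 hU
  have hdiag : Matrix.diagonal d = (a * U).transpose * (a * U) := by
    calc Matrix.diagonal d = (U.transpose * U) * Matrix.diagonal d * (U.transpose * U) := by
          rw [hU, one_mul, mul_one]
      _ = U.transpose * (U * Matrix.diagonal d * U.transpose) * U := by simp only [mul_assoc]
      _ = _ := by rw [← hPd, Matrix.transpose_mul]; simp only [mul_assoc]
  have hdpos : ∀ i, 0 < d i := fun i => by
    have h1 : 0 ≤ d i := by
      have := congrFun (congrFun hdiag i) i
      rw [Matrix.diagonal_apply_eq, Matrix.mul_apply] at this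
      rw [this]
      exact Finset.sum_nonneg fun j _ => mul_self_nonneg _
    have h2 : ∏ i, d i ≠ 0 := by
      rw [← Matrix.det_diagonal, hdiag, Matrix.det_mul, Matrix.det_transpose, Matrix.det_mul]
      have h3 : a.det ≠ 0 := ((Matrix.isUnit_iff_isUnit_det a).1 (p g).isUnit).ne_zero
      have h4 : U.det ≠ 0 := fun h => by
        have := congrArg Matrix.det hU
        rw [Matrix.det_mul, h, mul_zero, Matrix.det_one] at this
        exact zero_ne_one this
      exact mul_ne_zero (mul_ne_zero h3 h4) (mul_ne_zero h3 h4)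
    exact lt_of_le_of_ne h1 (Finset.prod_ne_zero_iff.1 h2 i (Finset.mem_univ i)).symm
  -- `S` is the symmetric logarithm of `aᵀ a`.
  let ℓ : Fin n → ℝ := fun i => Real.log (d i)
  set S := U * Matrix.diagonal ℓ * U.transpose with hS
  have hSs : S.IsSymm := by
    rw [Matrix.IsSymm, hS]
    simp [Matrix.transpose_mul, mul_assoc]
  have hexpS : NormedSpace.exp S = a.transpose * a := by
    have h1 := exp_smul_diagonalized hU ℓ 1
    rw [one_smul] at h1
    rw [hS, h1, hPd]
    simp only [ℓ, one_mul, Real.exp_log (hdpos _)]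
  have hpS : p (g' * g) = expGL S := by ext1; rw [hP, expGL_val, hexpS]
  have hw : ∀ A ∈ lieAlg p ⊤,
      entryMul U (fun i j => Real.exp (1 * (ℓ j - ℓ i))) A ∈ lieAlg p ⊤ := fun A hA => by
    rw [← exp_conj_eq_entryMul hU, ← hS]
    have h1 := conj_mem p ⊤ (Subgroup.mem_top (g' * g)⁻¹) hA
    rw [conj_apply, map_inv, hpS, inv_inv, expGL_inv, expGL_val, expGL_val] at h1
    simpa using h1
  -- `Ad(exp S)` preserves the Lie algebra, hence so does its logarithm `ad S`.
  have hS𝔤 : ∀ A ∈ lieAlg p ⊤, A * S - S * A ∈ lieAlg p ⊤ := fun A hA => by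
    have h1 := entryMul_comp_mem hU hw Real.log A hA
    have h2 : entryMul U (fun i j => Real.log (Real.exp (1 * (ℓ j - ℓ i)))) A = A * S - S * A := by
      rw [entryMul_eq_iff hU]
      intro i j
      have h3 : U.transpose * (A * S - S * A) * U = (U.transpose * A * U) * Matrix.diagonal ℓ -
          Matrix.diagonal ℓ * (U.transpose * A * U) := by
        calc _ = (U.transpose * A * U) * Matrix.diagonal ℓ * (U.transpose * U) -
            (U.transpose * U) * Matrix.diagonal ℓ * (U.transpose * A * U) := by
              rw [hS]; simp only [mul_sub, sub_mul, mul_assoc]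
          _ = _ := by rw [hU, mul_one, one_mul]
      rw [h3, Matrix.sub_apply, Matrix.mul_diagonal, Matrix.diagonal_mul, Real.log_exp]
      ring
    rwa [h2] at h1
  -- `S₁` is the projection of `S` to the Lie algebra. The difference `S - S₁` commutes with the Lie
  -- algebra and is orthogonal to it, so it vanishes and `S` is in the Lie algebra.
  obtain ⟨S₁, hS₁, horth⟩ := exists_trace_orthogonal (lieAlg p ⊤) S
  have horth' : ∀ C ∈ lieAlg p ⊤, ((S - S₁) * C).trace = 0 := fun C hC => by
    have := horth _ (hp.transpose_mem_lieAlg hC)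
    rwa [Matrix.transpose_transpose] at this
  have hS₁s : S₁.IsSymm := by
    have h1 : S₁ - S₁.transpose ∈ lieAlg p ⊤ := sub_mem hS₁ (hp.transpose_mem_lieAlg hS₁)
    have h2 : ∀ C ∈ lieAlg p ⊤, ((S - S₁.transpose) * C.transpose).trace = 0 := fun C hC => by
      rw [← Matrix.trace_transpose, Matrix.transpose_mul, Matrix.transpose_transpose,
        Matrix.transpose_sub, Matrix.transpose_transpose, hSs.eq, Matrix.trace_mul_comm]
      exact horth' C hC
    have h3 : S₁ - S₁.transpose = 0 := by
      apply eq_zero_of_trace_mul_transpose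
      have h4 := h2 _ h1
      have h5 := horth _ h1
      have h6 : S₁ - S₁.transpose = (S - S₁.transpose) - (S - S₁) := by abel
      calc _ = (((S - S₁.transpose) - (S - S₁)) * (S₁ - S₁.transpose).transpose).trace := by
            rw [← h6]
        _ = 0 := by rw [sub_mul, Matrix.trace_sub, h4, h5, sub_zero]
    exact (sub_eq_zero.1 h3).symm
  have hcomm : ∀ A ∈ lieSet p ⊤, Commute A (S - S₁) := fun A hA => by
    have hA' := hmem.2 hA
    have h1 : A * (S - S₁) - (S - S₁) * A ∈ lieAlg p ⊤ := by
      have h2 : A * (S - S₁) - (S - S₁) * A = (A * S - S * A) - (A * S₁ - S₁ * A) := by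
        noncomm_ring
      rw [h2]
      exact sub_mem (hS𝔤 A hA') (mul_sub_mul_mem_lieAlg (hmem.1 hS₁) hA')
    have h3 : A * (S - S₁) - (S - S₁) * A = 0 := by
      apply eq_zero_of_trace_mul_transpose
      set C := A * (S - S₁) - (S - S₁) * A with hC
      have h4 := horth' _ (mul_sub_mul_mem_lieAlg hA (hp.transpose_mem_lieAlg h1))
      have h5 : (C * C.transpose).trace =
          ((S - S₁) * (C.transpose * A - A * C.transpose)).trace := by
        have h6 : ∀ R F : Matrix (Fin n) (Fin n) ℝ,
            ((A * R - R * A) * F).trace = (R * (F * A - A * F)).trace := fun R F => by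
          rw [sub_mul, mul_sub, Matrix.trace_sub, Matrix.trace_sub, mul_assoc A,
            Matrix.trace_mul_comm A, mul_assoc, mul_assoc]
        exact h6 _ _
      rw [h5]
      exact h4
    exact sub_eq_zero.1 h3
  have hSS₁ : Commute S (-S₁) := by
    have h1 : Commute S₁ (S - S₁ + S₁) := (hcomm S₁ (hmem.1 hS₁)).add_right (Commute.refl _)
    rw [sub_add_cancel] at h1
    exact h1.symm.neg_right
  obtain ⟨γ₁, hγ₁⟩ := hp.exists_isOneParam (hmem.1 hS₁)
  have hz : (p (g' * g * γ₁ (Multiplicative.ofAdd (-1)))).val = NormedSpace.exp (S - S₁) := by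
    rw [map_mul, Units.val_mul, hγ₁, hpS, expGL_val, neg_one_smul, sub_eq_add_neg,
      Matrix.exp_add_of_commute _ _ hSS₁]
  have hS0 := hp.eq_zero_of_orthogonal
    (T := S - S₁) (by rw [Matrix.IsSymm, Matrix.transpose_sub, hSs.eq, hS₁s.eq]) hcomm
    (fun A hA => by rw [Matrix.trace_mul_comm]; exact horth' A (hmem.2 hA)) hz
  have hSg : (1 / 2 : ℝ) • S ∈ lieSet p ⊤ := by
    rw [sub_eq_zero.1 hS0]
    exact hmem.1 (Submodule.smul_mem _ _ hS₁)
  obtain ⟨γ, hγ⟩ := hp.exists_isOneParam hSg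
  refine ⟨g * γ (Multiplicative.ofAdd (-1)), ?_, _, hSg, γ, hγ, ?_⟩
  · change (p (g * γ (Multiplicative.ofAdd (-1)))).val.transpose *
      (p (g * γ (Multiplicative.ofAdd (-1)))).val = 1
    set x := (-1 : ℝ) • ((1 / 2 : ℝ) • S) with hx
    have h1 : (p (g * γ (Multiplicative.ofAdd (-1)))).val = a * NormedSpace.exp x := by
      rw [map_mul, Units.val_mul, hγ]
    have hxs : x.transpose = x := by rw [hx, Matrix.transpose_smul, Matrix.transpose_smul, hSs.eq]
    have h2 : NormedSpace.exp S = NormedSpace.exp (-x) * NormedSpace.exp (-x) := by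
      rw [← Matrix.exp_add_of_commute _ _ (Commute.refl (-x))]
      congr 1
      rw [hx, smul_smul, ← neg_smul, ← add_smul]
      norm_num
    have h3 : NormedSpace.exp x * NormedSpace.exp (-x) = 1 := by
      have := (expGL x).mul_inv
      rwa [expGL_inv] at this
    have h4 : NormedSpace.exp (-x) * NormedSpace.exp x = 1 := mul_eq_one_comm.1 h3
    rw [h1, Matrix.transpose_mul, ← Matrix.exp_transpose, hxs]
    calc _ = NormedSpace.exp x * (a.transpose * a) * NormedSpace.exp x := by
          simp only [mul_assoc]
      _ = (NormedSpace.exp x * NormedSpace.exp (-x)) *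
          (NormedSpace.exp (-x) * NormedSpace.exp x) := by
          rw [← hexpS, h2]; simp only [mul_assoc]
      _ = 1 := by rw [h3, h4, mul_one]
  · rw [mul_assoc, ← oneParam_add, neg_add_cancel, oneParam_zero, mul_one]

end PolarDecomposition

/-! ### The decomposition `G = KQ` and continuity of sections -/

section Iwasawa

open scoped Pointwise

variable {n : ℕ} {G : Type*} [Group G]

theorem exists_disjoint_le_sup {R M : Type*} [DivisionRing R] [AddCommGroup M] [Module R M]
    (𝔨 𝔮 : Submodule R M) : ∃ 𝔞 ≤ 𝔨, Disjoint 𝔞 𝔮 ∧ 𝔨 ≤ 𝔞 ⊔ 𝔮 := by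
  obtain ⟨c, hc⟩ := exists_isCompl (𝔨 ⊓ 𝔮)
  refine ⟨c ⊓ 𝔨, inf_le_right, ?_, ?_⟩
  · rw [disjoint_iff, inf_assoc]
    exact hc.symm.inf_eq_bot
  · have h0 : 𝔨 ⊓ 𝔮 ≤ 𝔨 := inf_le_left
    have h1 := sup_inf_assoc_of_le c h0
    rw [hc.sup_eq_top, top_inf_eq] at h1
    conv_lhs => rw [h1]
    exact sup_le (inf_le_right.trans le_sup_right) le_sup_left

theorem lieSet_mono {p : G →* GL (Fin n) ℝ} {Γ Γ' : Subgroup G} (h : Γ ≤ Γ') :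
    lieSet p Γ ⊆ lieSet p Γ' := fun Y hY t => by
  obtain ⟨g, hg, hgt⟩ := hY t
  exact ⟨g, h hg, hgt⟩

variable [TopologicalSpace G]

theorem IsOneParam.mem_maxCompact {p : G →* GL (Fin n) ℝ} {Y : Matrix (Fin n) (Fin n) ℝ}
    {γ : Multiplicative ℝ →ₜ* G} (h : IsOneParam p Y γ) (hY : Y ∈ lieSet p (maxCompact p))
    (t : ℝ) : γ (Multiplicative.ofAdd t) ∈ maxCompact p :=
  h.mem (fun g hg g' hgg' => by
    change (p g').val.transpose * (p g').val = 1
    rw [← hgg']; exact hg) hY t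

theorem IsOneParam.mem_parabolic {p : G →* GL (Fin n) ℝ} {Y : Matrix (Fin n) (Fin n) ℝ}
    {γ : Multiplicative ℝ →ₜ* G} (h : IsOneParam p Y γ) {Q : Subgroup G} (hQ : IsParabolic p Q)
    (hY : Y ∈ lieSet p Q) (t : ℝ) : γ (Multiplicative.ofAdd t) ∈ Q :=
  h.mem (fun _ hg _ hgg' => hQ.mem_of_map_eq hg hgg') hY t

variable [IsTopologicalGroup G]

theorem IsParabolic.lieAlg_le {p : G →* GL (Fin n) ℝ} (hp : IsRealReductive p) {Q : Subgroup G}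
    (hQ : IsParabolic p Q) : lieAlg p ⊤ ≤ lieAlg p (maxCompact p) ⊔ lieAlg p Q := fun Y hY => by
  obtain ⟨Z, hZ, W, hW, rfl⟩ := hQ.exists_add hp ((hp.mem_lieAlg isClosed_univ).1 hY)
  exact Submodule.add_mem_sup (Submodule.subset_span hZ) (Submodule.subset_span hW)

variable [T2Space G]

/-- Coordinates near the identity adapted to `𝔤 = 𝔨 + 𝔮`. -/
theorem IsParabolic.exists_coordinates {p : G →* GL (Fin n) ℝ} (hp : IsRealReductive p)
    {Q : Subgroup G} (hQ : IsParabolic p Q) :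
    ∃ (r s : ℕ) (a : Fin r → Matrix (Fin n) (Fin n) ℝ) (b : Fin s → Matrix (Fin n) (Fin n) ℝ)
      (γa : Fin r → Multiplicative ℝ →ₜ* G) (γb : Fin s → Multiplicative ℝ →ₜ* G)
      (ξ : Matrix (Fin n) (Fin n) ℝ → Fin r → ℝ) (η : Matrix (Fin n) (Fin n) ℝ → Fin s → ℝ),
      (∀ i, a i ∈ lieSet p (maxCompact p) ∧ IsOneParam p (a i) (γa i)) ∧
      (∀ i, b i ∈ lieSet p Q ∧ IsOneParam p (b i) (γb i)) ∧
      ContDiffAt ℝ ∞ ξ 1 ∧ ContDiffAt ℝ ∞ η 1 ∧ ξ 1 = 0 ∧ η 1 = 0 ∧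
      ∀ᶠ g in 𝓝 (1 : G), g =
        ((List.finRange r).map fun i => γa i (Multiplicative.ofAdd (ξ (p g).val i))).prod *
        ((List.finRange s).map fun i => γb i (Multiplicative.ofAdd (η (p g).val i))).prod := by
  have hK : ∀ {A}, A ∈ lieAlg p (maxCompact p) ↔ A ∈ lieSet p (maxCompact p) :=
    hp.mem_lieAlg hp.isClosed_maxCompact
  have hQm : ∀ {A}, A ∈ lieAlg p Q ↔ A ∈ lieSet p Q := hp.mem_lieAlg (hQ.isClosed hp)
  obtain ⟨𝔞, ha𝔞, hd, hs⟩ := exists_disjoint_le_sup (lieAlg p (maxCompact p)) (lieAlg p Q)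
  have hsup : lieAlg p ⊤ ≤ 𝔞 ⊔ lieAlg p Q :=
    (hQ.lieAlg_le hp).trans (sup_le hs le_sup_right)
  have h1 : ∀ Y ∈ 𝔞, Y ∈ lieSet p (maxCompact p) := fun Y hY =>
    hK.1 (ha𝔞 hY)
  have h2 : ∀ Y ∈ lieAlg p Q, Y ∈ lieSet p Q := fun Y hY => hQm.1 hY
  obtain ⟨r, s, a, b, γa, γb, ξ, η, ha, hb, hξ, hη, hξ1, hη1, hev⟩ :=
    hp.exists_adapted_coordinates
      (𝔞 := 𝔞) (𝔟 := lieAlg p Q)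
      (fun Y hY => lieSet_mono le_top (h1 Y hY)) (fun Y hY => lieSet_mono le_top (h2 Y hY)) hd hsup
  exact ⟨r, s, a, b, γa, γb, ξ, η, fun i => ⟨h1 _ (ha i).1, (ha i).2⟩,
    fun i => ⟨h2 _ (hb i).1, (hb i).2⟩, hξ, hη, hξ1, hη1, hev⟩

/-- `G = KQ`. The set `KQ` is open since `𝔤 = 𝔨 + 𝔮`, and closed since `K` is compact; so it
contains the connected set `k exp(ℝY)` for `k ∈ K`, and the polar decomposition applies. -/
theorem IsParabolic.exists_eq_mul {p : G →* GL (Fin n) ℝ} (hp : IsRealReductive p)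
    {Q : Subgroup G} (hQ : IsParabolic p Q) (g : G) :
    ∃ k ∈ maxCompact p, ∃ q ∈ Q, g = k * q := by
  set S : Set G := {g | ∃ k ∈ maxCompact p, ∃ q ∈ Q, g = k * q} with hS
  have h1 : S ∈ 𝓝 (1 : G) := by
    obtain ⟨r, s, a, b, γa, γb, ξ, η, ha, hb, -, -, -, -, hev⟩ := hQ.exists_coordinates hp
    filter_upwards [hev] with g hg
    refine ⟨_, ?_, _, ?_, hg⟩
    · refine Subgroup.list_prod_mem _ fun x hx => ?_
      obtain ⟨i, -, rfl⟩ := List.mem_map.1 hx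
      exact (ha i).2.mem_maxCompact (ha i).1 _
    · refine Subgroup.list_prod_mem _ fun x hx => ?_
      obtain ⟨i, -, rfl⟩ := List.mem_map.1 hx
      exact (hb i).2.mem_parabolic hQ (hb i).1 _
  have hopen : IsOpen S := by
    rw [isOpen_iff_mem_nhds]
    rintro x ⟨k, hk, q, hq, rfl⟩
    have hc : Tendsto (fun y => k⁻¹ * y * q⁻¹) (𝓝 (k * q)) (𝓝 1) := by
      have : Continuous fun y : G => k⁻¹ * y * q⁻¹ := by fun_prop
      simpa [← mul_assoc] using this.tendsto (k * q)
    filter_upwards [hc h1] with y hy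
    obtain ⟨k', hk', q', hq', h⟩ := hy
    refine ⟨k * k', mul_mem hk hk', q' * q, mul_mem hq' hq, ?_⟩
    calc y = k * (k⁻¹ * y * q⁻¹) * q := by group
      _ = k * (k' * q') * q := congrArg (fun z => k * z * q) h
      _ = _ := by group
  have hclosed : IsClosed S := by
    have : S = (maxCompact p : Set G) * (Q : Set G) := by
      ext x
      rw [Set.mem_mul]
      exact ⟨fun ⟨k, hk, q, hq, h⟩ => ⟨k, hk, q, hq, h.symm⟩,
        fun ⟨k, hk, q, hq, h⟩ => ⟨k, hk, q, hq, h.symm⟩⟩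
    rw [this]
    exact (hQ.isClosed hp).mul_left_of_isCompact hp.isCompact_maxCompact
  obtain ⟨k, hk, Y, -, γ, hγ, rfl⟩ := hp.exists_polar g
  have hclopen : IsClopen ((fun t : ℝ => k * γ (Multiplicative.ofAdd t)) ⁻¹' S) :=
    IsClopen.preimage ⟨hclosed, hopen⟩ (continuous_const.mul hγ.continuous)
  have huniv := hclopen.eq_univ ⟨0, k, hk, 1, Q.one_mem, congrArg (k * ·) (oneParam_zero γ)⟩
  exact huniv.ge (Set.mem_univ (1 : ℝ))

/-- Multiplication `K × Q → G` is a surjective closed map. -/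
theorem IsParabolic.isQuotientMap_mul {p : G →* GL (Fin n) ℝ} (hp : IsRealReductive p)
    {Q : Subgroup G} (hQ : IsParabolic p Q) :
    IsQuotientMap fun z : maxCompact p × Q => (z.1 : G) * z.2 := by
  have hK : CompactSpace (maxCompact p) := isCompact_iff_compactSpace.1 hp.isCompact_maxCompact
  have h1 : IsClosedMap fun z : maxCompact p × G => (z.1 : G) * z.2 := by
    let e : maxCompact p × G ≃ₜ maxCompact p × G :=
      { toFun := fun z => (z.1, z.1 * z.2)
        invFun := fun z => (z.1, (z.1 : G)⁻¹ * z.2)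
        left_inv := fun z => by simp
        right_inv := fun z => by simp
        continuous_toFun := by fun_prop
        continuous_invFun := by fun_prop }
    exact isClosedMap_snd_of_compactSpace.comp e.isClosedMap
  have h2 : IsClosedMap (Prod.map id Subtype.val : maxCompact p × Q → maxCompact p × G) :=
    (IsClosedEmbedding.id.prodMap (hQ.isClosed hp).isClosedEmbedding_subtypeVal).isClosedMap
  refine (h1.comp h2).isQuotientMap (f := fun z : maxCompact p × Q => (z.1 : G) * z.2)
    (by fun_prop) fun g => ?_
  obtain ⟨k, hk, q, hq, rfl⟩ := hQ.exists_eq_mul hp g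
  exact ⟨(⟨k, hk⟩, ⟨q, hq⟩), rfl⟩

theorem IsParabolic.compactSpace_quotient {p : G →* GL (Fin n) ℝ} (hp : IsRealReductive p)
    {Q : Subgroup G} (hQ : IsParabolic p Q) : CompactSpace (G ⧸ Q) := by
  have h1 := hp.isCompact_maxCompact.image (QuotientGroup.continuous_mk (N := Q))
  refine ⟨?_⟩
  convert h1
  refine (Set.eq_univ_of_forall fun x => ?_).symm
  obtain ⟨g, rfl⟩ := QuotientGroup.mk_surjective x
  obtain ⟨k, hk, q, hq, rfl⟩ := hQ.exists_eq_mul hp g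
  exact ⟨k, hk, (QuotientGroup.mk_mul_of_mem k hq).symm⟩

variable {W : Type*} [NormedAddCommGroup W] [NormedSpace ℂ W]

theorem IsContinuousRep.comp {Γ V X : Type*} [Group Γ] [TopologicalSpace Γ]
    [NormedAddCommGroup V] [NormedSpace ℂ V] [TopologicalSpace X] {ρ : Representation ℂ Γ V}
    (h : IsContinuousRep ρ) {a : X → Γ} {v : X → V} (ha : Continuous a) (hv : Continuous v) :
    Continuous fun x => ρ (a x) (v x) :=
  Continuous.comp (g := fun x : Γ × V => ρ x.1 x.2) h (ha.prodMk hv)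

/-- A section is continuous as soon as its restriction to `K` is. -/
theorem IsParabolic.continuous_section {p : G →* GL (Fin n) ℝ} (hp : IsRealReductive p)
    {Q : Subgroup G} (hQ : IsParabolic p Q) {ζ : Representation ℂ Q W} (hζ : IsContinuousRep ζ)
    {f : G → W} (hf : f ∈ equivSections ζ) (hc : Continuous fun k : maxCompact p => f k) :
    Continuous f := by
  rw [(hQ.isQuotientMap_mul hp).continuous_iff]
  have : (f ∘ fun z : maxCompact p × Q => (z.1 : G) * z.2) = fun z => ζ z.2⁻¹ (f z.1) :=
    funext fun z => hf _ _
  rw [this]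
  exact hζ.comp continuous_snd.inv (hc.comp continuous_fst)

/-- A section is determined by its restriction to `K`. -/
theorem IsParabolic.section_ext {p : G →* GL (Fin n) ℝ} (hp : IsRealReductive p)
    {Q : Subgroup G} (hQ : IsParabolic p Q) {ζ : Representation ℂ Q W}
    {f f' : G → W} (hf : f ∈ equivSections ζ) (hf' : f' ∈ equivSections ζ)
    (h : ∀ k ∈ maxCompact p, f k = f' k) : f = f' := by
  ext g
  obtain ⟨k, hk, q, hq, rfl⟩ := hQ.exists_eq_mul hp g
  rw [hf k ⟨q, hq⟩, hf' k ⟨q, hq⟩, h k hk]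

/-- A function on `K` with the equivariance of a section extends to a section. -/
theorem IsParabolic.exists_section {p : G →* GL (Fin n) ℝ} (hp : IsRealReductive p)
    {Q : Subgroup G} (hQ : IsParabolic p Q) {ζ : Representation ℂ Q W} {φ : maxCompact p → W}
    (hφ : ∀ (k : maxCompact p) (m : maxCompact p) (hm : (m : G) ∈ Q),
      φ (k * m) = ζ (⟨m, hm⟩⁻¹) (φ k)) :
    ∃ f ∈ equivSections ζ, ∀ k : maxCompact p, f k = φ k := by
  choose κ hκ θ hθ hκθ using hQ.exists_eq_mul hp
  have key : ∀ (k : maxCompact p) (q : Q), ζ (⟨θ (k * q), hθ _⟩⁻¹) (φ ⟨κ (k * q), hκ _⟩) =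
      ζ q⁻¹ (φ k) := by
    intro k q
    set x : G := k * q with hx
    have hm : ((k⁻¹ * ⟨κ x, hκ x⟩ : maxCompact p) : G) = q * (θ x)⁻¹ := by
      have := hκθ x
      change (k : G)⁻¹ * κ x = q * (θ x)⁻¹
      rw [eq_mul_inv_iff_mul_eq, mul_assoc, ← this, hx, inv_mul_cancel_left]
    have hmQ : ((k⁻¹ * ⟨κ x, hκ x⟩ : maxCompact p) : G) ∈ Q := by
      rw [hm]; exact mul_mem q.2 (inv_mem (hθ x))
    have h1 := hφ k (k⁻¹ * ⟨κ x, hκ x⟩) hmQ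
    rw [mul_inv_cancel_left] at h1
    rw [h1, ← Module.End.mul_apply, ← map_mul]
    congr 2
    apply Subtype.ext
    change (θ x)⁻¹ * ((k⁻¹ * ⟨κ x, hκ x⟩ : maxCompact p) : G)⁻¹ = (q : G)⁻¹
    rw [hm, mul_inv_rev, inv_inv, inv_mul_cancel_left]
  refine ⟨fun x => ζ (⟨θ x, hθ x⟩⁻¹) (φ ⟨κ x, hκ x⟩), fun g q => ?_, fun k => ?_⟩
  · obtain ⟨k, hk, q', hq', rfl⟩ := hQ.exists_eq_mul hp g
    have h1 := key ⟨k, hk⟩ (⟨q', hq'⟩ * q)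
    have h2 := key ⟨k, hk⟩ ⟨q', hq'⟩
    simp only [Subgroup.coe_mul, ← mul_assoc] at h1 h2 ⊢
    rw [h1, h2, mul_inv_rev, map_mul, Module.End.mul_apply]
  · have := key k 1
    simpa using this

end Iwasawa

/-! ### Smoothness of `K`-finite sections -/

section OneParameter

/-- A continuous one-parameter group in a Banach algebra is `t ↦ exp(tB)`. With
`M = ∫_0^δ c`, which is invertible for small `δ`, one has `c(t) M = ∫_t^{t+δ} c`. -/
theorem exists_eq_exp_smul {𝔸 : Type*} [NormedRing 𝔸] [NormedAlgebra ℝ 𝔸] [CompleteSpace 𝔸]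
    {c : ℝ → 𝔸} (hc : Continuous c) (h0 : c 0 = 1) (hadd : ∀ s t, c (s + t) = c s * c t) :
    ∃ B : 𝔸, ∀ t, c t = NormedSpace.exp (t • B) := by
  let I : ℝ → 𝔸 := fun t => ∫ s in (0 : ℝ)..t, c s
  have hI : ∀ t, HasDerivAt I (c t) t := fun t =>
    intervalIntegral.integral_hasDerivAt_right (hc.intervalIntegrable _ _)
      (hc.stronglyMeasurableAtFilter _ _) hc.continuousAt
  obtain ⟨δ, hδ, hunit⟩ : ∃ δ : ℝ, δ ≠ 0 ∧ IsUnit (δ⁻¹ • I δ) := by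
    have h1 : Tendsto (fun t : ℝ => t⁻¹ • (I (0 + t) - I 0)) (𝓝[≠] 0) (𝓝 (1 : 𝔸)) := by
      have := (hI 0).tendsto_slope_zero
      rwa [h0] at this
    have h2 : ∀ᶠ t in 𝓝[≠] (0 : ℝ), IsUnit (t⁻¹ • (I (0 + t) - I 0)) :=
      h1 (Units.isOpen.mem_nhds isUnit_one)
    obtain ⟨t, ht, ht0⟩ := (h2.and self_mem_nhdsWithin).exists
    refine ⟨t, ht0, ?_⟩
    have hI0 : I 0 = 0 := intervalIntegral.integral_same
    rwa [zero_add, hI0, sub_zero] at ht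
  obtain ⟨u, hu⟩ := hunit
  have hcI : ∀ t, c t * I δ = I (t + δ) - I t := fun t => by
    have h1 : c t * I δ = ∫ s in (0 : ℝ)..δ, c (t + s) := by
      simp only [hadd, I]
      exact ((ContinuousLinearMap.mul ℝ 𝔸 (c t)).intervalIntegral_comp_comm
        (hc.intervalIntegrable 0 δ)).symm
    rw [h1, intervalIntegral.integral_comp_add_left (fun s => c s) t, add_zero]
    rw [eq_sub_iff_add_eq, add_comm]
    exact intervalIntegral.integral_add_adjacent_intervals (hc.intervalIntegrable _ _)
      (hc.intervalIntegrable _ _)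
  let N : 𝔸 := δ⁻¹ • (u⁻¹ : 𝔸ˣ).val
  have hN : I δ * N = 1 := by
    simp only [N]
    rw [mul_smul_comm, ← smul_mul_assoc, ← hu, u.mul_inv]
  have hcN : ∀ t, c t = (I (t + δ) - I t) * N := fun t => by
    rw [← hcI, mul_assoc, hN, mul_one]
  let B : 𝔸 := (c δ - 1) * N
  have hder : ∀ t, HasDerivAt c (c t * B) t := fun t => by
    have h1 : HasDerivAt (fun t => (I (t + δ) - I t) * N) ((c (t + δ) - c t) * N) t :=
      (((hI (t + δ)).comp_add_const t δ).sub (hI t)).mul_const N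
    rw [← funext hcN] at h1
    refine h1.congr_deriv ?_
    rw [hadd, ← mul_assoc, mul_sub, mul_one]
  refine ⟨B, fun t => ?_⟩
  have hE : ∀ t, HasDerivAt (fun t : ℝ => c t * NormedSpace.exp (t • -B)) 0 t := fun t => by
    refine ((hder t).mul (hasDerivAt_exp_smul_const (-B) t)).congr_deriv ?_
    have h2 : NormedSpace.exp (t • -B) * -B = -B * NormedSpace.exp (t • -B) :=
      ((Commute.refl (-B)).smul_left t).exp_left.eq
    rw [h2, mul_assoc, ← mul_add, neg_mul, add_neg_cancel, mul_zero]
  have hconst := is_const_of_deriv_eq_zero (fun t => (hE t).differentiableAt)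
    (fun t => (hE t).deriv) t 0
  simp only [h0, zero_smul, NormedSpace.exp_zero, mul_one] at hconst
  let _ : NormedAlgebra ℚ 𝔸 := NormedAlgebra.restrictScalars ℚ ℝ 𝔸
  have hinv : NormedSpace.exp (t • -B) * NormedSpace.exp (t • B) = 1 := by
    rw [smul_neg, ← NormedSpace.exp_add_of_commute (Commute.refl (t • B)).neg_left,
      neg_add_cancel, NormedSpace.exp_zero]
  calc c t = c t * NormedSpace.exp (t • -B) * NormedSpace.exp (t • B) := by
        rw [mul_assoc, hinv, mul_one]
    _ = _ := by rw [hconst, one_mul]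

variable {Γ V : Type*} [Group Γ] [NormedAddCommGroup V] [NormedSpace ℂ V]
  [FiniteDimensional ℂ V]

/-- A continuous finite-dimensional representation, with values in continuous linear maps. -/
def repCLM (ρ : Representation ℂ Γ V) (x : Γ) : V →L[ℂ] V := LinearMap.toContinuousLinearMap (ρ x)

@[simp] theorem repCLM_apply (ρ : Representation ℂ Γ V) (x : Γ) (v : V) : repCLM ρ x v = ρ x v :=
  rfl

theorem repCLM_mul (ρ : Representation ℂ Γ V) (x y : Γ) :
    repCLM ρ (x * y) = repCLM ρ x * repCLM ρ y := by
  ext v; simp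

theorem repCLM_one (ρ : Representation ℂ Γ V) : repCLM ρ 1 = 1 := by
  ext v; simp

variable [TopologicalSpace Γ]

theorem IsContinuousRep.continuous_repCLM {ρ : Representation ℂ Γ V} (hρ : IsContinuousRep ρ) :
    Continuous (repCLM ρ) :=
  continuous_clm_apply.2 fun _ => hρ.comp continuous_id continuous_const

theorem IsContinuousRep.exists_eq_exp {ρ : Representation ℂ Γ V} (hρ : IsContinuousRep ρ)
    (γ : Multiplicative ℝ →ₜ* Γ) :
    ∃ B : V →L[ℂ] V, ∀ t : ℝ, repCLM ρ (γ (Multiplicative.ofAdd t)) = NormedSpace.exp (t • B) := by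
  have hcompl : CompleteSpace V := FiniteDimensional.complete ℂ V
  refine exists_eq_exp_smul (c := fun t : ℝ => repCLM ρ (γ (Multiplicative.ofAdd t))) ?_ ?_ ?_
  · exact hρ.continuous_repCLM.comp (γ.continuous_toFun.comp continuous_ofAdd)
  · rw [ofAdd_zero, map_one, repCLM_one]
  · intro s t
    rw [ofAdd_add, map_mul, repCLM_mul]

theorem IsContinuousRep.contDiffAt_oneParam {ρ : Representation ℂ Γ V} (hρ : IsContinuousRep ρ)
    (γ : Multiplicative ℝ →ₜ* Γ) {E : Type*} [NormedAddCommGroup E] [NormedSpace ℝ E] {s : E → ℝ}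
    {v : E → V} {x : E} (hs : ContDiffAt ℝ ∞ s x) (hv : ContDiffAt ℝ ∞ v x) :
    ContDiffAt ℝ ∞ (fun y => ρ (γ (Multiplicative.ofAdd (s y))) (v y)) x := by
  have hcompl : CompleteSpace V := FiniteDimensional.complete ℂ V
  obtain ⟨B, hB⟩ := hρ.exists_eq_exp γ
  have h1 : ContDiffAt ℝ ∞ (fun y => NormedSpace.exp (s y • B)) x :=
    contDiff_exp.contDiffAt.comp x (hs.smul contDiffAt_const)
  have h2 : ContDiffAt ℝ ∞ (fun y => (NormedSpace.exp (s y • B)).restrictScalars ℝ) x :=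
    (ContinuousLinearMap.restrictScalarsL ℂ V V ℝ ℝ).contDiff.contDiffAt.comp x h1
  have h3 := h2.clm_apply hv
  refine h3.congr_of_eventuallyEq (Eventually.of_forall fun y => ?_)
  change repCLM ρ _ (v y) = _
  rw [hB]
  rfl

theorem IsContinuousRep.contDiffAt_list_prod {ρ : Representation ℂ Γ V} (hρ : IsContinuousRep ρ)
    {ι : Type*} [Fintype ι] (L : List ι) (γ : ι → Multiplicative ℝ →ₜ* Γ)
    {E : Type*} [NormedAddCommGroup E]
    [NormedSpace ℝ E] {s : E → ι → ℝ} {v : E → V} {x : E} (hs : ContDiffAt ℝ ∞ s x)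
    (hv : ContDiffAt ℝ ∞ v x) :
    ContDiffAt ℝ ∞
      (fun y => ρ (L.map fun i => γ i (Multiplicative.ofAdd (s y i))).prod⁻¹ (v y)) x := by
  induction L generalizing v with
  | nil => simpa using hv
  | cons a L ih =>
    have h1 : ContDiffAt ℝ ∞ (fun y => -(s y a)) x := (contDiffAt_pi.1 hs a).neg
    refine (ih (hρ.contDiffAt_oneParam (γ a) h1 hv)).congr_of_eventuallyEq
      (Eventually.of_forall fun y => ?_)
    simp only [List.map_cons, List.prod_cons, mul_inv_rev, map_mul, Module.End.mul_apply, ofAdd_neg,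
      map_inv]

end OneParameter

section KFinite

variable {n : ℕ} {G : Type*} [Group G] [TopologicalSpace G] [IsTopologicalGroup G]
variable {W : Type*} [NormedAddCommGroup W] [NormedSpace ℂ W]

/-- A continuous `K`-finite function is, on `K`, a matrix coefficient of a continuous
finite-dimensional representation of `K`. -/
theorem IsKFinite.exists_rep {p : G →* GL (Fin n) ℝ} {f : G → W} (hf : IsKFinite p f)
    (hc : Continuous f) :
    ∃ (d : ℕ) (ρ : Representation ℂ (maxCompact p) (Fin d → ℂ)) (v : Fin d → ℂ)
      (ℓ : (Fin d → ℂ) →ₗ[ℂ] W), IsContinuousRep ρ ∧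
      ∀ k : maxCompact p, f k = ℓ (ρ k⁻¹ v) := by
  obtain ⟨F, hF, hfF⟩ := hf
  let F' : Submodule ℂ (G → W) := Submodule.span ℂ (Set.range fun k : maxCompact p => leftReg k.1 f)
  have hF'F : F' ≤ F := Submodule.span_le.2 (by rintro _ ⟨k, rfl⟩; exact hfF k k.2)
  have hfin : FiniteDimensional ℂ F' := Submodule.finiteDimensional_of_le hF'F
  have hinv : ∀ k : maxCompact p, ∀ φ ∈ F', leftReg k.1 φ ∈ F' := by
    intro k φ hφ
    induction hφ using Submodule.span_induction with
    | mem φ h =>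
      obtain ⟨k', rfl⟩ := h
      refine Submodule.subset_span ⟨k * k', ?_⟩
      simp [Module.End.mul_apply]
    | zero => rw [map_zero]; exact zero_mem _
    | add φ ψ _ _ h1 h2 => rw [map_add]; exact add_mem h1 h2
    | smul c φ _ h => rw [map_smul]; exact Submodule.smul_mem _ c h
  have hcont : ∀ φ ∈ F', Continuous φ := by
    intro φ hφ
    induction hφ using Submodule.span_induction with
    | mem φ h =>
      obtain ⟨k', rfl⟩ := h
      exact hc.comp (continuous_const.mul continuous_id)
    | zero => exact continuous_const
    | add φ ψ _ _ h1 h2 => exact h1.add h2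
    | smul c φ _ h => exact h.const_smul c
  let ρ₀ : maxCompact p → F' →ₗ[ℂ] F' := fun k => (leftReg k.1).restrict (hinv k)
  let b := Module.finBasis ℂ F'
  let e := b.equivFun
  let ρ : Representation ℂ (maxCompact p) (Fin (Module.finrank ℂ F') → ℂ) :=
    { toFun := fun k => e.conj (ρ₀ k)
      map_one' := by
        have : ρ₀ 1 = LinearMap.id := by
          ext φ : 2
          simp [ρ₀, LinearMap.restrict_apply]
        rw [this, LinearEquiv.conj_id]; rfl
      map_mul' := fun k k' => by
        have : ρ₀ (k * k') = ρ₀ k ∘ₗ ρ₀ k' := by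
          ext φ : 2
          simp [ρ₀, LinearMap.restrict_apply]
        rw [this, LinearEquiv.conj_comp]; rfl }
  have hf1 : f ∈ F' := Submodule.subset_span ⟨1, by simp⟩
  refine ⟨_, ρ, e ⟨f, hf1⟩, (LinearMap.proj (1 : G) ∘ₗ F'.subtype) ∘ₗ e.symm.toLinearMap, ?_, ?_⟩
  · have h1 : ∀ φ : F', Continuous fun k : maxCompact p => e (ρ₀ k φ) := by
      intro φ
      have h2 : Continuous fun k : maxCompact p => ρ₀ k φ := by
        refine Continuous.subtype_mk (continuous_pi fun x => ?_) _
        exact (hcont φ.1 φ.2).comp (by fun_prop : Continuous fun k : maxCompact p => (k : G)⁻¹ * x)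
      exact (LinearMap.continuous_of_finiteDimensional e.toLinearMap).comp h2
    have h2 : ∀ z : maxCompact p × (Fin (Module.finrank ℂ F') → ℂ),
        ρ z.1 z.2 = ∑ i, z.2 i • e (ρ₀ z.1 (b i)) := by
      intro z
      change e (ρ₀ z.1 (e.symm z.2)) = _
      rw [Module.Basis.equivFun_symm_apply, map_sum, map_sum]
      simp only [map_smul]
    have : (fun z : maxCompact p × (Fin (Module.finrank ℂ F') → ℂ) => ρ z.1 z.2) =
        fun z => ∑ i, z.2 i • e (ρ₀ z.1 (b i)) := funext h2
    rw [IsContinuousRep, this]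
    refine continuous_finsetSum _ fun i _ => ?_
    exact ((continuous_apply i).comp continuous_snd).smul ((h1 (b i)).comp continuous_fst)
  · intro k
    change f k = (e.symm (e (ρ₀ k⁻¹ (e.symm (e ⟨f, hf1⟩)))) : F').1 1
    rw [e.symm_apply_apply, e.symm_apply_apply]
    simp [ρ₀, LinearMap.restrict_apply, leftReg]

variable [T2Space G] [FiniteDimensional ℂ W]

/-- Continuous `K`-finite sections are smooth: in coordinates `g = ∏ exp(ξᵢaᵢ) ∏ exp(ηⱼbⱼ)` with
`aᵢ ∈ 𝔨`, `bⱼ ∈ 𝔮` they are given by one-parameter groups of matrices. -/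
theorem IsParabolic.isSmooth_of_isKFinite {p : G →* GL (Fin n) ℝ} (hp : IsRealReductive p)
    {Q : Subgroup G} (hQ : IsParabolic p Q) {ζ : Representation ℂ Q W} (hζ : IsContinuousRep ζ)
    {f : G → W} (hf : f ∈ equivSections ζ) (hc : Continuous f) (hK : IsKFinite p f) :
    IsSmooth p f := by
  obtain ⟨d, ρ, v, ℓ, hρ, hfρ⟩ := hK.exists_rep hc
  obtain ⟨r, s, a, b, γa, γb, ξ, η, ha, hb, hξ, hη, -, -, hev⟩ := hQ.exists_coordinates hp
  let δa : Fin r → Multiplicative ℝ →ₜ* maxCompact p := fun i =>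
    { toFun := fun t => ⟨γa i t, (ha i).2.mem_maxCompact (ha i).1 t⟩
      map_one' := Subtype.ext (map_one _)
      map_mul' := fun s t => Subtype.ext (map_mul _ s t)
      continuous_toFun := (γa i).continuous_toFun.subtype_mk _ }
  let δb : Fin s → Multiplicative ℝ →ₜ* Q := fun i =>
    { toFun := fun t => ⟨γb i t, (hb i).2.mem_parabolic hQ (hb i).1 t⟩
      map_one' := Subtype.ext (map_one _)
      map_mul' := fun s t => Subtype.ext (map_mul _ s t)
      continuous_toFun := (γb i).continuous_toFun.subtype_mk _ }
  intro x
  obtain ⟨k₀, hk₀, q₀, hq₀, rfl⟩ := hQ.exists_eq_mul hp x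
  -- `y` carries `k₀ q₀` to `1`, where the coordinates `ξ`, `η` are defined.
  let y : (Fin n → Fin n → ℝ) →L[ℝ] Matrix (Fin n) (Fin n) ℝ := LinearMap.toContinuousLinearMap
    ((LinearMap.mulLeft ℝ (p k₀⁻¹).val ∘ₗ LinearMap.mulRight ℝ (p q₀⁻¹).val) ∘ₗ
      (Matrix.ofLinearEquiv ℝ).toLinearMap)
  have hy : ∀ g : G, y (fun i j => (p g).val i j) = (p (k₀⁻¹ * g * q₀⁻¹)).val := fun g => by
    change (p k₀⁻¹).val * ((p g).val * (p q₀⁻¹).val) = _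
    rw [map_mul, map_mul, Units.val_mul, Units.val_mul, mul_assoc]
  have hx : y (fun i j => (p (k₀ * q₀)).val i j) = 1 := by
    rw [hy]; simp
  refine ⟨fun M => ζ (⟨q₀, hq₀⟩⁻¹) (ζ
      ((List.finRange s).map fun i => δb i (Multiplicative.ofAdd (η (y M) i))).prod⁻¹
      (ℓ (ρ ((List.finRange r).map fun i => δa i (Multiplicative.ofAdd (ξ (y M) i))).prod⁻¹
        (ρ (⟨k₀, hk₀⟩⁻¹) v)))), ?_, ?_⟩
  · have hξ' : ContDiffAt ℝ ∞ (fun M => ξ (y M)) (fun i j => (p (k₀ * q₀)).val i j) :=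
      ContDiffAt.comp (g := ξ) _ (by rw [hx]; exact hξ) y.contDiff.contDiffAt
    have hη' : ContDiffAt ℝ ∞ (fun M => η (y M)) (fun i j => (p (k₀ * q₀)).val i j) :=
      ContDiffAt.comp (g := η) _ (by rw [hx]; exact hη) y.contDiff.contDiffAt
    have h1 := hρ.contDiffAt_list_prod (List.finRange r) δa hξ'
      (contDiffAt_const (c := ρ (⟨k₀, hk₀⟩⁻¹) v))
    have h2 := (LinearMap.toContinuousLinearMap (ℓ.restrictScalars ℝ)).contDiff.contDiffAt.comp _ h1
    have h3 := hζ.contDiffAt_list_prod (List.finRange s) δb hη' h2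
    exact (LinearMap.toContinuousLinearMap
      ((ζ (⟨q₀, hq₀⟩⁻¹)).restrictScalars ℝ)).contDiff.contDiffAt.comp _ h3
  · have h1 : Tendsto (fun g => k₀⁻¹ * g * q₀⁻¹) (𝓝 (k₀ * q₀)) (𝓝 1) := by
      have : Continuous fun y : G => k₀⁻¹ * y * q₀⁻¹ := by fun_prop
      simpa [← mul_assoc] using this.tendsto (k₀ * q₀)
    filter_upwards [h1.eventually hev] with g hg
    simp only [hy]
    set m := k₀⁻¹ * g * q₀⁻¹ with hm
    set A := ((List.finRange r).map fun i => δa i (Multiplicative.ofAdd (ξ (p m).val i))).prod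
      with hA
    set B := ((List.finRange s).map fun i => δb i (Multiplicative.ofAdd (η (p m).val i))).prod
      with hB
    have hA' : (A : G) =
        ((List.finRange r).map fun i => γa i (Multiplicative.ofAdd (ξ (p m).val i))).prod := by
      rw [hA, ← Subgroup.coe_subtype, map_list_prod, List.map_map]; rfl
    have hB' : (B : G) =
        ((List.finRange s).map fun i => γb i (Multiplicative.ofAdd (η (p m).val i))).prod := by
      rw [hB, ← Subgroup.coe_subtype, map_list_prod, List.map_map]; rfl
    rw [← hA', ← hB'] at hg
    have hg2 : g = ((⟨k₀, hk₀⟩ * A : maxCompact p) : G) * ((B * ⟨q₀, hq₀⟩ : Q) : G) := by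
      rw [Subgroup.coe_mul, Subgroup.coe_mul]
      calc g = k₀ * m * q₀ := by rw [hm]; group
        _ = k₀ * (A * B) * q₀ := by rw [← hg]
        _ = _ := by simp only [mul_assoc]
    rw [hg2, hf, hfρ, mul_inv_rev, mul_inv_rev, map_mul, map_mul, Module.End.mul_apply,
      Module.End.mul_apply]

end KFinite

/-! ### Integrals over compact spaces depending on a parameter -/

section Param

variable {X : Type*} [TopologicalSpace X] [CompactSpace X] [MeasurableSpace X] [BorelSpace X]
  (μ : Measure X) [IsFiniteMeasure μ]

theorem integrable_of_continuous {E : Type*} [NormedAddCommGroup E] {f : X → E}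
    (hf : Continuous f) : Integrable f μ :=
  hf.integrable_of_hasCompactSupport (HasCompactSupport.of_compactSpace f)

theorem continuous_integral_param {A E : Type*} [TopologicalSpace A] [NormedAddCommGroup E]
    [NormedSpace ℝ E] {f : A → X → E} (hf : Continuous f.uncurry) :
    Continuous fun a => ∫ x, f a x ∂μ := by
  let F : C(A, C(X, E)) := ContinuousMap.curry ⟨f.uncurry, hf⟩
  have h1 : Continuous fun φ : C(X, E) => ∫ x, φ x ∂μ := by
    refine (LipschitzWith.of_dist_le_mul (K := (μ.real Set.univ).toNNReal) fun φ ψ => ?_).continuous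
    rw [dist_eq_norm, ← integral_sub (integrable_of_continuous μ φ.continuous)
      (integrable_of_continuous μ ψ.continuous), Real.coe_toNNReal _ measureReal_nonneg, mul_comm,
      dist_eq_norm]
    exact norm_integral_le_of_norm_le_const (Eventually.of_forall fun x =>
        (φ - ψ).norm_coe_le_norm x)
  exact h1.comp F.continuous

theorem hasDerivAt_integral_param {E : Type*} [NormedAddCommGroup E] [NormedSpace ℝ E]
    {f f' : ℝ → X → E} (hf : ∀ t, Continuous (f t)) (hf' : Continuous f'.uncurry)
    (h : ∀ t x, HasDerivAt (fun t => f t x) (f' t x) t) (t₀ : ℝ) :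
    HasDerivAt (fun t => ∫ x, f t x ∂μ) (∫ x, f' t₀ x ∂μ) t₀ := by
  obtain ⟨C, hC⟩ := ((isCompact_closedBall t₀ 1).prod (isCompact_univ (X := X))).bddAbove_image
    hf'.norm.continuousOn
  refine (hasDerivAt_integral_of_dominated_loc_of_deriv_le (bound := fun _ => C)
    (Metric.ball_mem_nhds t₀ one_pos) (Eventually.of_forall fun t =>
      (integrable_of_continuous μ (hf t)).aestronglyMeasurable) (integrable_of_continuous μ (hf t₀))
    (integrable_of_continuous μ (hf'.comp (Continuous.prodMk_right t₀))).aestronglyMeasurable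
    (Eventually.of_forall fun x t ht => ?_) (integrable_const C)
    (Eventually.of_forall fun x t _ => h t x)).2
  exact hC ⟨(t, x), ⟨Metric.ball_subset_closedBall ht, Set.mem_univ x⟩, rfl⟩

end Param

/-! ### The adjoint action -/

section Adjoint

variable {n : ℕ} {G : Type*} [Group G]

theorem coe_Ad (p : G →* GL (Fin n) ℝ) (a : G) (Y : lieAlg p ⊤) :
    (Ad p a Y : Matrix (Fin n) (Fin n) ℝ) = conj (p a) Y := rfl

theorem Ad_mul (p : G →* GL (Fin n) ℝ) (a b : G) (Y : lieAlg p ⊤) :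
    Ad p (a * b) Y = Ad p a (Ad p b Y) := by
  apply Subtype.ext
  simp [coe_Ad, conj_apply, mul_assoc]

theorem Ad_one (p : G →* GL (Fin n) ℝ) (Y : lieAlg p ⊤) : Ad p 1 Y = Y := by
  apply Subtype.ext
  simp [coe_Ad, conj_apply]

variable [TopologicalSpace G] [IsTopologicalGroup G]

/-- The conjugate `t ↦ a γ(t) a⁻¹` of a one-parameter subgroup. -/
def conjParam (a : G) (γ : Multiplicative ℝ →ₜ* G) : Multiplicative ℝ →ₜ* G where
  toFun t := a * γ t * a⁻¹
  map_one' := by simp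
  map_mul' s t := by simp [mul_assoc]
  continuous_toFun := (continuous_const.mul γ.continuous_toFun).mul continuous_const

theorem IsOneParam.conjParam {p : G →* GL (Fin n) ℝ} {Y : Matrix (Fin n) (Fin n) ℝ}
    {γ : Multiplicative ℝ →ₜ* G} (h : IsOneParam p Y γ) (a : G) :
    IsOneParam p (conj (p a) Y) (conjParam a γ) := fun t => by
  change (p (a * γ (Multiplicative.ofAdd t) * a⁻¹)).val = _
  rw [← map_smul, conj_apply, Matrix.exp_units_conj, map_mul, map_mul, Units.val_mul,
    Units.val_mul, h, map_inv]

theorem IsRealReductive.continuous_Ad {p : G →* GL (Fin n) ℝ} (hp : IsRealReductive p) :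
    Continuous fun z : G × lieAlg p ⊤ => Ad p z.1 z.2 := by
  refine Continuous.subtype_mk (f := fun z : G × lieAlg p ⊤ => conj (p z.1) z.2) ?_ _
  simp only [conj_apply, ← map_inv]
  exact ((hp.continuous_val.comp continuous_fst).matrix_mul
    (continuous_subtype_val.comp continuous_snd)).matrix_mul
    (hp.continuous_val.comp continuous_fst.inv)

end Adjoint

/-! ### Derivatives along one-parameter subgroups -/

section LieDeriv

variable {n : ℕ} {G : Type*} [Group G] [TopologicalSpace G]
variable {W : Type*} [NormedAddCommGroup W] [NormedSpace ℂ W]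

/-- `D x Y` is the derivative at `t = 0` of `t ↦ f(γ(t) x)` for every one-parameter subgroup `γ`
over `exp(tY)`, and depends continuously on `x` and `Y`. -/
structure HasLieDeriv (p : G →* GL (Fin n) ℝ) (f : G → W) (D : G → lieAlg p ⊤ →ₗ[ℝ] W) :
    Prop where
  continuous : Continuous fun z : G × lieAlg p ⊤ => D z.1 z.2
  hasDerivAt : ∀ (Y : lieAlg p ⊤) (γ : Multiplicative ℝ →ₜ* G),
    IsOneParam p (Y : Matrix (Fin n) (Fin n) ℝ) γ → ∀ x,
      HasDerivAt (fun t : ℝ => f (γ (Multiplicative.ofAdd t) * x)) (D x Y) 0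

theorem IsOneParam.tendsto_mul [IsTopologicalGroup G] {p : G →* GL (Fin n) ℝ}
    {Y : Matrix (Fin n) (Fin n) ℝ}
    {γ : Multiplicative ℝ →ₜ* G} (h : IsOneParam p Y γ) (x : G) :
    Tendsto (fun t : ℝ => γ (Multiplicative.ofAdd t) * x) (𝓝 0) (𝓝 x) := by
  have h1 : Continuous fun t : ℝ => γ (Multiplicative.ofAdd t) * x :=
    h.continuous.mul continuous_const
  have := h1.tendsto 0
  rwa [oneParam_zero, one_mul] at this

theorem IsSmooth.continuous {p : G →* GL (Fin n) ℝ} (hp : IsRealReductive p) {f : G → W}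
    (hf : IsSmooth p f) : Continuous f := by
  rw [continuous_iff_continuousAt]
  intro x
  obtain ⟨F, hF, hfF⟩ := hf x
  have hP : Continuous fun y : G => fun i j => (p y).val i j :=
    continuous_pi fun i => continuous_pi fun j => hp.continuous_val.matrix_elem i j
  exact (hF.continuousAt.comp (f := fun y : G => fun i j => (p y).val i j) hP.continuousAt).congr
    (hfF.mono fun y hy => hy.symm)

theorem IsSmooth.leftReg [IsTopologicalGroup G] {p : G →* GL (Fin n) ℝ} {f : G → W}
    (hf : IsSmooth p f) (g : G) : IsSmooth p (leftReg g f) := by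
  intro x
  obtain ⟨F, hF, hfF⟩ := hf (g⁻¹ * x)
  let y : (Fin n → Fin n → ℝ) →L[ℝ] (Fin n → Fin n → ℝ) := LinearMap.toContinuousLinearMap
    ((Matrix.ofLinearEquiv ℝ).symm.toLinearMap ∘ₗ LinearMap.mulLeft ℝ (p g⁻¹).val ∘ₗ
      (Matrix.ofLinearEquiv ℝ).toLinearMap)
  have hy : ∀ x : G, y (fun i j => (p x).val i j) = fun i j => (p (g⁻¹ * x)).val i j := fun x => by
    rw [map_mul, Units.val_mul]
    rfl
  refine ⟨fun M => F (y M), ContDiffAt.comp (g := F) _ (by rw [hy]; exact hF) y.contDiff.contDiffAt,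
    ?_⟩
  have h1 : Tendsto (fun z => g⁻¹ * z) (𝓝 x) (𝓝 (g⁻¹ * x)) :=
    (continuous_const.mul continuous_id).tendsto x
  filter_upwards [h1.eventually hfF] with z hz
  rw [hy]
  exact hz

section

variable [IsTopologicalGroup G]

variable {p : G →* GL (Fin n) ℝ} {f : G → W} {D : G → lieAlg p ⊤ →ₗ[ℝ] W}

theorem HasLieDeriv.hasDerivAt_mul (h : HasLieDeriv p f D) {Y : lieAlg p ⊤}
    {γ : Multiplicative ℝ →ₜ* G} (hγ : IsOneParam p (Y : Matrix (Fin n) (Fin n) ℝ) γ) (a b : G)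
    (t : ℝ) :
    HasDerivAt (fun t : ℝ => f (a * γ (Multiplicative.ofAdd t) * b))
      (D (a * γ (Multiplicative.ofAdd t) * b) (Ad p a Y)) t := by
  have h1 := h.hasDerivAt (Ad p a Y) (conjParam a γ) (hγ.conjParam a)
    (a * γ (Multiplicative.ofAdd t) * b)
  rw [← sub_self t] at h1
  refine (h1.comp_sub_const t t).congr_of_eventuallyEq (Eventually.of_forall fun s => ?_)
  change f (a * γ (Multiplicative.ofAdd s) * b) = f (a * γ (Multiplicative.ofAdd (s - t)) * a⁻¹ *
    (a * γ (Multiplicative.ofAdd t) * b))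
  have h2 := oneParam_add γ (s - t) t
  rw [sub_add_cancel] at h2
  rw [h2]
  simp only [mul_assoc, inv_mul_cancel_left]

theorem HasLieDeriv.leftReg (hp : IsRealReductive p) (h : HasLieDeriv p f D) (g : G) :
    HasLieDeriv p (leftReg g f) fun x => D (g⁻¹ * x) ∘ₗ Ad p g⁻¹ where
  continuous := by
    have h2 : Continuous fun z : G × lieAlg p ⊤ => ((g⁻¹, z.2) : G × lieAlg p ⊤) :=
      continuous_const.prodMk continuous_snd
    have h3 := hp.continuous_Ad.comp h2
    have h4 : Continuous fun z : G × lieAlg p ⊤ => g⁻¹ * z.1 := by fun_prop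
    exact h.continuous.comp (h4.prodMk h3)
  hasDerivAt Y γ hγ x := by
    have h1 := h.hasDerivAt_mul hγ g⁻¹ x 0
    rw [oneParam_zero, mul_one] at h1
    refine h1.congr_of_eventuallyEq (Eventually.of_forall fun t => ?_)
    simp [RealFlag.leftReg, mul_assoc]

end

variable [IsTopologicalGroup G] [T2Space G]

/-- Smooth functions have continuous derivatives along one-parameter subgroups. -/
theorem IsSmooth.exists_hasLieDeriv {p : G →* GL (Fin n) ℝ} (hp : IsRealReductive p) {f : G → W}
    (hf : IsSmooth p f) : ∃ D, HasLieDeriv p f D := by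
  choose F hF hfF using hf
  let P : G → Fin n → Fin n → ℝ := fun x i j => (p x).val i j
  have hP : Continuous P :=
    continuous_pi fun i => continuous_pi fun j => hp.continuous_val.matrix_elem i j
  let m : G → lieAlg p ⊤ →ₗ[ℝ] (Fin n → Fin n → ℝ) := fun x =>
    (Matrix.ofLinearEquiv ℝ).symm.toLinearMap ∘ₗ LinearMap.mulRight ℝ (p x).val ∘ₗ
      (lieAlg p ⊤).subtype
  -- The derivative may be computed with any of the local extensions `F x`, and one extension serves
  -- for all points near `x`, which gives continuity.
  have key : ∀ x y : G, (∀ᶠ z in 𝓝 y, f z = F x (P z)) → DifferentiableAt ℝ (F x) (P y) →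
      ∀ (Y : lieAlg p ⊤) (γ : Multiplicative ℝ →ₜ* G),
      IsOneParam p (Y : Matrix (Fin n) (Fin n) ℝ) γ →
      HasDerivAt (fun t : ℝ => f (γ (Multiplicative.ofAdd t) * y))
        (fderiv ℝ (F x) (P y) (m y Y)) 0 := by
    intro x y h1 h2 Y γ hγ
    let L : Matrix (Fin n) (Fin n) ℝ →L[ℝ] (Fin n → Fin n → ℝ) := LinearMap.toContinuousLinearMap
      ((Matrix.ofLinearEquiv ℝ).symm.toLinearMap ∘ₗ LinearMap.mulRight ℝ (p y).val)
    have h3 : HasDerivAt (fun t : ℝ => L (NormedSpace.exp (t • (Y : Matrix (Fin n) (Fin n) ℝ))))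
        (L Y) 0 := L.hasFDerivAt.comp_hasDerivAt 0 (hasDerivAt_exp_smul_zero _)
    have h4 : ∀ t : ℝ, L (NormedSpace.exp (t • (Y : Matrix (Fin n) (Fin n) ℝ))) =
        P (γ (Multiplicative.ofAdd t) * y) := fun t => by
      simp only [P]
      rw [map_mul, Units.val_mul, hγ]
      rfl
    have h0 : P y = L (NormedSpace.exp ((0 : ℝ) • (Y : Matrix (Fin n) (Fin n) ℝ))) := by
      rw [h4, oneParam_zero, one_mul]
    have h5 : HasFDerivAt (F x) (fderiv ℝ (F x) (P y))
        (L (NormedSpace.exp ((0 : ℝ) • (Y : Matrix (Fin n) (Fin n) ℝ)))) := by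
      rw [← h0]; exact h2.hasFDerivAt
    refine (h5.comp_hasDerivAt 0 h3).congr_of_eventuallyEq ?_
    filter_upwards [(hγ.tendsto_mul y).eventually h1] with t ht
    rw [ht, Function.comp_apply, h4]
  refine ⟨fun x => (fderiv ℝ (F x) (P x)).toLinearMap ∘ₗ m x, ?_, ?_⟩
  · rw [continuous_iff_continuousAt]
    rintro ⟨x, Y⟩
    have h1 : ContDiffAt ℝ 1 (F x) (P x) := (hF x).of_le (by exact_mod_cast le_top)
    have h2 : ∀ᶠ y in 𝓝 x, DifferentiableAt ℝ (F x) (P y) :=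
      hP.continuousAt.eventually ((h1.eventually (by simp)).mono
        fun z hz => hz.differentiableAt (by simp))
    have h3 : ∀ᶠ y in 𝓝 x, ∀ Y : lieAlg p ⊤,
        fderiv ℝ (F x) (P y) (m y Y) = fderiv ℝ (F y) (P y) (m y Y) := by
      filter_upwards [h2, (hfF x).eventually_nhds] with y hy1 hy2 Y
      obtain ⟨γ, hγ⟩ := hp.exists_isOneParam ((hp.mem_lieAlg isClosed_univ).1 Y.2)
      exact (key x y hy2 hy1 Y γ hγ).unique
        (key y y (hfF y) ((hF y).differentiableAt (by simp)) Y γ hγ)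
    have h4 : ContinuousAt (fun y => fderiv ℝ (F x) (P y)) x :=
      ((h1.fderiv_right (m := 0) (by simp)).continuousAt).comp hP.continuousAt
    have h5 : Continuous fun z : G × lieAlg p ⊤ => m z.1 z.2 := by
      refine continuous_pi fun i => continuous_pi fun j => ?_
      have : Continuous fun z : G × lieAlg p ⊤ =>
          (z.2 : Matrix (Fin n) (Fin n) ℝ) * (p z.1).val :=
        (continuous_subtype_val.comp continuous_snd).matrix_mul
          (hp.continuous_val.comp continuous_fst)
      exact this.matrix_elem i j
    have h6 : ContinuousAt (fun z : G × lieAlg p ⊤ => fderiv ℝ (F x) (P z.1) (m z.1 z.2))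
        (x, Y) := by
      have h7 : ContinuousAt (fun z : G × lieAlg p ⊤ => fderiv ℝ (F x) (P z.1)) (x, Y) :=
        ContinuousAt.comp (f := Prod.fst) (g := fun y => fderiv ℝ (F x) (P y)) h4
          continuous_fst.continuousAt
      exact h7.clm_apply h5.continuousAt
    refine h6.congr ?_
    have h8 : ∀ᶠ z : G × lieAlg p ⊤ in 𝓝 (x, Y), ∀ Y : lieAlg p ⊤,
        fderiv ℝ (F x) (P z.1) (m z.1 Y) = fderiv ℝ (F z.1) (P z.1) (m z.1 Y) :=
      (continuous_fst.tendsto (x, Y)).eventually h3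
    filter_upwards [h8] with z hz
    exact hz z.2
  · intro Y γ hγ x
    exact key x x (hfF x) ((hF x).differentiableAt (by simp)) Y γ hγ

variable {p : G →* GL (Fin n) ℝ} {f : G → W} {D : G → lieAlg p ⊤ →ₗ[ℝ] W}

theorem HasLieDeriv.mem_equivSections (hp : IsRealReductive p) [FiniteDimensional ℂ W]
    (h : HasLieDeriv p f D) {Q : Subgroup G} {ζ : Representation ℂ Q W}
    (hf : f ∈ equivSections ζ) (Y : lieAlg p ⊤) : (fun x => D x Y) ∈ equivSections ζ := by
  intro g q
  obtain ⟨γ, hγ⟩ := hp.exists_isOneParam ((hp.mem_lieAlg isClosed_univ).1 Y.2)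
  refine (h.hasDerivAt Y γ hγ (g * q)).unique ?_
  have h1 := (LinearMap.toContinuousLinearMap ((ζ q⁻¹).restrictScalars ℝ)).hasFDerivAt.comp_hasDerivAt
    0 (h.hasDerivAt Y γ hγ g)
  refine h1.congr_of_eventuallyEq (Eventually.of_forall fun t => ?_)
  simp only [← mul_assoc]
  exact hf _ q

end LieDeriv

/-! ### Representative functions on a compact group -/

section PeterWeyl

open scoped InnerProductSpace ComplexConjugate

/-- The operator from a Hilbert space to continuous functions given by a continuous family of
vectors. -/
def innerCLM {X 𝓗 : Type*} [TopologicalSpace X] [CompactSpace X] [NormedAddCommGroup 𝓗]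
    [InnerProductSpace ℂ 𝓗] (H : C(X, 𝓗)) : 𝓗 →L[ℂ] C(X, ℂ) :=
  LinearMap.mkContinuous
    { toFun := fun f => ⟨fun x => ⟪H x, f⟫_ℂ, H.continuous.inner continuous_const⟩
      map_add' := fun f g => by ext x; simp
      map_smul' := fun c f => by ext x; simp } ‖H‖ fun f => by
    refine (ContinuousMap.norm_le _ (by positivity)).2 fun x => ?_
    exact (norm_inner_le_norm _ _).trans
      (mul_le_mul_of_nonneg_right (H.norm_coe_le_norm x) (norm_nonneg f))

theorem innerCLM_apply {X 𝓗 : Type*} [TopologicalSpace X] [CompactSpace X] [NormedAddCommGroup 𝓗]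
    [InnerProductSpace ℂ 𝓗] (H : C(X, 𝓗)) (f : 𝓗) (x : X) : innerCLM H f x = ⟪H x, f⟫_ℂ := rfl

/-- By the Arzelà–Ascoli theorem. -/
theorem isCompactOperator_innerCLM {X 𝓗 : Type*} [TopologicalSpace X] [CompactSpace X]
    [NormedAddCommGroup 𝓗] [InnerProductSpace ℂ 𝓗] (H : C(X, 𝓗)) :
    IsCompactOperator (innerCLM H) := by
  let J := BoundedContinuousFunction.mkOfCompact (α := X) (β := ℂ)
  let S : Set (BoundedContinuousFunction X ℂ) := J '' (innerCLM H '' Metric.closedBall 0 1)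
  have hS : ∀ φ ∈ S, ∃ f : 𝓗, ‖f‖ ≤ 1 ∧ ∀ x, φ x = ⟪H x, f⟫_ℂ := by
    rintro _ ⟨_, ⟨f, hf, rfl⟩, rfl⟩
    exact ⟨f, by simpa using hf, fun x => rfl⟩
  have hcomp : IsCompact (closure S) := by
    refine BoundedContinuousFunction.arzela_ascoli (Metric.closedBall (0 : ℂ) ‖H‖)
      (isCompact_closedBall _ _) S ?_ ?_
    · intro φ x hφ
      obtain ⟨f, hf, h⟩ := hS φ hφ
      rw [h, mem_closedBall_zero_iff]
      calc _ ≤ ‖H x‖ * ‖f‖ := norm_inner_le_norm _ _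
        _ ≤ ‖H‖ * 1 := mul_le_mul (H.norm_coe_le_norm x) hf (norm_nonneg _) (norm_nonneg _)
        _ = ‖H‖ := mul_one _
    · intro x
      rw [Metric.equicontinuousAt_iff_right]
      intro ε hε
      filter_upwards [Metric.continuousAt_iff'.1 H.continuous.continuousAt ε hε] with y hy φ
      obtain ⟨f, hf, h⟩ := hS φ φ.2
      change dist (φ.1 x) (φ.1 y) < ε
      rw [h, h, dist_eq_norm, ← inner_sub_left]
      calc _ ≤ ‖H x - H y‖ * ‖f‖ := norm_inner_le_norm _ _
        _ ≤ ‖H x - H y‖ * 1 := mul_le_mul_of_nonneg_left hf (norm_nonneg _)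
        _ < ε := by rw [mul_one, ← dist_eq_norm, dist_comm]; exact hy
  rw [isCompactOperator_iff_exists_mem_nhds_image_subset_compact]
  refine ⟨_, Metric.closedBall_mem_nhds 0 one_pos,
    (ContinuousMap.isometryEquivBoundedOfCompact X ℂ).symm '' closure S,
    hcomp.image (ContinuousMap.isometryEquivBoundedOfCompact X ℂ).symm.continuous, ?_⟩
  rintro _ ⟨f, hf, rfl⟩
  exact ⟨J (innerCLM H f), subset_closure ⟨_, ⟨f, hf, rfl⟩, rfl⟩, by ext x; rfl⟩

variable {K : Type*} [Group K] [TopologicalSpace K]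

/-- Representative functions: `e(xy)` is a finite sum `∑ uⱼ(x) vⱼ(y)` of products of continuous
functions. -/
def representative : Submodule ℂ C(K, ℂ) where
  carrier := {e | ∃ (ι : Type) (_ : Fintype ι) (u v : ι → C(K, ℂ)),
    ∀ x y, e (x * y) = ∑ j, u j x * v j y}
  add_mem' := by
    rintro e e' ⟨ι, _, u, v, h⟩ ⟨ι', _, u', v', h'⟩
    refine ⟨ι ⊕ ι', inferInstance, Sum.elim u u', Sum.elim v v', fun x y => ?_⟩
    simp [h, h']
  zero_mem' := ⟨PEmpty, inferInstance, fun i => i.elim, fun i => i.elim, fun x y => by simp⟩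
  smul_mem' := by
    rintro c e ⟨ι, _, u, v, h⟩
    refine ⟨ι, inferInstance, fun i => c • u i, v, fun x y => ?_⟩
    simp [h, Finset.mul_sum, mul_assoc]

section Bump

variable [CompactSpace K] [MeasurableSpace K] [BorelSpace K] (μ : Measure K) [μ.IsHaarMeasure]

/-- A continuous probability density on `K` supported where `φ` is close to `φ 1`. -/
theorem exists_bump [T2Space K] {E : Type*} [NormedAddCommGroup E] {φ : K → E}
    (hφ : Continuous φ) {δ : ℝ} (hδ : 0 < δ) :
    ∃ b : C(K, ℝ), (∀ k, 0 ≤ b k) ∧ ∫ k, b k ∂μ = 1 ∧ ∀ k, b k ≠ 0 → ‖φ k - φ 1‖ < δ := by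
  have hUo : IsOpen {x | ‖φ x - φ 1‖ < δ} :=
    isOpen_lt (hφ.sub continuous_const).norm continuous_const
  obtain ⟨u, hu1, hu0, -, hu01⟩ := exists_continuous_one_zero_of_isCompact
    (isCompact_singleton (x := (1 : K))) hUo.isClosed_compl (by
      rw [Set.disjoint_singleton_left, Set.notMem_compl_iff]
      simpa using hδ)
  have hpos : 0 < ∫ k, u k ∂μ := by
    refine u.continuous.integral_pos_of_hasCompactSupport_nonneg_nonzero
      (HasCompactSupport.of_compactSpace _) (fun x => (hu01 x).1) (x := 1) ?_
    rw [hu1 rfl]; exact one_ne_zero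
  refine ⟨⟨fun k => (∫ k, u k ∂μ)⁻¹ * u k, by fun_prop⟩,
    fun k => mul_nonneg (inv_nonneg.2 hpos.le) (hu01 k).1, ?_, fun k hk => ?_⟩
  · change ∫ k, (∫ k, u k ∂μ)⁻¹ * u k ∂μ = 1
    rw [integral_const_mul, inv_mul_cancel₀ hpos.ne']
  · by_contra hne
    exact hk (mul_eq_zero_of_right _ (hu0 hne))

theorem norm_integral_bump_sub_le {E : Type*} [NormedAddCommGroup E] [NormedSpace ℝ E]
    [CompleteSpace E] {φ : K → E} (hφ : Continuous φ) {δ : ℝ} {b : C(K, ℝ)}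
    (hb : ∀ k, 0 ≤ b k) (hb1 : ∫ k, b k ∂μ = 1) (hbφ : ∀ k, b k ≠ 0 → ‖φ k - φ 1‖ < δ) :
    ‖∫ k, b k • φ k ∂μ - φ 1‖ ≤ δ := by
  have h1 : φ 1 = ∫ k, b k • φ 1 ∂μ := by rw [integral_smul_const, hb1, one_smul]
  conv_lhs => rw [h1]
  rw [← integral_sub (integrable_of_continuous μ (by fun_prop))
    (integrable_of_continuous μ (by fun_prop))]
  have h3 : ∫ k, b k * δ ∂μ = δ := by rw [integral_mul_const, hb1, one_mul]
  rw [← h3]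
  refine norm_integral_le_of_norm_le (integrable_of_continuous μ (by fun_prop))
    (Eventually.of_forall fun k => ?_)
  rw [← smul_sub, norm_smul, Real.norm_of_nonneg (hb k)]
  by_cases hk : b k = 0
  · simp [hk]
  · exact mul_le_mul_of_nonneg_left (hbφ k hk).le (hb k)

end Bump

variable [IsTopologicalGroup K] [CompactSpace K]

/-- Left translation of continuous functions on `K`, `ψ ↦ ψ(g ·)`, is continuous in `g`. -/
def translate {E : Type*} [TopologicalSpace E] (ψ : C(K, E)) : C(K, C(K, E)) :=
  ContinuousMap.curry ⟨fun z : K × K => ψ (z.1 * z.2), by fun_prop⟩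

theorem mem_representative_of_invariant {𝓔 : Submodule ℂ C(K, ℂ)} [FiniteDimensional ℂ 𝓔]
    {ψ : C(K, ℂ)} (h : ∀ g, translate ψ g ∈ 𝓔) : ψ ∈ representative (K := K) := by
  let b := Module.finBasis ℂ 𝓔
  have hc : Continuous fun g : K => b.equivFun ⟨translate ψ g, h g⟩ :=
    (LinearMap.continuous_of_finiteDimensional b.equivFun.toLinearMap).comp
      ((translate ψ).continuous.subtype_mk _)
  refine ⟨Fin (Module.finrank ℂ 𝓔), inferInstance,
    fun j => ⟨fun g => b.equivFun ⟨translate ψ g, h g⟩ j, (continuous_apply j).comp hc⟩,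
    fun j => (b j : C(K, ℂ)), fun x y => ?_⟩
  have h1 := b.sum_equivFun ⟨translate ψ x, h x⟩
  have h2 := congrArg (fun φ : 𝓔 => (φ : C(K, ℂ)) y) h1
  simp only [AddSubmonoidClass.coe_finsetSum, Submodule.coe_smul, ContinuousMap.sum_apply,
    ContinuousMap.smul_apply, smul_eq_mul] at h2
  exact h2.symm

variable [MeasurableSpace K] [BorelSpace K] (μ : Measure K) [μ.IsHaarMeasure]

/-- Every `f ∈ L²(K)` orthogonal to the representative functions is orthogonal to the continuous
functions `k` with `k(y⁻¹) = conj k(y)`. The convolution operator with such a kernel is compact and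
self-adjoint, and its eigenfunctions for non-zero eigenvalues are representative functions. -/
theorem inner_eq_zero_of_orthogonal_representative {f : Lp ℂ 2 μ}
    (hf : ∀ e ∈ representative (K := K), ⟪ContinuousMap.toLp 2 μ ℂ e, f⟫_ℂ = 0) {k : C(K, ℂ)}
    (hk : ∀ y, k y⁻¹ = conj (k y)) : ⟪ContinuousMap.toLp 2 μ ℂ k, f⟫_ℂ = 0 := by
  let κ : C(K, C(K, ℂ)) :=
    ContinuousMap.curry ⟨fun z : K × K => conj (k (z.2⁻¹ * z.1)), by fun_prop⟩
  let H : C(K, Lp ℂ 2 μ) := ⟨fun x => ContinuousMap.toLp 2 μ ℂ (κ x),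
    (ContinuousMap.toLp 2 μ ℂ).continuous.comp κ.continuous⟩
  let B := innerCLM H
  have hB : ∀ (ψ : C(K, ℂ)) x, B (ContinuousMap.toLp 2 μ ℂ ψ) x = ∫ y, ψ y * k (y⁻¹ * x) ∂μ :=
    fun ψ x => by
      rw [innerCLM_apply]
      change ⟪ContinuousMap.toLp 2 μ ℂ (κ x), _⟫_ℂ = _
      rw [ContinuousMap.inner_toLp]
      simp [κ]
  let A : Lp ℂ 2 μ →L[ℂ] Lp ℂ 2 μ := (ContinuousMap.toLp 2 μ ℂ).comp B
  have hA : IsCompactOperator A :=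
      (isCompactOperator_innerCLM H).clm_comp (ContinuousMap.toLp 2 μ ℂ)
  have hdense : DenseRange (ContinuousMap.toLp 2 μ ℂ : C(K, ℂ) →L[ℂ] Lp ℂ 2 μ) :=
    ContinuousMap.toLp_denseRange ℂ μ ℂ (by simp)
  have hsymm : A.toLinearMap.IsSymmetric := by
    intro f g
    change ⟪A f, g⟫_ℂ = ⟪f, A g⟫_ℂ
    refine hdense.induction_on₂ (p := fun f g => ⟪A f, g⟫_ℂ = ⟪f, A g⟫_ℂ) ?_ ?_ f g
    · exact isClosed_eq ((A.continuous.comp continuous_fst).inner continuous_snd)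
        (continuous_fst.inner (A.continuous.comp continuous_snd))
    · intro φ ψ
      change ⟪ContinuousMap.toLp 2 μ ℂ (B _), _⟫_ℂ = ⟪_, ContinuousMap.toLp 2 μ ℂ (B _)⟫_ℂ
      rw [ContinuousMap.inner_toLp, ContinuousMap.inner_toLp]
      simp only [hB, ← integral_conj, ← integral_const_mul, ← integral_mul_const]
      rw [integral_integral_swap_of_hasCompactSupport (by fun_prop)
        (HasCompactSupport.of_compactSpace _)]
      refine integral_congr_ae (Eventually.of_forall fun x => integral_congr_ae
        (Eventually.of_forall fun y => ?_))
      simp only [map_mul]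
      rw [← hk (x⁻¹ * y), mul_inv_rev, inv_inv]
      ring
  have hAf : A f = 0 := by
    have h1 : A f ∈ (⨆ c, Module.End.eigenspace (A : Module.End ℂ (Lp ℂ 2 μ)) c)ᗮ := by
      rw [Submodule.mem_orthogonal]
      intro w hw
      induction hw using Submodule.iSup_induction' with
      | zero => simp
      | add w w' _ _ h h' => rw [inner_add_left, h, h', add_zero]
      | mem c w hw =>
        rw [Module.End.mem_eigenspace_iff] at hw
        change A w = c • w at hw
        have h2 : ⟪w, A f⟫_ℂ = conj c * ⟪w, f⟫_ℂ := by
          have h3 : ⟪A w, f⟫_ℂ = ⟪w, A f⟫_ℂ := hsymm w f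
          rw [← h3, hw, inner_smul_left]
        rw [h2]
        by_cases hc : c = 0
        · simp [hc]
        · suffices ⟪w, f⟫_ℂ = 0 by rw [this, mul_zero]
          let 𝓔 : Submodule ℂ C(K, ℂ) := LinearMap.ker
            (B.toLinearMap ∘ₗ (ContinuousMap.toLp 2 μ ℂ).toLinearMap - c • LinearMap.id)
          have h𝓔 : ∀ ψ, ψ ∈ 𝓔 ↔ B (ContinuousMap.toLp 2 μ ℂ ψ) = c • ψ := fun ψ => by
            rw [LinearMap.mem_ker, LinearMap.sub_apply, sub_eq_zero]; rfl
          have hfin : FiniteDimensional ℂ 𝓔 := by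
            have h3 := ContinuousLinearMap.finite_dimensional_eigenspace hA c hc
            let L : 𝓔 →ₗ[ℂ] Module.End.eigenspace A.toLinearMap c :=
              ((ContinuousMap.toLp 2 μ ℂ).toLinearMap ∘ₗ 𝓔.subtype).codRestrict _ fun ψ => by
                rw [Module.End.mem_eigenspace_iff]
                change ContinuousMap.toLp 2 μ ℂ (B (ContinuousMap.toLp 2 μ ℂ ψ.1)) =
                  c • ContinuousMap.toLp 2 μ ℂ ψ.1
                rw [(h𝓔 ψ.1).1 ψ.2, map_smul]
            refine FiniteDimensional.of_injective L fun ψ ψ' h => ?_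
            apply Subtype.ext
            exact ContinuousMap.toLp_injective (p := 2) (𝕜 := ℂ) μ (congrArg Subtype.val h)
          have hinv : ∀ ψ ∈ 𝓔, ∀ g, translate ψ g ∈ 𝓔 := fun ψ hψ g => by
            rw [h𝓔] at hψ ⊢
            ext x
            rw [hB]
            have h3 := DFunLike.congr_fun hψ (g * x)
            rw [hB] at h3
            rw [← integral_mul_left_eq_self _ g] at h3
            change _ = c * ψ (g * x)
            rw [← smul_eq_mul, ← ContinuousMap.smul_apply, ← h3]
            refine integral_congr_ae (Eventually.of_forall fun y => ?_)
            change ψ (g * y) * k (y⁻¹ * x) = ψ (g * y) * k ((g * y)⁻¹ * (g * x))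
            rw [mul_inv_rev, mul_assoc, inv_mul_cancel_left]
          have hw' : w = ContinuousMap.toLp 2 μ ℂ (c⁻¹ • B w) := by
            rw [map_smul]
            change w = c⁻¹ • A w
            rw [hw, smul_smul, inv_mul_cancel₀ hc, one_smul]
          have hmem : c⁻¹ • B w ∈ 𝓔 := by
            rw [h𝓔, ← hw', smul_smul, mul_inv_cancel₀ hc, one_smul]
          rw [hw']
          exact hf _ (mem_representative_of_invariant (hinv _ hmem))
    have h2 := ContinuousLinearMap.orthogonalComplement_iSup_eigenspaces_eq_bot hA hsymm
    rw [h2] at h1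
    exact h1
  have hBf : B f = 0 := ContinuousMap.toLp_injective (p := 2) (𝕜 := ℂ) μ (by
    rw [map_zero]; exact hAf)
  have h1 := DFunLike.congr_fun hBf 1
  rw [innerCLM_apply] at h1
  have hκ : κ 1 = k := by
    ext y
    simp [κ, hk]
  change ⟪ContinuousMap.toLp 2 μ ℂ (κ 1), f⟫_ℂ = 0 at h1
  rwa [hκ] at h1

/-- The Peter–Weyl theorem: representative functions are dense in `L²(K)`. -/
theorem denseRange_representative :
    Dense ((representative (K := K)).map (ContinuousMap.toLp 2 μ ℂ).toLinearMap :
      Set (Lp ℂ 2 μ)) := by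
  rw [Submodule.dense_iff_topologicalClosure_eq_top, Submodule.topologicalClosure_eq_top_iff,
    Submodule.eq_bot_iff]
  intro f hf
  rw [Submodule.mem_orthogonal] at hf
  have hf' : ∀ e ∈ representative (K := K), ⟪ContinuousMap.toLp 2 μ ℂ e, f⟫_ℂ = 0 :=
    fun e he => hf _ ⟨e, he, rfl⟩
  have hdense : DenseRange (ContinuousMap.toLp 2 μ ℂ : C(K, ℂ) →L[ℂ] Lp ℂ 2 μ) :=
    ContinuousMap.toLp_denseRange ℂ μ ℂ (by simp)
  refine hdense.eq_zero_of_inner_left ℂ ?_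
  intro k
  change ⟪f, ContinuousMap.toLp 2 μ ℂ k⟫_ℂ = 0
  rw [← inner_conj_symm]
  let k' : C(K, ℂ) := ⟨fun y => conj (k y⁻¹), by fun_prop⟩
  have h1 := inner_eq_zero_of_orthogonal_representative μ hf' (k := k + k') fun y => by
    simp [k', add_comm]
  have h2 := inner_eq_zero_of_orthogonal_representative μ hf'
      (k := Complex.I • (k - k')) fun y => by
    simp only [k', ContinuousMap.smul_apply, ContinuousMap.sub_apply, ContinuousMap.coe_mk,
      inv_inv, smul_eq_mul, map_mul, map_sub, Complex.conj_I, Complex.conj_conj]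
    ring
  rw [map_add, inner_add_left] at h1
  rw [map_smul, inner_smul_left, map_sub, inner_sub_left, mul_eq_zero] at h2
  have h3 := h2.resolve_left (by simp)
  have h4 : ⟪ContinuousMap.toLp 2 μ ℂ k, f⟫_ℂ = 0 := by linear_combination (h1 + h3) / 2
  rw [h4, map_zero]

/-- Representative functions approximate the Dirac measure at the identity. -/
theorem exists_representative_integral [T2Space K] {E : Type*} [NormedAddCommGroup E]
    [NormedSpace ℂ E] [CompleteSpace E] {φ : K → E} (hφ : Continuous φ) {δ : ℝ} (hδ : 0 < δ) :
    ∃ e ∈ representative (K := K), ‖∫ k, e k • φ k ∂μ - φ 1‖ < δ := by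
  obtain ⟨M, hM⟩ := (isCompact_range hφ).isBounded.exists_norm_le
  have hM' : ∀ x, ‖φ x‖ ≤ |M| := fun x => (hM _ ⟨x, rfl⟩).trans (le_abs_self M)
  obtain ⟨b, hb⟩ : ∃ b : C(K, ℂ), ‖∫ k, b k • φ k ∂μ - φ 1‖ ≤ δ / 2 := by
    obtain ⟨b, hb, hb1, hbφ⟩ := exists_bump μ hφ (half_pos hδ)
    exact ⟨⟨fun k => (b k : ℂ), by fun_prop⟩, norm_integral_bump_sub_le μ hφ hb hb1 hbφ⟩
  -- approximation in `L²`, hence in `L¹`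
  set C : ℝ := (μ Set.univ ^ (1 / (1 : ENNReal).toReal - 1 / (2 : ENNReal).toReal)).toReal with hC
  have hL1 : ∀ d : C(K, ℂ), ∫ k, ‖d k‖ ∂μ ≤ ‖ContinuousMap.toLp 2 μ ℂ d‖ * C := fun d => by
    have haes : AEStronglyMeasurable d μ := (integrable_of_continuous μ d.continuous).1
    have hmem : MemLp d 2 μ := by
      refine MemLp.of_bound haes ‖d‖ (Eventually.of_forall fun x => d.norm_coe_le_norm x)
    have h1 := eLpNorm_le_eLpNorm_mul_rpow_measure_univ (μ := μ) (p := 1) (q := 2)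
      one_le_two haes
    have h2 : ‖ContinuousMap.toLp 2 μ ℂ d‖ = (eLpNorm d 2 μ).toReal := by
      rw [Lp.norm_def]
      congr 1
      exact eLpNorm_congr_ae (ContinuousMap.coeFn_toLp μ d)
    rw [integral_norm_eq_lintegral_enorm haes, ← eLpNorm_one_eq_lintegral_enorm, h2, hC,
      ← ENNReal.toReal_mul]
    refine ENNReal.toReal_mono (ENNReal.mul_ne_top hmem.eLpNorm_ne_top ?_) h1
    exact ENNReal.rpow_ne_top_of_nonneg (by norm_num) (measure_ne_top _ _)
  have hε : 0 < δ / 2 / (|C| * |M| + 1) := by positivity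
  obtain ⟨_, hlt, e, he, rfl⟩ := Metric.dense_iff.1 (denseRange_representative (K := K) μ)
    (ContinuousMap.toLp 2 μ ℂ b) _ hε
  refine ⟨e, he, ?_⟩
  have h1 : ‖∫ k, e k • φ k ∂μ - ∫ k, b k • φ k ∂μ‖ < δ / 2 := by
    rw [← integral_sub (integrable_of_continuous μ (by fun_prop))
      (integrable_of_continuous μ (by fun_prop))]
    calc _ ≤ ∫ k, ‖(e - b) k‖ * |M| ∂μ := by
          refine norm_integral_le_of_norm_le (integrable_of_continuous μ (by fun_prop))
            (Eventually.of_forall fun k => ?_)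
          rw [← sub_smul, norm_smul]
          exact mul_le_mul_of_nonneg_left (hM' k) (norm_nonneg _)
      _ ≤ ‖ContinuousMap.toLp 2 μ ℂ (e - b)‖ * C * |M| := by
          rw [integral_mul_const]
          exact mul_le_mul_of_nonneg_right (hL1 _) (abs_nonneg _)
      _ ≤ ‖ContinuousMap.toLp 2 μ ℂ (e - b)‖ * (|C| * |M| + 1) := by
          rw [mul_assoc]
          refine mul_le_mul_of_nonneg_left ?_ (norm_nonneg _)
          have := mul_le_mul_of_nonneg_right (le_abs_self C) (abs_nonneg M)
          linarith
      _ < δ / 2 := by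
          rw [← lt_div_iff₀ (by positivity), map_sub, ← dist_eq_norm]
          exact hlt
  calc _ = ‖(∫ k, e k • φ k ∂μ - ∫ k, b k • φ k ∂μ) + (∫ k, b k • φ k ∂μ - φ 1)‖ := by
        congr 1; abel
    _ ≤ _ := norm_add_le _ _
    _ < δ := by linarith

end PeterWeyl

/-! ### Convolution over `K` and equivariant functionals -/

theorem leftReg_apply {G W : Type*} [Group G] [NormedAddCommGroup W] [NormedSpace ℂ W] (g : G)
    (f : G → W) (x : G) : leftReg g f x = f (g⁻¹ * x) := rfl

theorem leftReg_mem_equivSections {G W : Type*} [Group G] [NormedAddCommGroup W]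
    [NormedSpace ℂ W] {Q : Subgroup G} {ζ : Representation ℂ Q W} {f : G → W}
    (hf : f ∈ equivSections ζ) (g : G) : leftReg g f ∈ equivSections ζ := fun x q => by
  rw [leftReg_apply, leftReg_apply, ← mul_assoc, hf]

theorem continuous_pairing_integrand {X A W V : Type*} [TopologicalSpace X] [TopologicalSpace A]
    [NormedAddCommGroup W] [NormedSpace ℂ W] [NormedAddCommGroup V] [NormedSpace ℂ V]
    (Θ : C(X, W →L[ℂ] V)) {F : A → X → W} (hF : Continuous F.uncurry) :
    Continuous fun z : A × X => Θ z.2 (F z.1 z.2) :=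
  (Θ.continuous.comp continuous_snd).clm_apply hF

section Equivariance

variable {n : ℕ} {G : Type*} [Group G] [TopologicalSpace G] [IsTopologicalGroup G]
variable {p : G →* GL (Fin n) ℝ} (μ : Measure (maxCompact p))
variable {W : Type*} [NormedAddCommGroup W] [NormedSpace ℂ W]
variable {V : Type*} [NormedAddCommGroup V] [NormedSpace ℂ V]

/-- The convolution `∫_K e(k) (k · f) dk` of a function on `K` with a function on `G`. -/
def kconv (e : C(maxCompact p, ℂ)) (f : G → W) : G → W :=
  fun x => ∫ k : maxCompact p, e k • f ((k : G)⁻¹ * x) ∂μ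

/-- The functional `f ↦ ∫_K Θ(k) f(k) dk`. -/
def pairing (Θ : C(maxCompact p, W →L[ℂ] V)) (f : G → W) : V :=
  ∫ k : maxCompact p, Θ k (f k) ∂μ

theorem continuous_leftReg {f : G → W} (hf : Continuous f) (g : G) : Continuous (leftReg g f) :=
  hf.comp (continuous_const.mul continuous_id)

variable [CompactSpace (maxCompact p)] [μ.IsHaarMeasure]

theorem continuous_kconv (e : C(maxCompact p, ℂ)) {f : G → W} (hf : Continuous f) :
    Continuous (kconv μ e f) :=
  continuous_integral_param (f := fun x (k : maxCompact p) => e k • f ((k : G)⁻¹ * x)) μ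
      (by fun_prop)

/-- Translates of a convolution by `K`, in terms of `e(xy) = ∑ uⱼ(x) vⱼ(y)`. -/
theorem leftReg_kconv {e : C(maxCompact p, ℂ)} {ι : Type*} [Fintype ι]
    {u v : ι → C(maxCompact p, ℂ)} (h : ∀ x y, e (x * y) = ∑ j, u j x * v j y) {f : G → W}
    (hf : Continuous f) (k : maxCompact p) :
    leftReg k.1 (kconv μ e f) = ∑ j, u j k⁻¹ • kconv μ (v j) f := by
  ext x
  rw [leftReg_apply, Finset.sum_apply]
  simp only [Pi.smul_apply, kconv]
  rw [← integral_mul_left_eq_self _ k⁻¹]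
  simp only [h, Finset.sum_smul, ← integral_smul]
  rw [integral_finsetSum]
  · refine Finset.sum_congr rfl fun j _ => integral_congr_ae (Eventually.of_forall fun k' => ?_)
    simp only [mul_smul, InvMemClass.coe_inv, Subgroup.coe_mul, mul_inv_rev, inv_inv, mul_assoc,
      mul_inv_cancel_left]
  · intro j _
    exact integrable_of_continuous μ (by fun_prop)

theorem hasDerivAt_kconv {e : C(maxCompact p, ℂ)} {f : G → W} (hf : Continuous f)
    {D : G → lieAlg p ⊤ →ₗ[ℝ] W} (hp : IsRealReductive p) (hD : HasLieDeriv p f D)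
    {Y : lieAlg p ⊤} {γ : Multiplicative ℝ →ₜ* G}
    (hγ : IsOneParam p (Y : Matrix (Fin n) (Fin n) ℝ) γ) (x : G) :
    HasDerivAt (fun t : ℝ => kconv μ e f (γ (Multiplicative.ofAdd t) * x))
      (∫ k : maxCompact p, e k • D ((k : G)⁻¹ * x) (Ad p (k : G)⁻¹ Y) ∂μ) 0 := by
  have hγc := hγ.continuous
  have h := hasDerivAt_integral_param μ
    (f := fun t (k : maxCompact p) => e k • f ((k : G)⁻¹ * γ (Multiplicative.ofAdd t) * x))
    (f' := fun t (k : maxCompact p) =>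
      e k • D ((k : G)⁻¹ * γ (Multiplicative.ofAdd t) * x) (Ad p (k : G)⁻¹ Y))
    (fun t => by fun_prop) ?_ (fun t k => (hD.hasDerivAt_mul hγ _ _ t).const_smul (e k)) 0
  · simpa only [oneParam_zero, mul_one, mul_assoc, kconv] using h
  · have h1 : Continuous fun z : ℝ × maxCompact p => Ad p (z.2 : G)⁻¹ Y :=
      hp.continuous_Ad.comp (f := fun z : ℝ × maxCompact p => ((z.2 : G)⁻¹, Y)) (by fun_prop)
    have h2 : Continuous fun z : ℝ × maxCompact p =>
        (z.2 : G)⁻¹ * γ (Multiplicative.ofAdd z.1) * x := by fun_prop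
    exact (e.continuous.comp continuous_snd).smul (hD.continuous.comp (h2.prodMk h1))

theorem isKFinite_kconv {e : C(maxCompact p, ℂ)}
    (he : e ∈ representative (K := maxCompact p)) {f : G → W} (hf : Continuous f) :
    IsKFinite p (kconv μ e f) := by
  obtain ⟨ι, _, u, v, h⟩ := he
  refine ⟨Submodule.span ℂ (Set.range fun j => kconv μ (v j) f),
    FiniteDimensional.span_of_finite ℂ (Set.finite_range _), fun k hk => ?_⟩
  rw [leftReg_kconv μ h hf ⟨k, hk⟩]
  exact Submodule.sum_mem _ fun j _ => Submodule.smul_mem _ _ (Submodule.subset_span ⟨j, rfl⟩)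

theorem continuous_pairing_leftReg (Θ : C(maxCompact p, W →L[ℂ] V)) {f : G → W}
    (hf : Continuous f) : Continuous fun g : G => pairing μ Θ (leftReg g f) :=
  continuous_integral_param μ (f := fun g (k : maxCompact p) => Θ k (f (g⁻¹ * k)))
    (continuous_pairing_integrand Θ (F := fun g k => f (g⁻¹ * k)) (by fun_prop))

variable [FiniteDimensional ℂ W]

theorem kconv_mem_equivSections {Q : Subgroup G} {ζ : Representation ℂ Q W}
    (e : C(maxCompact p, ℂ)) {f : G → W} (hf : f ∈ equivSections ζ) (hc : Continuous f) :
    kconv μ e f ∈ equivSections ζ := by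
  have hcompl : CompleteSpace W := FiniteDimensional.complete ℂ W
  intro x q
  simp only [kconv]
  change _ = LinearMap.toContinuousLinearMap (ζ q⁻¹) _
  rw [← ContinuousLinearMap.integral_comp_comm _ (integrable_of_continuous μ (by fun_prop))]
  refine integral_congr_ae (Eventually.of_forall fun k => ?_)
  change e k • f ((k : G)⁻¹ * (x * q)) = ζ q⁻¹ (e k • f ((k : G)⁻¹ * x))
  rw [map_smul, ← mul_assoc, hf]

theorem IsParabolic.kconv_mem_gkModule [T2Space G] (hp : IsRealReductive p) {Q : Subgroup G}
    (hQ : IsParabolic p Q) {ζ : Representation ℂ Q W} (hζ : IsContinuousRep ζ)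
    {e : C(maxCompact p, ℂ)} (he : e ∈ representative (K := maxCompact p)) {f : G → W}
    (hf : f ∈ equivSections ζ) (hc : Continuous f) : kconv μ e f ∈ gkModule p ζ :=
  ⟨kconv_mem_equivSections μ e hf hc, hQ.isSmooth_of_isKFinite hp hζ
    (kconv_mem_equivSections μ e hf hc) (continuous_kconv μ e hc) (isKFinite_kconv μ he hc),
    isKFinite_kconv μ he hc⟩

variable [FiniteDimensional ℂ V]

theorem pairing_kconv (Θ : C(maxCompact p, W →L[ℂ] V)) (e : C(maxCompact p, ℂ)) {f : G → W}
    (hf : Continuous f) (g : G) :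
    pairing μ Θ (leftReg g (kconv μ e f)) =
      ∫ k : maxCompact p, e k • pairing μ Θ (leftReg g (leftReg k.1 f)) ∂μ := by
  have hW : CompleteSpace W := FiniteDimensional.complete ℂ W
  have h1 : ∀ k : maxCompact p, Θ k (leftReg g (kconv μ e f) k) =
      ∫ k' : maxCompact p, Θ k (e k' • f ((k' : G)⁻¹ * (g⁻¹ * k))) ∂μ := fun k =>
    ((Θ k).integral_comp_comm (integrable_of_continuous μ (by fun_prop))).symm
  simp only [pairing, h1, ← integral_smul]
  rw [integral_integral_swap_of_hasCompactSupport _ (HasCompactSupport.of_compactSpace _)]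
  · refine integral_congr_ae (Eventually.of_forall fun k' => integral_congr_ae
      (Eventually.of_forall fun k => ?_))
    simp only [map_smul, leftReg_apply]
  · exact (Θ.continuous.comp continuous_fst).clm_apply (by fun_prop)

/-- An infinitesimally equivariant functional on smooth sections, which is equivariant for `K`, is
equivariant on all continuous sections. Smooth sections are handled by solving a linear
differential equation along one-parameter subgroups; a continuous section is a limit of
convolutions with representative functions of `K`, which are smooth. -/
theorem IsParabolic.pairing_leftReg [T2Space G] (hp : IsRealReductive p) {Q : Subgroup G}
    (hQ : IsParabolic p Q) {ζ : Representation ℂ Q W} (hζ : IsContinuousRep ζ)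
    {σ : Representation ℂ G V} (hσ : IsContinuousRep σ) {Θ : C(maxCompact p, W →L[ℂ] V)}
    (hK : ∀ f ∈ equivSections ζ, Continuous f → ∀ k : maxCompact p,
      pairing μ Θ (leftReg k.1 f) = σ k (pairing μ Θ f))
    (hinf : ∀ f ∈ equivSections ζ, IsSmooth p f → ∀ D, HasLieDeriv p f D → ∀ (Y : lieAlg p ⊤)
      (γ : Multiplicative ℝ →ₜ* G), IsOneParam p (Y : Matrix (Fin n) (Fin n) ℝ) γ →
      HasDerivAt (fun t : ℝ => σ (γ (Multiplicative.ofAdd t)) (pairing μ Θ f))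
        (-pairing μ Θ fun x => D x Y) 0)
    {f : G → W} (hf : f ∈ equivSections ζ) (hc : Continuous f) (g : G) :
    pairing μ Θ (leftReg g f) = σ g (pairing μ Θ f) := by
  have hV : CompleteSpace V := FiniteDimensional.complete ℂ V
  -- smooth sections
  have hsm : ∀ f ∈ equivSections ζ, IsSmooth p f → ∀ (Y : lieAlg p ⊤)
      (γ : Multiplicative ℝ →ₜ* G), IsOneParam p (Y : Matrix (Fin n) (Fin n) ℝ) γ →
      pairing μ Θ (leftReg (γ (Multiplicative.ofAdd 1)) f) =
        σ (γ (Multiplicative.ofAdd 1)) (pairing μ Θ f) := by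
    intro f hf hfs Y γ hγ
    obtain ⟨D, hD⟩ := hfs.exists_hasLieDeriv hp
    have hfc := hfs.continuous hp
    have hγc := hγ.continuous
    obtain ⟨B, hB⟩ := hσ.exists_eq_exp γ
    let u : ℝ → V := fun t => pairing μ Θ (leftReg (γ (Multiplicative.ofAdd t)) f)
    have hAd : ∀ t : ℝ, Ad p (γ (Multiplicative.ofAdd t)) Y = Y := fun t => by
      apply Subtype.ext
      rw [coe_Ad, conj_apply, ← map_inv, ← oneParam_neg, hγ, hγ]
      have h1 : Commute (NormedSpace.exp (t • (Y : Matrix (Fin n) (Fin n) ℝ)))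
          (Y : Matrix (Fin n) (Fin n) ℝ) := ((Commute.refl _).smul_left t).exp_left
      rw [h1.eq, mul_assoc]
      have h2 := (expGL (t • (Y : Matrix (Fin n) (Fin n) ℝ))).mul_inv
      rw [expGL_inv, expGL_val, expGL_val, ← neg_smul] at h2
      rw [h2, mul_one]
    have hu : ∀ t, HasDerivAt u (B (u t)) t := by
      intro t
      have h1 := hasDerivAt_integral_param μ
        (f := fun t (k : maxCompact p) => Θ k (f (1 * γ (Multiplicative.ofAdd (-t)) * k)))
        (f' := fun t (k : maxCompact p) =>
          Θ k (-D (1 * γ (Multiplicative.ofAdd (-t)) * k) (Ad p 1 Y)))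
        (fun t => Θ.continuous.clm_apply (by fun_prop)) ?_ (fun t k => ?_) t
      · have h2 := hinf _ (leftReg_mem_equivSections hf (γ (Multiplicative.ofAdd t)))
          (hfs.leftReg _) _ (hD.leftReg hp (γ (Multiplicative.ofAdd t))) Y γ hγ
        have h3 : HasDerivAt (fun s : ℝ => σ (γ (Multiplicative.ofAdd s)) (u t)) (B (u t)) 0 := by
          have h4 := hasDerivAt_exp_smul_const B (0 : ℝ)
          rw [zero_smul, NormedSpace.exp_zero, one_mul] at h4
          have h5 := (((ContinuousLinearMap.apply ℂ V (u t)).restrictScalars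
            ℝ).hasFDerivAt.comp_hasDerivAt (0 : ℝ) h4)
          refine h5.congr_of_eventuallyEq (Eventually.of_forall fun s => ?_)
          change repCLM σ (γ (Multiplicative.ofAdd s)) (u t) = _
          rw [hB]; rfl
        have h6 := h3.unique h2
        rw [h6]
        refine (h1.congr_of_eventuallyEq (Eventually.of_forall fun s => ?_)).congr_deriv ?_
        · simp only [u, pairing, leftReg_apply, one_mul, oneParam_neg]
        · simp only [pairing, map_neg, integral_neg, one_mul, oneParam_neg, Ad_one,
            LinearMap.comp_apply]
          simp only [← oneParam_neg, hAd]
      · refine continuous_pairing_integrand Θ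
          (F := fun t k => -D (1 * γ (Multiplicative.ofAdd (-t)) * k) (Ad p 1 Y)) ?_
        have h2 : Continuous fun z : ℝ × maxCompact p =>
            1 * γ (Multiplicative.ofAdd (-z.1)) * (z.2 : G) := by
          have : Continuous fun z : ℝ × maxCompact p => γ (Multiplicative.ofAdd (-z.1)) :=
            hγc.comp (by fun_prop : Continuous fun z : ℝ × maxCompact p => -z.1)
          fun_prop
        exact (hD.continuous.comp (h2.prodMk continuous_const)).neg
      · have h2 := (hD.hasDerivAt_mul hγ 1 (k : G) (-t)).scomp t (hasDerivAt_neg t)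
        rw [neg_one_smul] at h2
        exact ((Θ k).restrictScalars ℝ).hasFDerivAt.comp_hasDerivAt t h2
    have hE : ∀ t : ℝ, HasDerivAt
        (fun t : ℝ => (NormedSpace.exp (t • -B)).restrictScalars ℝ (u t)) 0 t := fun t => by
      have h1 := (ContinuousLinearMap.restrictScalarsL ℂ V V ℝ ℝ).hasFDerivAt.comp_hasDerivAt t
        (hasDerivAt_exp_smul_const (-B) t)
      refine (h1.clm_apply (hu t)).congr_deriv ?_
      change (NormedSpace.exp (t • -B) * -B) (u t) + NormedSpace.exp (t • -B) (B (u t)) = 0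
      rw [mul_apply_eq_comp, neg_apply, map_neg, neg_add_cancel]
    have hconst := is_const_of_deriv_eq_zero (fun t => (hE t).differentiableAt)
      (fun t => (hE t).deriv) 1 0
    have hu0 : u 0 = pairing μ Θ f := by
      simp only [u, oneParam_zero, map_one, Module.End.one_apply]
    have h1 : repCLM σ (γ (Multiplicative.ofAdd (-1))) (u 1) = u 0 := by
      rw [hB, neg_smul, ← smul_neg]
      refine hconst.trans ?_
      change NormedSpace.exp ((0 : ℝ) • -B) (u 0) = u 0
      rw [zero_smul, NormedSpace.exp_zero]; rfl
    change u 1 = _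
    rw [← hu0, ← h1, repCLM_apply, ← Module.End.mul_apply, ← map_mul, ← oneParam_add,
      add_neg_cancel, oneParam_zero, map_one, Module.End.one_apply]
  -- continuous sections
  have hγ1 : ∀ f ∈ equivSections ζ, Continuous f → ∀ (Y : lieAlg p ⊤)
      (γ : Multiplicative ℝ →ₜ* G), IsOneParam p (Y : Matrix (Fin n) (Fin n) ℝ) γ →
      pairing μ Θ (leftReg (γ (Multiplicative.ofAdd 1)) f) =
        σ (γ (Multiplicative.ofAdd 1)) (pairing μ Θ f) := by
    intro f hf hfc Y γ hγ
    set g := γ (Multiplicative.ofAdd 1) with hg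
    let φ : maxCompact p → V := fun k =>
      pairing μ Θ (leftReg g (leftReg k.1 f)) - σ g (pairing μ Θ (leftReg k.1 f))
    have hc1 : Continuous fun k : maxCompact p => pairing μ Θ (leftReg g (leftReg k.1 f)) := by
      have h1 := (continuous_pairing_leftReg μ Θ hfc).comp
        (by fun_prop : Continuous fun k : maxCompact p => g * (k : G))
      refine h1.congr fun k => ?_
      rw [Function.comp_apply, map_mul, Module.End.mul_apply]
    have hc2 : Continuous fun k : maxCompact p => pairing μ Θ (leftReg k.1 f) :=
      (continuous_pairing_leftReg μ Θ hfc).comp continuous_subtype_val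
    have hc3 : Continuous fun k : maxCompact p => σ g (pairing μ Θ (leftReg k.1 f)) :=
      hσ.comp continuous_const hc2
    have hφ : Continuous φ := hc1.sub hc3
    have hφ0 : ∀ e ∈ representative (K := maxCompact p), ∫ k, e k • φ k ∂μ = 0 := fun e he => by
      have hmem := hQ.kconv_mem_gkModule μ hp hζ he hf hfc
      have h1 := hsm _ hmem.1 hmem.2.1 Y γ hγ
      have h2 := pairing_kconv μ Θ e hfc 1
      simp only [map_one, Module.End.one_apply] at h2
      rw [pairing_kconv μ Θ e hfc, h2] at h1
      simp only [φ, smul_sub]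
      rw [integral_sub (integrable_of_continuous μ (by fun_prop))
        (integrable_of_continuous μ (by fun_prop)), h1, sub_eq_zero]
      change repCLM σ g _ = _
      rw [← ContinuousLinearMap.integral_comp_comm _ (integrable_of_continuous μ (by fun_prop))]
      refine integral_congr_ae (Eventually.of_forall fun k => ?_)
      simp only [map_smul, repCLM_apply]
    have h1 : φ 1 = 0 := by
      by_contra hne
      obtain ⟨e, he, hlt⟩ := exists_representative_integral μ hφ (norm_pos_iff.2 hne)
      rw [hφ0 e he, zero_sub, norm_neg] at hlt
      exact lt_irrefl _ hlt
    have h2 := sub_eq_zero.1 h1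
    simpa using h2
  obtain ⟨k, hk, Y, hY, γ, hγ, rfl⟩ := hp.exists_polar g
  rw [map_mul, Module.End.mul_apply, hK _ (leftReg_mem_equivSections hf _)
    (continuous_leftReg hc _) ⟨k, hk⟩, map_mul, Module.End.mul_apply]
  congr 1
  exact hγ1 f hf hc ⟨Y, (hp.mem_lieAlg isClosed_univ).2 hY⟩ γ hγ

end Equivariance

/-! ### Invariance of the Haar measure of a compact group -/

section Unimodular

variable {K : Type*} [Group K] [TopologicalSpace K] [IsTopologicalGroup K] [CompactSpace K]
  [MeasurableSpace K] [BorelSpace K] (μ : Measure K) [μ.IsHaarMeasure]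

theorem eq_of_isMulLeftInvariant {ν : Measure K} [IsFiniteMeasure ν] [ν.IsMulLeftInvariant]
    (h : ν Set.univ = μ Set.univ) : ν = μ := by
  have h1 := Measure.isMulInvariant_eq_smul_of_compactSpace ν μ
  have h2 : (Measure.haarScalarFactor ν μ : ENNReal) * μ Set.univ = 1 * μ Set.univ := by
    rw [one_mul]; conv_rhs => rw [← h, h1]
    rfl
  have h3 := (ENNReal.mul_left_inj (IsOpen.measure_pos μ isOpen_univ Set.univ_nonempty).ne'
    (measure_ne_top μ _)).1 h2
  have h4 : Measure.haarScalarFactor ν μ = 1 := by exact_mod_cast h3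
  rw [h1, h4, one_smul]

theorem isMulRightInvariant_of_compactSpace : μ.IsMulRightInvariant where
  map_mul_right_eq_self g := by
    have h1 : (μ.map (· * g)).IsMulLeftInvariant := inferInstance
    have h2 : IsFiniteMeasure (μ.map (· * g)) := inferInstance
    refine eq_of_isMulLeftInvariant μ ?_
    rw [Measure.map_apply (by fun_prop) MeasurableSet.univ, Set.preimage_univ]

theorem isInvInvariant_of_compactSpace : μ.IsInvInvariant where
  inv_eq_self := by
    have := isMulRightInvariant_of_compactSpace μ
    have h2 : IsFiniteMeasure μ.inv := inferInstanceAs (IsFiniteMeasure (μ.map _))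
    refine eq_of_isMulLeftInvariant μ ?_
    rw [Measure.inv_apply, Set.inv_univ]

/-- A continuous function on a compact group vanishes if its integrals against all representative
functions do. -/
theorem eq_zero_of_forall_representative [T2Space K] {E : Type*} [NormedAddCommGroup E]
    [NormedSpace ℂ E] [CompleteSpace E] {φ : K → E} (hφ : Continuous φ)
    (h : ∀ e ∈ representative (K := K), ∫ k, e k • φ k ∂μ = 0) : φ 1 = 0 := by
  by_contra hne
  obtain ⟨e, he, hlt⟩ := exists_representative_integral μ hφ (norm_pos_iff.2 hne)
  rw [h e he, zero_sub, norm_neg] at hlt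
  exact lt_irrefl _ hlt

end Unimodular

/-! ### Quotients of the `(𝔤, K)`-module as integral functionals -/

/-- On a finite-dimensional space of functions, every linear map is expressed by the values at
finitely many points. -/
theorem exists_finset_eval {X W V : Type*} [AddCommGroup W] [Module ℂ W] [AddCommGroup V]
    [Module ℂ V] (F : Submodule ℂ (X → W)) [FiniteDimensional ℂ F] (T : (X → W) →ₗ[ℂ] V) :
    ∃ (s : Finset X) (L : (s → W) →ₗ[ℂ] V), ∀ f ∈ F, T f = L fun x => f x := by
  obtain ⟨s, hs⟩ := Finset.exists_inf_le
    fun x : X => LinearMap.ker ((LinearMap.proj x : (X → W) →ₗ[ℂ] W) ∘ₗ F.subtype)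
  let R : F →ₗ[ℂ] (s → W) := LinearMap.pi fun x =>
    (LinearMap.proj (x : X) : (X → W) →ₗ[ℂ] W) ∘ₗ F.subtype
  have hR : LinearMap.ker R = ⊥ := by
    refine (Submodule.eq_bot_iff _).2 fun f hf => ?_
    have h1 : f ∈ s.inf fun x : X =>
        LinearMap.ker ((LinearMap.proj x : (X → W) →ₗ[ℂ] W) ∘ₗ F.subtype) :=
      (Submodule.mem_finsetInf (p := fun x : X =>
        LinearMap.ker ((LinearMap.proj x : (X → W) →ₗ[ℂ] W) ∘ₗ F.subtype))).2
        fun x hx => congrFun hf ⟨x, hx⟩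
    ext x
    exact hs x h1
  obtain ⟨R', hR'⟩ := R.exists_leftInverse_of_injective hR
  refine ⟨s, T ∘ₗ F.subtype ∘ₗ R', fun f hf => ?_⟩
  have h1 := LinearMap.congr_fun hR' ⟨f, hf⟩
  change T f = T (R' (R ⟨f, hf⟩))
  change R' (R ⟨f, hf⟩) = ⟨f, hf⟩ at h1
  rw [h1]

section Quotient

variable {n : ℕ} {G : Type*} [Group G] [TopologicalSpace G] [IsTopologicalGroup G]
variable {p : G →* GL (Fin n) ℝ} (μ : Measure (maxCompact p))
variable {W : Type*} [NormedAddCommGroup W] [NormedSpace ℂ W]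
variable {V : Type*} [NormedAddCommGroup V] [NormedSpace ℂ V]

theorem mem_gkModule_leftReg {Q : Subgroup G} {ζ : Representation ℂ Q W} {f : G → W}
    (hf : f ∈ gkModule p ζ) {k : G} (hk : k ∈ maxCompact p) : leftReg k f ∈ gkModule p ζ := by
  obtain ⟨h1, h2, F, hF, h3⟩ := hf
  refine ⟨leftReg_mem_equivSections h1 k, h2.leftReg k, F, hF, fun k' hk' => ?_⟩
  rw [← Module.End.mul_apply, ← map_mul]
  exact h3 _ (mul_mem hk' hk)

/-- The infinitesimal action of `𝔤` preserves `E(G/Q; ζ)`. -/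
theorem HasLieDeriv.mem_gkModule [T2Space G] [FiniteDimensional ℂ W] (hp : IsRealReductive p)
    {Q : Subgroup G}
    (hQ : IsParabolic p Q) {ζ : Representation ℂ Q W} (hζ : IsContinuousRep ζ) {f : G → W}
    (hf : f ∈ gkModule p ζ) {D : G → lieAlg p ⊤ →ₗ[ℝ] W} (hD : HasLieDeriv p f D)
    (Y : lieAlg p ⊤) : (fun x => D x Y) ∈ gkModule p ζ := by
  have hsec := hD.mem_equivSections hp hf.1 Y
  have hcont : Continuous fun x => D x Y :=
      hD.continuous.comp (continuous_id.prodMk continuous_const)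
  have hKfin : IsKFinite p fun x => D x Y := by
    obtain ⟨F, hF, hfF⟩ := hf.2.2
    let F' : Submodule ℂ (G → W) :=
      Submodule.span ℂ (Set.range fun k : maxCompact p => RealFlag.leftReg k.1 f)
    have hF'F : F' ≤ F := Submodule.span_le.2 (by rintro _ ⟨k, rfl⟩; exact hfF k k.2)
    have hF'gk : F' ≤ gkModule p ζ :=
      Submodule.span_le.2 (by rintro _ ⟨k, rfl⟩; exact mem_gkModule_leftReg hf k.2)
    have hfin : FiniteDimensional ℂ F' := Submodule.finiteDimensional_of_le hF'F
    let b := Module.finBasis ℂ F'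
    let a := Module.finBasis ℝ (lieAlg p ⊤)
    have hb : ∀ i, ∃ D, HasLieDeriv p (b i).1 D := fun i =>
      (hF'gk (b i).2).2.1.exists_hasLieDeriv hp
    choose D' hD' using hb
    refine ⟨Submodule.span ℂ (Set.range fun z : Fin (Module.finrank ℂ F') ×
        Fin (Module.finrank ℝ (lieAlg p ⊤)) => fun x => D' z.1 x (a z.2)),
      FiniteDimensional.span_of_finite ℂ (Set.finite_range _), fun k hk => ?_⟩
    have hkF : RealFlag.leftReg k f ∈ F' := Submodule.subset_span ⟨⟨k, hk⟩, rfl⟩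
    -- `k · f = ∑ cᵢ bᵢ`, and `D (k⁻¹ x) Y` is the derivative of `k · f` at `x` along `Ad(k) Y`
    have h1 : ∀ x, RealFlag.leftReg k f x = ∑ i, b.repr ⟨_, hkF⟩ i • (b i).1 x := fun x => by
      have h2 := congrArg (fun φ : F' => φ.1 x) (b.sum_repr ⟨_, hkF⟩)
      simp only [Submodule.coe_sum, Submodule.coe_smul, Finset.sum_apply, Pi.smul_apply] at h2
      exact h2.symm
    have h2 : ∀ x, D (k⁻¹ * x) Y = ∑ i, b.repr ⟨_, hkF⟩ i • D' i x (Ad p k Y) := fun x => by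
      obtain ⟨γ, hγ⟩ := hp.exists_isOneParam
        ((hp.mem_lieAlg isClosed_univ).1 (Ad p k Y).2)
      have h3 := (hD.leftReg hp k).hasDerivAt (Ad p k Y) γ hγ x
      simp only [LinearMap.comp_apply, ← Ad_mul, inv_mul_cancel, Ad_one] at h3
      refine h3.unique ?_
      simp only [h1]
      exact HasDerivAt.fun_sum fun i _ => ((hD' i).hasDerivAt _ γ hγ x).const_smul _
    have h3 : RealFlag.leftReg k (fun x => D x Y) = ∑ i, ∑ j, (b.repr ⟨_, hkF⟩ i *
        ((a.repr (Ad p k Y) j : ℝ) : ℂ)) • fun x => D' i x (a j) := by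
      ext x
      rw [leftReg_apply, h2]
      simp only [Finset.sum_apply, Pi.smul_apply]
      refine Finset.sum_congr rfl fun i _ => ?_
      conv_lhs => rw [← a.sum_repr (Ad p k Y), map_sum, Finset.smul_sum]
      refine Finset.sum_congr rfl fun j _ => ?_
      rw [map_smul, mul_smul, Complex.coe_smul]
    rw [h3]
    exact Submodule.sum_mem _ fun i _ => Submodule.sum_mem _ fun j _ =>
      Submodule.smul_mem _ _ (Submodule.subset_span ⟨(i, j), rfl⟩)
  exact ⟨hsec, hQ.isSmooth_of_isKFinite hp hζ hsec hcont hKfin, hKfin⟩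

variable [CompactSpace (maxCompact p)] [μ.IsHaarMeasure]

theorem kconv_apply_coe (e : C(maxCompact p, ℂ)) (f : G → W) (x : maxCompact p) :
    kconv μ e f x = ∫ k : maxCompact p, e (x * k⁻¹) • f k ∂μ := by
  have := isInvInvariant_of_compactSpace μ
  rw [← integral_inv_eq_self, kconv, ← integral_mul_left_eq_self _ x]
  refine integral_congr_ae (Eventually.of_forall fun k => ?_)
  simp only [inv_inv, Subgroup.coe_mul, mul_inv_rev, inv_mul_cancel_right, InvMemClass.coe_inv]

variable [FiniteDimensional ℂ W] [FiniteDimensional ℂ V]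

theorem map_kconv (T : (G → W) →ₗ[ℂ] V) (e : C(maxCompact p, ℂ)) {f : G → W} (hf : Continuous f)
    (hK : IsKFinite p f) :
    T (kconv μ e f) = ∫ k : maxCompact p, e k • T (leftReg k.1 f) ∂μ := by
  have hW : CompleteSpace W := FiniteDimensional.complete ℂ W
  obtain ⟨F, hF, hfF⟩ := hK
  obtain ⟨s, L, hL⟩ := exists_finset_eval (F ⊔ Submodule.span ℂ {kconv μ e f}) T
  rw [hL _ (Submodule.mem_sup_right (Submodule.mem_span_singleton_self _))]
  let v : maxCompact p → s → W := fun k x => e k • f ((k : G)⁻¹ * x)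
  have hv : Continuous v := by fun_prop
  have hvi : Integrable v μ := integrable_of_continuous μ hv
  have h1 : (fun x : s => kconv μ e f x) = ∫ k, v k ∂μ := by
    ext x
    exact eval_integral (f := v)
      (fun x => integrable_of_continuous μ (by fun_prop)) x |>.symm
  have hV : CompleteSpace V := FiniteDimensional.complete ℂ V
  rw [h1]
  refine ((LinearMap.toContinuousLinearMap L).integral_comp_comm hvi).symm.trans
    (integral_congr_ae (Eventually.of_forall fun k => ?_))
  change L (v k) = e k • T (leftReg k.1 f)
  rw [hL _ (Submodule.mem_sup_left (hfF k k.2)), ← map_smul]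
  rfl

/-- Convolutions with a representative function depend, on `K`, on finitely many integrals. Hence
a linear map on them is an integral functional. -/
theorem exists_pairing_of_representative (T : (maxCompact p → W) →ₗ[ℂ] V) {e : C(maxCompact p, ℂ)}
    (he : e ∈ representative (K := maxCompact p)) :
    ∃ Θ : C(maxCompact p, W →L[ℂ] V), ∀ f : G → W, Continuous f →
      T (fun k => kconv μ e f k) = pairing μ Θ f := by
  obtain ⟨ι, _, u, v, h⟩ := he
  have hW : CompleteSpace W := FiniteDimensional.complete ℂ W
  have hV : CompleteSpace V := FiniteDimensional.complete ℂ V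
  let L : ι → W →ₗ[ℂ] V := fun j =>
    T ∘ₗ LinearMap.pi fun x => u j x • LinearMap.id
  refine ⟨⟨fun k => ∑ j, v j k⁻¹ • LinearMap.toContinuousLinearMap (L j), by fun_prop⟩,
    fun f hf => ?_⟩
  have h1 : (fun k : maxCompact p => kconv μ e f k) =
      ∑ j, fun x => u j x • ∫ k : maxCompact p, v j k⁻¹ • f k ∂μ := by
    ext x
    rw [kconv_apply_coe, Finset.sum_apply]
    simp only [h, Finset.sum_smul, mul_smul, ← integral_smul]
    rw [integral_finsetSum]
    exact fun j _ => integrable_of_continuous μ (by fun_prop)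
  rw [h1, map_sum]
  simp only [pairing, ContinuousMap.coe_mk, sum_apply, smul_apply]
  rw [integral_finsetSum]
  · refine Finset.sum_congr rfl fun j _ => ?_
    change L j _ = _
    refine ((LinearMap.toContinuousLinearMap (L j)).integral_comp_comm
      (integrable_of_continuous μ (by fun_prop))).symm.trans
      (integral_congr_ae (Eventually.of_forall fun k => ?_))
    exact map_smul _ _ _
  · exact fun j _ => integrable_of_continuous μ (by fun_prop)

/-- A finite-dimensional quotient of `E(G/Q; ζ)` is given by an integral over `K`: choose `e` with
`∫ e(k) σ(k) dk` invertible, so that the quotient map is determined by its values on convolutions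
with `e`. -/
theorem IsParabolic.exists_pairing [T2Space G] (hp : IsRealReductive p) {Q : Subgroup G}
    (hQ : IsParabolic p Q) {ζ : Representation ℂ Q W}
    {σ : Representation ℂ G V} (hσ : IsContinuousRep σ) (T : gkModule p ζ →ₗ[ℂ] V)
    (hζ : IsContinuousRep ζ)
    (hT : ∀ k ∈ maxCompact p, ∀ f f' : gkModule p ζ,
      (∀ x : G, f'.1 x = f.1 (k⁻¹ * x)) → T f' = σ k (T f)) :
    ∃ Θ : C(maxCompact p, W →L[ℂ] V), ∀ f : gkModule p ζ, T f = pairing μ Θ f.1 := by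
  have hV : CompleteSpace V := FiniteDimensional.complete ℂ V
  have hKc : Continuous fun k : maxCompact p => repCLM σ (k : G) :=
    hσ.continuous_repCLM.comp continuous_subtype_val
  obtain ⟨e, he, hlt⟩ := exists_representative_integral μ hKc one_pos
  simp only [OneMemClass.coe_one, repCLM_one] at hlt
  set B : V →L[ℂ] V := ∫ k : maxCompact p, e k • repCLM σ (k : G) ∂μ with hB
  obtain ⟨u, hu⟩ : IsUnit B := by
    have h1 := isUnit_one_sub_of_norm_lt_one (x := 1 - B) (by rwa [norm_sub_rev])
    rwa [sub_sub_cancel] at h1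
  -- restriction to `K` is injective
  let R : gkModule p ζ →ₗ[ℂ] (maxCompact p → W) :=
    LinearMap.funLeft ℂ W (fun k : maxCompact p => (k : G)) ∘ₗ (gkModule p ζ).subtype
  have hR : LinearMap.ker R = ⊥ := LinearMap.ker_eq_bot.2 fun f f' h => Subtype.ext
    (hQ.section_ext hp f.2.1 f'.2.1 fun k hk => congrFun h ⟨k, hk⟩)
  obtain ⟨R', hR'⟩ := R.exists_leftInverse_of_injective hR
  obtain ⟨T', hT'⟩ := T.exists_extend
  obtain ⟨Θ, hΘ⟩ := exists_pairing_of_representative μ (T ∘ₗ R') he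
  refine ⟨⟨fun k => (↑u⁻¹ : V →L[ℂ] V).comp (Θ k), continuous_const.clm_comp Θ.continuous⟩,
    fun f => ?_⟩
  have hfc := f.2.2.1.continuous hp
  have hT'f : ∀ φ : gkModule p ζ, T' φ.1 = T φ := fun φ => LinearMap.congr_fun hT' φ
  have hk := hQ.kconv_mem_gkModule μ hp hζ he f.2.1 hfc
  have h1 : T ⟨_, hk⟩ = B (T f) := by
    rw [← hT'f, map_kconv μ T' e hfc f.2.2.2, hB]
    change _ = ContinuousLinearMap.apply ℂ V (T f) _
    rw [← ContinuousLinearMap.integral_comp_comm _ (integrable_of_continuous μ (by fun_prop))]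
    refine integral_congr_ae (Eventually.of_forall fun k => ?_)
    change e k • T' (leftReg k.1 f.1) = e k • σ k (T f)
    congr 1
    exact (hT'f ⟨_, mem_gkModule_leftReg f.2 k.2⟩).trans (hT k k.2 f _ fun x => rfl)
  have h2 : T ⟨_, hk⟩ = pairing μ Θ f.1 := by
    rw [← hΘ f.1 hfc]
    have h3 := LinearMap.congr_fun hR' ⟨_, hk⟩
    exact congrArg T h3.symm
  have h4 : pairing μ ⟨fun k => (↑u⁻¹ : V →L[ℂ] V).comp (Θ k),
      continuous_const.clm_comp Θ.continuous⟩ f.1 = (↑u⁻¹ : V →L[ℂ] V) (pairing μ Θ f.1) :=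
    (↑u⁻¹ : V →L[ℂ] V).integral_comp_comm (integrable_of_continuous μ (Θ.continuous.clm_apply
      (hfc.comp continuous_subtype_val)))
  rw [h4, ← h2, h1, ← hu, ← mul_apply_eq_comp, Units.inv_mul]
  rfl

/-- A finite-dimensional quotient `σ` of `E(G/Q; ζ)` is given by an integral over `K` which is
equivariant under `G` on all continuous sections. -/
theorem IsParabolic.exists_equivariant_pairing [T2Space G] (hp : IsRealReductive p)
    {Q : Subgroup G} (hQ : IsParabolic p Q) {ζ : Representation ℂ Q W} (hζ : IsContinuousRep ζ)
    {σ : Representation ℂ G V} (hσ : IsContinuousRep σ) (h : IsQuotientOfGKModule p ζ σ) :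
    ∃ Θ : C(maxCompact p, W →L[ℂ] V),
      (∀ f ∈ equivSections ζ, Continuous f → ∀ g : G,
        pairing μ Θ (leftReg g f) = σ g (pairing μ Θ f)) ∧
      ∀ v, ∃ f ∈ equivSections ζ, Continuous f ∧ pairing μ Θ f = v := by
  have hV : CompleteSpace V := FiniteDimensional.complete ℂ V
  have hW : CompleteSpace W := FiniteDimensional.complete ℂ W
  obtain ⟨T, hTs, hTK, hTγ⟩ := h
  obtain ⟨Θ, hΘ⟩ := hQ.exists_pairing μ hp hσ T hζ hTK
  refine ⟨Θ, fun f hf hc g => hQ.pairing_leftReg μ hp hζ hσ ?_ ?_ hf hc g, fun v => ?_⟩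
  · intro f hf hc k
    let φ : maxCompact p → V := fun k' =>
      pairing μ Θ (leftReg k.1 (leftReg k'.1 f)) - σ k (pairing μ Θ (leftReg k'.1 f))
    have hc1 : Continuous fun k' : maxCompact p => pairing μ Θ (leftReg k.1 (leftReg k'.1 f)) := by
      have h1 := (continuous_pairing_leftReg μ Θ hc).comp
        (by fun_prop : Continuous fun k' : maxCompact p => k.1 * (k' : G))
      refine h1.congr fun k' => ?_
      rw [Function.comp_apply, map_mul, Module.End.mul_apply]
    have hc2 : Continuous fun k' : maxCompact p => pairing μ Θ (leftReg k'.1 f) :=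
      (continuous_pairing_leftReg μ Θ hc).comp continuous_subtype_val
    have hc3 : Continuous fun k' : maxCompact p => σ k (pairing μ Θ (leftReg k'.1 f)) :=
      hσ.comp continuous_const hc2
    have h0 : φ 1 = 0 := by
      refine eq_zero_of_forall_representative μ (hc1.sub hc3) fun e he => ?_
      have hmem := hQ.kconv_mem_gkModule μ hp hζ he hf hc
      have h1 := hTK k k.2 ⟨_, hmem⟩ ⟨_, mem_gkModule_leftReg hmem k.2⟩ fun x => rfl
      have h2 := pairing_kconv μ Θ e hc 1
      simp only [map_one, Module.End.one_apply] at h2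
      rw [hΘ, hΘ, pairing_kconv μ Θ e hc, h2] at h1
      change ∫ k', e k' • φ k' ∂μ = 0
      simp only [φ, smul_sub]
      rw [integral_sub (integrable_of_continuous μ (by fun_prop))
        (integrable_of_continuous μ (by fun_prop)), h1, sub_eq_zero]
      change repCLM σ k _ = _
      rw [← ContinuousLinearMap.integral_comp_comm _ (integrable_of_continuous μ (by fun_prop))]
      refine integral_congr_ae (Eventually.of_forall fun k' => ?_)
      simp only [map_smul, repCLM_apply]
    simpa [φ] using sub_eq_zero.1 h0
  · intro f hf hfs D hD Y γ hγ
    have hc := hfs.continuous hp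
    obtain ⟨B, hB⟩ := hσ.exists_eq_exp γ
    have hder : ∀ v, HasDerivAt (fun t : ℝ => σ (γ (Multiplicative.ofAdd t)) v) (B v) 0 := by
      intro v
      have h4 := hasDerivAt_exp_smul_const B (0 : ℝ)
      rw [zero_smul, NormedSpace.exp_zero, one_mul] at h4
      refine (((ContinuousLinearMap.apply ℂ V v).restrictScalars
        ℝ).hasFDerivAt.comp_hasDerivAt (0 : ℝ) h4).congr_of_eventuallyEq
        (Eventually.of_forall fun s => ?_)
      change repCLM σ (γ (Multiplicative.ofAdd s)) v = _
      rw [hB]; rfl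
    refine (hder _).congr_deriv (eq_neg_of_add_eq_zero_left ?_)
    let φ : maxCompact p → V := fun k => B (pairing μ Θ (leftReg k.1 f)) +
      pairing μ Θ fun x => D ((k : G)⁻¹ * x) (Ad p (k : G)⁻¹ Y)
    have hDc : Continuous fun z : maxCompact p × maxCompact p =>
        D ((z.1 : G)⁻¹ * z.2) (Ad p (z.1 : G)⁻¹ Y) := by
      have h1 : Continuous fun z : maxCompact p × maxCompact p => Ad p (z.1 : G)⁻¹ Y :=
        hp.continuous_Ad.comp (f := fun z : maxCompact p × maxCompact p => ((z.1 : G)⁻¹, Y))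
          (by fun_prop)
      exact hD.continuous.comp ((by fun_prop : Continuous fun z : maxCompact p × maxCompact p =>
        (z.1 : G)⁻¹ * (z.2 : G)).prodMk h1)
    have hc1 : Continuous fun k : maxCompact p => B (pairing μ Θ (leftReg k.1 f)) :=
      B.continuous.comp ((continuous_pairing_leftReg μ Θ hc).comp continuous_subtype_val)
    have hc2 : Continuous fun k : maxCompact p =>
        pairing μ Θ fun x => D ((k : G)⁻¹ * x) (Ad p (k : G)⁻¹ Y) :=
      continuous_integral_param μ (continuous_pairing_integrand Θ
        (F := fun k x : maxCompact p => D ((k : G)⁻¹ * x) (Ad p (k : G)⁻¹ Y)) hDc)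
    have h0 : φ 1 = 0 := by
      refine eq_zero_of_forall_representative μ (hc1.add hc2) fun e he => ?_
      have hmem := hQ.kconv_mem_gkModule μ hp hζ he hf hc
      obtain ⟨D', hD'⟩ := hmem.2.1.exists_hasLieDeriv hp
      have hmem' := hD'.mem_gkModule hp hQ hζ hmem Y
      have h1 : HasDerivAt (fun t : ℝ => σ (γ (Multiplicative.ofAdd t)) (T ⟨_, hmem⟩))
          (T (-⟨_, hmem'⟩)) 0 := by
        refine hTγ γ ⟨_, hmem⟩ (-⟨_, hmem'⟩) fun x => ?_
        have h2 := hD'.hasDerivAt Y γ hγ x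
        have h3 := h2.scomp_of_eq (0 : ℝ) (hasDerivAt_neg (0 : ℝ)) neg_zero.symm
        rw [neg_one_smul] at h3
        refine h3.congr_of_eventuallyEq (Eventually.of_forall fun t => ?_)
        simp only [Function.comp_apply, oneParam_neg]
      have h2 := (hder _).unique h1
      have h3 := pairing_kconv μ Θ e hc 1
      simp only [map_one, Module.End.one_apply] at h3
      have h4 : pairing μ Θ (fun x => D' x Y) = ∫ k : maxCompact p, e k •
          pairing μ Θ (fun x => D ((k : G)⁻¹ * x) (Ad p (k : G)⁻¹ Y)) ∂μ := by
        have h5 : ∀ x : maxCompact p, Θ x (D' x Y) =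
            ∫ k : maxCompact p, Θ x (e k • D ((k : G)⁻¹ * x) (Ad p (k : G)⁻¹ Y)) ∂μ := fun x => by
          rw [(hD'.hasDerivAt Y γ hγ x).unique (hasDerivAt_kconv μ hc hp hD hγ (x : G))]
          exact ((Θ x).integral_comp_comm (integrable_of_continuous μ (e.continuous.smul
            (hDc.comp (continuous_id.prodMk continuous_const))))).symm
        simp only [pairing, h5, ← integral_smul]
        rw [integral_integral_swap_of_hasCompactSupport _ (HasCompactSupport.of_compactSpace _)]
        · refine integral_congr_ae (Eventually.of_forall fun k => integral_congr_ae
            (Eventually.of_forall fun x => ?_))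
          simp only [map_smul]
        · exact (Θ.continuous.comp continuous_fst).clm_apply ((e.continuous.comp
            continuous_snd).smul (hDc.comp (continuous_snd.prodMk continuous_fst)))
      rw [map_neg, hΘ, hΘ, h3, h4] at h2
      change ∫ k, e k • φ k ∂μ = 0
      simp only [φ, smul_add]
      have h5 : Continuous fun k : maxCompact p => e k • pairing μ Θ (leftReg k.1 f) :=
        e.continuous.smul ((continuous_pairing_leftReg μ Θ hc).comp continuous_subtype_val)
      have h6 : Integrable (fun k : maxCompact p => e k • B (pairing μ Θ (leftReg k.1 f))) μ :=
        integrable_of_continuous μ (e.continuous.smul hc1)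
      have h7 : Integrable (fun k : maxCompact p =>
          e k • pairing μ Θ fun x => D ((k : G)⁻¹ * x) (Ad p (k : G)⁻¹ Y)) μ :=
        integrable_of_continuous μ (e.continuous.smul hc2)
      rw [integral_add h6 h7, add_eq_zero_iff_eq_neg, ← h2,
        ← B.integral_comp_comm (integrable_of_continuous μ h5)]
      refine integral_congr_ae (Eventually.of_forall fun k => ?_)
      simp only [map_smul]
    simpa [φ, Ad_one] using h0
  · obtain ⟨f, rfl⟩ := hTs v
    exact ⟨f.1, f.2.1, f.2.2.1.continuous hp, (hΘ f).symm⟩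

end Quotient

/-! ### Integration of densities over `K` -/

/-- An orthonormal family in `𝔨` complementary to `𝔮`, with the coordinate functionals along `𝔮`.
On `𝔨` these functionals are orthogonal projections. -/
theorem exists_orthonormal_complement {E : Type*} [NormedAddCommGroup E] [InnerProductSpace ℝ E]
    [FiniteDimensional ℝ E] {𝔤 𝔨 𝔮 : Submodule ℝ E} (h : 𝔤 ≤ 𝔨 ⊔ 𝔮) :
    ∃ (d : ℕ) (z : Fin d → E) (α : Fin d → E →ₗ[ℝ] ℝ), (∀ i, z i ∈ 𝔨) ∧
      (∀ i, ∀ x ∈ 𝔮, α i x = 0) ∧ (∀ i, ∀ x ∈ 𝔨, α i x = inner ℝ (z i) x) ∧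
      (∀ i j, α i (z j) = if i = j then 1 else 0) ∧
      ∀ x ∈ 𝔤, x - ∑ i, α i x • z i ∈ 𝔮 := by
  -- The family is an orthonormal basis of `𝔪`, and `P` extends the projection of `𝔨 + 𝔮` to `𝔪`
  -- along `𝔮`.
  let 𝔪 : Submodule ℝ E := 𝔨 ⊓ (𝔨 ⊓ 𝔮)ᗮ
  let b := stdOrthonormalBasis ℝ 𝔪
  have hker : LinearMap.ker (𝔮.mkQ ∘ₗ 𝔪.subtype) = ⊥ := by
    refine (Submodule.eq_bot_iff _).2 fun x hx => Subtype.ext ?_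
    have h1 : x.1 ∈ 𝔮 := (Submodule.Quotient.mk_eq_zero 𝔮).1 hx
    exact inner_self_eq_zero.1 (((𝔨 ⊓ 𝔮).mem_orthogonal _).1 x.2.2 x.1 ⟨x.2.1, h1⟩)
  obtain ⟨L, hL⟩ := LinearMap.exists_leftInverse_of_injective _ hker
  let P : E →ₗ[ℝ] 𝔪 := L ∘ₗ 𝔮.mkQ
  have hPm : ∀ x : 𝔪, P x = x := fun x => LinearMap.congr_fun hL x
  have hPq : ∀ x ∈ 𝔮, P x = 0 := fun x hx => by
    change L (𝔮.mkQ x) = 0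
    rw [Submodule.mkQ_apply, (Submodule.Quotient.mk_eq_zero 𝔮).2 hx, map_zero]
  have hk : ∀ x ∈ 𝔨, x - P x ∈ 𝔨 ⊓ 𝔮 := fun x hx => by
    obtain ⟨y, hy, w, hw, rfl⟩ := Submodule.exists_add_mem_mem_orthogonal (K := 𝔨 ⊓ 𝔮) x
    have hwk : w ∈ 𝔨 := by simpa using 𝔨.sub_mem hx hy.1
    have h1 := hPm ⟨w, hwk, hw⟩
    rw [map_add, hPq y hy.2, zero_add, h1]
    simpa using hy
  refine ⟨_, fun i => (b i : E), fun i => (innerₛₗ ℝ (b i : E)) ∘ₗ 𝔪.subtype ∘ₗ P,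
    fun i => (b i).2.1, fun i x hx => ?_, fun i x hx => ?_, fun i j => ?_, fun x hx => ?_⟩
  · simp [hPq x hx]
  · change inner ℝ (b i : E) (P x : E) = _
    have h1 := ((𝔨 ⊓ 𝔮).mem_orthogonal' _).1 (b i).2.2 _ (hk x hx)
    rw [inner_sub_right, sub_eq_zero] at h1
    exact h1.symm
  · change inner ℝ (b i : E) (P (b j) : E) = _
    rw [hPm]
    exact orthonormal_iff_ite.1 b.orthonormal i j
  · have h1 : (P x : E) = ∑ i, inner ℝ (b i : E) (P x : E) • (b i : E) := by
      conv_lhs => rw [← b.sum_repr (P x)]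
      simp [b.repr_apply_apply]
    change x - ∑ i, inner ℝ (b i : E) (P x : E) • (b i : E) ∈ 𝔮
    rw [← h1]
    obtain ⟨y, hy, w, hw, rfl⟩ := Submodule.mem_sup.1 (h hx)
    rw [map_add, hPq w hw, add_zero, add_sub_right_comm]
    exact add_mem (hk y hy).2 hw

section Density

variable {n : ℕ} {G : Type*} [Group G] {p : G →* GL (Fin n) ℝ}

theorem transpose_eq_neg_of_mem_lieSet {A : Matrix (Fin n) (Fin n) ℝ}
    (hA : A ∈ lieSet p (maxCompact p)) : A.transpose = -A := by
  have h1 : HasDerivAt (fun t : ℝ => NormedSpace.exp (t • A.transpose) * NormedSpace.exp (t • A))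
      (A.transpose * NormedSpace.exp ((0 : ℝ) • A) +
        NormedSpace.exp ((0 : ℝ) • A.transpose) * A) 0 :=
    (hasDerivAt_exp_smul_zero _).mul (hasDerivAt_exp_smul_zero _)
  have h2 : (fun t : ℝ => NormedSpace.exp (t • A.transpose) * NormedSpace.exp (t • A)) =
      fun _ => 1 := by
    ext1 t
    obtain ⟨k, hk, hkt⟩ := hA t
    rw [← Matrix.transpose_smul, Matrix.exp_transpose, ← hkt]
    exact hk
  rw [h2] at h1
  have h3 := h1.unique (hasDerivAt_const (0 : ℝ) (1 : Matrix (Fin n) (Fin n) ℝ))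
  simp only [zero_smul, NormedSpace.exp_zero, one_mul, mul_one] at h3
  exact eq_neg_of_add_eq_zero_left h3

/-- In the frame `Z` of `𝔤/𝔮`, the determinant of `Ad_#(q)` is `det(αᵢ(Ad(q) Zⱼ))`. -/
theorem det_AdQuot {Q : Subgroup G} {d : ℕ} {Z : Fin d → Matrix (Fin n) (Fin n) ℝ}
    {α : Fin d → Matrix (Fin n) (Fin n) ℝ →ₗ[ℝ] ℝ} (hZ : ∀ i, Z i ∈ lieAlg p ⊤)
    (h0 : ∀ i, ∀ A ∈ lieAlg p Q, α i A = 0)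
    (h1 : ∀ i j, α i (Z j) = if i = j then 1 else 0)
    (h2 : ∀ A ∈ lieAlg p ⊤, A - ∑ i, α i A • Z i ∈ lieAlg p Q) (q : Q) :
    LinearMap.det (AdQuot p Q q) = (Matrix.of fun i j => α i (conj (p q) (Z j))).det := by
  let e : (lieAlg p ⊤ ⧸ lieSub p Q) ≃ₗ[ℝ] (Fin d → ℝ) :=
    { (lieSub p Q).liftQ (LinearMap.pi fun i => α i ∘ₗ (lieAlg p ⊤).subtype) (fun A hA => by
        ext i
        exact h0 i _ hA) with
      invFun := fun c => (lieSub p Q).mkQ (∑ i, c i • ⟨Z i, hZ i⟩)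
      left_inv := fun A => by
        induction A using Submodule.Quotient.induction_on with
        | H A =>
          refine ((Submodule.Quotient.eq _).2 ?_).symm
          change (A : Matrix (Fin n) (Fin n) ℝ) - _ ∈ lieAlg p Q
          change (A : Matrix (Fin n) (Fin n) ℝ) -
            (∑ i, α i A • (⟨Z i, hZ i⟩ : lieAlg p ⊤) : lieAlg p ⊤) ∈ lieAlg p Q
          simpa using h2 A.1 A.2
      right_inv := fun c => by
        ext i
        change α i (∑ j, c j • (⟨Z j, hZ j⟩ : lieAlg p ⊤) : lieAlg p ⊤) = c i
        simp [h1] }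
  let b := Module.Basis.ofEquivFun e
  have hb : ∀ j, b j = (lieSub p Q).mkQ ⟨Z j, hZ j⟩ := fun j => by
    rw [Module.Basis.coe_ofEquivFun]
    change (lieSub p Q).mkQ (∑ i, (Pi.single j 1 : Fin d → ℝ) i • (⟨Z i, hZ i⟩ : lieAlg p ⊤)) = _
    congr 1
    simp [Pi.single_apply]
  rw [← LinearMap.det_toMatrix b]
  congr 1
  ext i j
  rw [LinearMap.toMatrix_apply, hb]
  rfl

theorem abs_det_AdQuot_mul {Q : Subgroup G} (a b : Q) :
    |LinearMap.det (AdQuot p Q (a * b))| =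
      |LinearMap.det (AdQuot p Q a)| * |LinearMap.det (AdQuot p Q b)| := by
  rw [AdQuot_mul, LinearMap.det_comp, abs_mul]

theorem abs_det_AdQuot_one (Q : Subgroup G) : |LinearMap.det (AdQuot p Q 1)| = 1 := by
  rw [AdQuot_one, LinearMap.det_id, abs_one]

theorem abs_det_AdQuot_inv {Q : Subgroup G} (q : Q) :
    |LinearMap.det (AdQuot p Q q⁻¹)|⁻¹ = |LinearMap.det (AdQuot p Q q)| :=
  inv_eq_of_mul_eq_one_right (by rw [← abs_det_AdQuot_mul, inv_mul_cancel, abs_det_AdQuot_one])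

theorem abs_det_AdQuot_pos {Q : Subgroup G} (q : Q) : 0 < |LinearMap.det (AdQuot p Q q)| := by
  have h : |LinearMap.det (AdQuot p Q q)| * |LinearMap.det (AdQuot p Q q⁻¹)| = 1 := by
    rw [← abs_det_AdQuot_mul, mul_inv_cancel, abs_det_AdQuot_one]
  exact (abs_nonneg _).lt_of_ne' (left_ne_zero_of_mul_eq_one h)

theorem densityRep_inv_apply {Q : Subgroup G} (q : Q) (z : ℂ) :
    densityRep p Q q⁻¹ z = |LinearMap.det (AdQuot p Q q)| • z := by
  change ((|LinearMap.det (AdQuot p Q q⁻¹)|⁻¹ : ℝ) : ℂ) • z = _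
  rw [abs_det_AdQuot_inv, Complex.coe_smul]

theorem section_densityRep {Q : Subgroup G} {f : G → ℂ} (hf : f ∈ equivSections (densityRep p Q))
    (x : G) (q : Q) : f (x * q) = |LinearMap.det (AdQuot p Q q)| • f x := by
  rw [hf, densityRep_inv_apply]

variable [TopologicalSpace G]

/-- The derivative of `t ↦ Ad(γ(t)) A` at `0`. -/
theorem IsOneParam.hasDerivAt_conj {Y : Matrix (Fin n) (Fin n) ℝ} {γ : Multiplicative ℝ →ₜ* G}
    (hγ : IsOneParam p Y γ) (A : Matrix (Fin n) (Fin n) ℝ) (s : ℝ) :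
    HasDerivAt (fun t : ℝ => conj (p (γ (Multiplicative.ofAdd t))) A)
      (conj (p (γ (Multiplicative.ofAdd s))) (Y * A - A * Y)) s := by
  have h1 : ∀ t : ℝ, conj (p (γ (Multiplicative.ofAdd t))) A =
      NormedSpace.exp (t • Y) * A * NormedSpace.exp (t • -Y) := fun t => by
    rw [conj_apply, ← map_inv, ← oneParam_neg, hγ, hγ, neg_smul, smul_neg]
  have h2 := (hasDerivAt_exp_smul Y s).mul_const A |>.mul (hasDerivAt_exp_smul (-Y) s)
  refine (h2.congr_of_eventuallyEq (Eventually.of_forall h1)).congr_deriv ?_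
  rw [conj_apply, ← map_inv, ← oneParam_neg, hγ, hγ, neg_smul, ← smul_neg]
  have h3 : NormedSpace.exp (s • -Y) * -Y = -Y * NormedSpace.exp (s • -Y) := by
    have := ((Commute.refl (-Y)).smul_left s).exp_left
    exact this.eq
  rw [h3]
  noncomm_ring

theorem IsRealReductive.continuous_conj (hp : IsRealReductive p) :
    Continuous fun z : G × Matrix (Fin n) (Fin n) ℝ => conj (p z.1) z.2 := by
  simp only [conj_apply]
  have h1 : Continuous fun z : G × Matrix (Fin n) (Fin n) ℝ => p z.1 :=
    hp.continuous.comp continuous_fst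
  exact ((Units.continuous_val.comp h1).mul continuous_snd).mul
    (Units.continuous_val.comp h1.inv)

variable [IsTopologicalGroup G]

theorem IsParabolic.exists_adapted_frame (hp : IsRealReductive p) {Q : Subgroup G}
    (hQ : IsParabolic p Q) :
    ∃ (d : ℕ) (Z : Fin d → Matrix (Fin n) (Fin n) ℝ)
      (α : Fin d → Matrix (Fin n) (Fin n) ℝ →ₗ[ℝ] ℝ), (∀ i, Z i ∈ lieAlg p (maxCompact p)) ∧
      (∀ i, ∀ A ∈ lieAlg p Q, α i A = 0) ∧
      (∀ i, ∀ A ∈ lieAlg p (maxCompact p), α i A = (Z i * A.transpose).trace) ∧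
      (∀ i j, α i (Z j) = if i = j then 1 else 0) ∧
      ∀ A ∈ lieAlg p ⊤, A - ∑ i, α i A • Z i ∈ lieAlg p Q := by
  have h1 : (lieAlg p ⊤).map toEuclid.toLinearMap ≤
      (lieAlg p (maxCompact p)).map toEuclid.toLinearMap ⊔
        (lieAlg p Q).map toEuclid.toLinearMap := by
    rw [← Submodule.map_sup]
    exact Submodule.map_mono (hQ.lieAlg_le hp)
  obtain ⟨d, z, α, hz, h2, h3, h4, h5⟩ := exists_orthonormal_complement h1
  refine ⟨d, fun i => toEuclid.symm (z i), fun i => α i ∘ₗ toEuclid.toLinearMap, fun i => ?_,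
    fun i A hA => h2 i _ ⟨A, hA, rfl⟩, fun i A hA => ?_, fun i j => ?_, fun A hA => ?_⟩
  · obtain ⟨A, hA, hAz⟩ := hz i
    change toEuclid.symm (z i) ∈ _
    rw [← hAz]
    exact hA
  · rw [← inner_toEuclid, LinearEquiv.apply_symm_apply]
    exact h3 i _ ⟨A, hA, rfl⟩
  · simpa using h4 i j
  · obtain ⟨B, hB, hBA⟩ := h5 _ ⟨A, hA, rfl⟩
    have h6 : B = A - ∑ i, α i (toEuclid A) • toEuclid.symm (z i) := by
      apply toEuclid.injective
      rw [map_sub, map_sum]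
      simp only [map_smul, LinearEquiv.apply_symm_apply]
      exact hBA
    exact h6 ▸ hB

theorem IsParabolic.continuous_det_AdQuot (hp : IsRealReductive p) {Q : Subgroup G}
    (hQ : IsParabolic p Q) : Continuous fun q : Q => LinearMap.det (AdQuot p Q q) := by
  obtain ⟨d, Z, α, hZ, h0, htr, hδ, hsub⟩ := hQ.exists_adapted_frame hp
  have hZg : ∀ i, Z i ∈ lieAlg p ⊤ := fun i => Submodule.span_mono (lieSet_mono le_top) (hZ i)
  simp only [det_AdQuot hZg h0 hδ hsub]
  refine Continuous.matrix_det (continuous_pi fun i => continuous_pi fun j => ?_)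
  exact (α i).continuous_of_finiteDimensional.comp (hp.continuous_conj.comp
    (f := fun q : Q => ((q : G), Z j)) (by fun_prop))

theorem IsParabolic.continuous_densityRep (hp : IsRealReductive p) {Q : Subgroup G}
    (hQ : IsParabolic p Q) : IsContinuousRep (densityRep p Q) := by
  have h3 : Continuous fun q : Q => ((|LinearMap.det (AdQuot p Q q)|⁻¹ : ℝ) : ℂ) :=
    Complex.continuous_ofReal.comp
      ((hQ.continuous_det_AdQuot hp).abs.inv₀ fun q => (abs_det_AdQuot_pos q).ne')
  exact (h3.comp continuous_fst).mul continuous_snd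

variable (μ : Measure (maxCompact p)) [CompactSpace (maxCompact p)] [μ.IsHaarMeasure]

/-- Integration by parts along a one-parameter subgroup of `K`. -/
theorem integral_smul_lieDeriv (hp : IsRealReductive p) {f : G → ℂ}
    {D : G → lieAlg p ⊤ →ₗ[ℝ] ℂ} (hD : HasLieDeriv p f D) (hf : Continuous f)
    (α : Matrix (Fin n) (Fin n) ℝ →ₗ[ℝ] ℝ) (Y : Matrix (Fin n) (Fin n) ℝ) {Z : lieAlg p ⊤}
    {γ : Multiplicative ℝ →ₜ* G} (hγ : IsOneParam p (Z : Matrix (Fin n) (Fin n) ℝ) γ)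
    (hK : ∀ t : ℝ, γ (Multiplicative.ofAdd t) ∈ maxCompact p) :
    ∫ k : maxCompact p, α (conj (p (k : G)⁻¹) Y) • D k (Ad p k Z) ∂μ =
      ∫ k : maxCompact p, α (Z.1 * conj (p (k : G)⁻¹) Y - conj (p (k : G)⁻¹) Y * Z.1) • f k ∂μ := by
  have hγc := hγ.continuous
  have hα : Continuous α := α.continuous_of_finiteDimensional
  have hconj : Continuous fun k : maxCompact p => conj (p (k : G)⁻¹) Y :=
    hp.continuous_conj.comp (f := fun k : maxCompact p => ((k : G)⁻¹, Y)) (by fun_prop)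
  have hcomp : ∀ (t : ℝ) (k : maxCompact p), conj (p (k * γ (Multiplicative.ofAdd t))⁻¹) Y =
      conj (p (γ (Multiplicative.ofAdd (-t)))) (conj (p (k : G)⁻¹) Y) := fun t k => by
    rw [mul_inv_rev, ← oneParam_neg, map_mul]
    simp only [conj_apply, mul_inv_rev, Units.val_mul, mul_assoc]
  have h1 := hasDerivAt_integral_param μ
    (f := fun t (k : maxCompact p) => α (conj (p (k * γ (Multiplicative.ofAdd t))⁻¹) Y) •
      f (k * γ (Multiplicative.ofAdd t) * 1))
    (f' := fun t (k : maxCompact p) =>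
      α (conj (p (γ (Multiplicative.ofAdd (-t)))) (conj (p (k : G)⁻¹) Y)) •
        D (k * γ (Multiplicative.ofAdd t) * 1) (Ad p k Z) +
      (-α (conj (p (γ (Multiplicative.ofAdd (-t)))) (Z.1 * conj (p (k : G)⁻¹) Y -
        conj (p (k : G)⁻¹) Y * Z.1))) • f (k * γ (Multiplicative.ofAdd t) * 1)) ?_ ?_ ?_ 0
  · have hconst : ∀ t : ℝ, ∫ k : maxCompact p, α (conj (p (k * γ (Multiplicative.ofAdd t))⁻¹) Y) •
        f (k * γ (Multiplicative.ofAdd t) * 1) ∂μ =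
        ∫ k : maxCompact p, α (conj (p (k : G)⁻¹) Y) • f k ∂μ := fun t => by
      have := isMulRightInvariant_of_compactSpace μ
      rw [← integral_mul_right_eq_self (fun k : maxCompact p => α (conj (p (k : G)⁻¹) Y) • f k)
        ⟨γ (Multiplicative.ofAdd t), hK t⟩]
      simp only [mul_one, Subgroup.coe_mul]
    have h2 := (h1.congr_of_eventuallyEq (Eventually.of_forall fun t => (hconst t).symm)).unique
      (hasDerivAt_const (0 : ℝ) _)
    simp only [neg_zero, oneParam_zero, mul_one, map_one] at h2
    have hone : ∀ A : Matrix (Fin n) (Fin n) ℝ, conj 1 A = A := fun A => by simp [conj_apply]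
    simp only [hone, neg_smul, ← sub_eq_add_neg] at h2
    rw [integral_sub, sub_eq_zero] at h2
    · exact h2
    · have h3 : Continuous fun k : maxCompact p => Ad p (k : G) Z :=
        hp.continuous_Ad.comp (f := fun k : maxCompact p => ((k : G), Z)) (by fun_prop)
      exact integrable_of_continuous μ ((hα.comp hconj).smul
        (hD.continuous.comp (continuous_subtype_val.prodMk h3)))
    · have h3 : Continuous fun k : maxCompact p =>
          Z.1 * conj (p (k : G)⁻¹) Y - conj (p (k : G)⁻¹) Y * Z.1 :=
        (continuous_const.mul hconj).sub (hconj.mul continuous_const)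
      exact integrable_of_continuous μ ((hα.comp h3).smul (hf.comp continuous_subtype_val))
  · intro t
    refine Continuous.smul (hα.comp ?_) (by fun_prop)
    exact hp.continuous_conj.comp (f := fun k : maxCompact p =>
      ((k * γ (Multiplicative.ofAdd t))⁻¹, Y)) (by fun_prop)
  · have hγn : Continuous fun z : ℝ × maxCompact p => γ (Multiplicative.ofAdd (-z.1)) :=
      hγc.comp (by fun_prop : Continuous fun z : ℝ × maxCompact p => -z.1)
    have hγp : Continuous fun z : ℝ × maxCompact p =>
        (z.2 : G) * γ (Multiplicative.ofAdd z.1) * 1 :=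
      by fun_prop
    have hA : Continuous fun z : ℝ × maxCompact p => conj (p (z.2 : G)⁻¹) Y :=
      hconj.comp continuous_snd
    have h3 : Continuous fun z : ℝ × maxCompact p => Ad p (z.2 : G) Z :=
      hp.continuous_Ad.comp (f := fun z : ℝ × maxCompact p => ((z.2 : G), Z)) (by fun_prop)
    exact ((hα.comp (hp.continuous_conj.comp (hγn.prodMk hA))).smul
      (hD.continuous.comp (hγp.prodMk h3))).add ((hα.comp (hp.continuous_conj.comp (hγn.prodMk
        ((continuous_const.mul hA).sub (hA.mul continuous_const))))).neg.smul (hf.comp hγp))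
  · intro t k
    simp only [hcomp]
    have h2 := (hγ.hasDerivAt_conj (conj (p (k : G)⁻¹) Y) (-t)).scomp t (hasDerivAt_neg t)
    have h3 := (LinearMap.toContinuousLinearMap α).hasFDerivAt.comp_hasDerivAt t h2
    refine (h3.smul (hD.hasDerivAt_mul hγ (k : G) 1 t)).congr_deriv ?_
    congr 2
    change α ((-1 : ℝ) • _) = _
    rw [map_smul, neg_one_smul]

/-- The integral over `K` of a derivative of a section of the density bundle vanishes. -/
theorem IsParabolic.integral_lieDeriv [T2Space G] (hp : IsRealReductive p) {Q : Subgroup G}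
    (hQ : IsParabolic p Q) {f : G → ℂ} (hf : f ∈ equivSections (densityRep p Q))
    (hfc : Continuous f) {D : G → lieAlg p ⊤ →ₗ[ℝ] ℂ} (hD : HasLieDeriv p f D)
    (Y : lieAlg p ⊤) : ∫ k : maxCompact p, D k Y ∂μ = 0 := by
  obtain ⟨d, Z, α, hZ, h0, htr, hδ, hsub⟩ := hQ.exists_adapted_frame hp
  have hKcl : IsClosed (maxCompact p : Set G) := hp.isClosed_maxCompact
  have hZK : ∀ i, Z i ∈ lieSet p (maxCompact p) := fun i => (hp.mem_lieAlg hKcl).1 (hZ i)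
  have hZg : ∀ i, Z i ∈ lieAlg p ⊤ := fun i => Submodule.subset_span (lieSet_mono le_top (hZK i))
  have hZt : ∀ i, (Z i).transpose = -Z i := fun i => transpose_eq_neg_of_mem_lieSet (hZK i)
  -- `αᵢ([Zᵢ, Zⱼ]) = 0` as `αᵢ` is the inner product with `Zᵢ` on `𝔨`
  have hbr : ∀ i j, α i (Z i * Z j - Z j * Z i) = 0 := fun i j => by
    have h1 : Z i * Z j - Z j * Z i ∈ lieAlg p (maxCompact p) := by
      refine Submodule.subset_span (mem_lieSet_maxCompact ?_ ?_)
      · exact (hp.mem_lieAlg isClosed_univ).1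
          (mul_sub_mul_mem_lieAlg (lieSet_mono le_top (hZK j)) (hZg i))
      · simp only [Matrix.transpose_sub, Matrix.transpose_mul, hZt]
        noncomm_ring
    rw [htr i _ h1]
    simp only [Matrix.transpose_sub, Matrix.transpose_mul, hZt, neg_mul_neg]
    rw [mul_sub, Matrix.trace_sub, Matrix.trace_mul_comm (Z i) (Z i * Z j), sub_eq_zero,
      ← mul_assoc, Matrix.trace_mul_cycle, mul_assoc]
  have hone : ∀ i, ∃ γ : Multiplicative ℝ →ₜ* G, IsOneParam p (Z i) γ := fun i =>
    hp.exists_isOneParam (lieSet_mono le_top (hZK i))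
  choose γ hγ using hone
  -- the derivative of a section along `𝔮`
  have hder : ∀ (x : G) (W : lieAlg p ⊤), W.1 ∈ lieAlg p Q →
      D x (Ad p x W) = (∑ i, α i (W.1 * Z i - Z i * W.1)) • f x := fun x W hW => by
    obtain ⟨γ, hγ⟩ := hp.exists_isOneParam ((hp.mem_lieAlg isClosed_univ).1 W.2)
    have hγQ := hγ.mem_parabolic hQ ((hp.mem_lieAlg (hQ.isClosed hp)).1 hW)
    have h1 := hD.hasDerivAt_mul hγ x 1 0
    simp only [oneParam_zero, mul_one] at h1
    refine h1.unique ?_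
    have h2 : ∀ t : ℝ, f (x * γ (Multiplicative.ofAdd t)) =
        |(Matrix.of fun i j => α i (conj (p (γ (Multiplicative.ofAdd t))) (Z j))).det| • f x :=
      fun t => by
        rw [← det_AdQuot hZg h0 hδ hsub ⟨_, hγQ t⟩]
        exact section_densityRep hf x ⟨_, hγQ t⟩
    have hconj1 : ∀ A : Matrix (Fin n) (Fin n) ℝ,
        conj (p (γ (Multiplicative.ofAdd 0))) A = A := fun A => by
      simp [conj_apply]
    have hone : (Matrix.of fun i j => α i (conj (p (γ (Multiplicative.ofAdd 0))) (Z j))) = 1 := by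
      ext i j
      rw [Matrix.of_apply, hconj1, hδ, Matrix.one_apply]
    have h3 : HasDerivAt (fun t : ℝ => Matrix.of fun i j =>
        α i (conj (p (γ (Multiplicative.ofAdd t))) (Z j)))
        (Matrix.of fun i j => α i (W.1 * Z j - Z j * W.1)) 0 := by
      refine hasDerivAt_pi.2 fun i => hasDerivAt_pi.2 fun j => ?_
      have h4 := (LinearMap.toContinuousLinearMap (α i)).hasFDerivAt.comp_hasDerivAt 0
        (hγ.hasDerivAt_conj (Z j) 0)
      rw [hconj1] at h4
      exact h4
    have h4 := hasDerivAt_det h3 hone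
    have h5 := (hasDerivAt_abs_pos (x := (Matrix.of fun i j =>
        α i (conj (p (γ (Multiplicative.ofAdd 0))) (Z j))).det)
        (by rw [hone, Matrix.det_one]; exact one_pos)).comp 0 h4
    rw [one_mul] at h5
    exact ((h5.smul_const (f x)).congr_of_eventuallyEq (Eventually.of_forall h2)).congr_deriv rfl
  -- expand `Ad(k⁻¹) Y` in the frame
  have hk : ∀ k : maxCompact p, D k Y =
      (∑ i, α i (conj (p (k : G)⁻¹) Y) • D k (Ad p k ⟨Z i, hZg i⟩)) -
        ∑ i, α i (Z i * conj (p (k : G)⁻¹) Y - conj (p (k : G)⁻¹) Y * Z i) • f k := fun k => by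
    set A : lieAlg p ⊤ := Ad p (k : G)⁻¹ Y with hA
    have hAc : conj (p (k : G)⁻¹) Y = A.1 := rfl
    let W : lieAlg p ⊤ := A - ∑ i, α i A.1 • ⟨Z i, hZg i⟩
    have hW1 : W.1 = A.1 - ∑ i, α i A.1 • Z i := by simp [W]
    have h1 : D k Y = (∑ i, α i A.1 • D k (Ad p k ⟨Z i, hZg i⟩)) + D k (Ad p k W) := by
      have h2 : Y = Ad p k A := by rw [hA, ← Ad_mul, mul_inv_cancel, Ad_one]
      conv_lhs => rw [h2]
      simp only [W, map_sub, map_sum, map_smul]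
      abel
    rw [hAc, h1, hder _ W (hW1 ▸ hsub _ A.2), sub_eq_add_neg, ← Finset.sum_smul, ← neg_smul,
      ← Finset.sum_neg_distrib]
    congr 2
    refine Finset.sum_congr rfl fun i _ => ?_
    rw [hW1, sub_mul, mul_sub, Finset.sum_mul, Finset.mul_sum]
    have h3 : (A.1 * Z i - ∑ j, α j A.1 • Z j * Z i) - (Z i * A.1 - ∑ j, Z i * α j A.1 • Z j) =
        -(Z i * A.1 - A.1 * Z i) + ∑ j, α j A.1 • (Z i * Z j - Z j * Z i) := by
      simp only [smul_sub, Finset.sum_sub_distrib, smul_mul_assoc, mul_smul_comm]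
      abel
    rw [h3, map_add, map_neg, map_sum, add_eq_left]
    exact Finset.sum_eq_zero fun j _ => by rw [map_smul, hbr, smul_zero]
  have hcA : ∀ i, Continuous fun k : maxCompact p => α i (conj (p (k : G)⁻¹) Y) := fun i =>
    (α i).continuous_of_finiteDimensional.comp (hp.continuous_conj.comp
      (f := fun k : maxCompact p => ((k : G)⁻¹, (Y : Matrix (Fin n) (Fin n) ℝ))) (by fun_prop))
  have hcB : ∀ i, Continuous fun k : maxCompact p =>
      α i (Z i * conj (p (k : G)⁻¹) Y - conj (p (k : G)⁻¹) Y * Z i) := fun i => by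
    have h1 : Continuous fun k : maxCompact p =>
        conj (p (k : G)⁻¹) (Y : Matrix (Fin n) (Fin n) ℝ) :=
      hp.continuous_conj.comp
        (f := fun k : maxCompact p => ((k : G)⁻¹, (Y : Matrix (Fin n) (Fin n) ℝ))) (by fun_prop)
    exact (α i).continuous_of_finiteDimensional.comp
      ((continuous_const.mul h1).sub (h1.mul continuous_const))
  have hcD : ∀ i, Continuous fun k : maxCompact p => D k (Ad p k ⟨Z i, hZg i⟩) := fun i => by
    have h3 : Continuous fun k : maxCompact p => Ad p (k : G) ⟨Z i, hZg i⟩ :=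
      hp.continuous_Ad.comp
        (f := fun k : maxCompact p => ((k : G), (⟨Z i, hZg i⟩ : lieAlg p ⊤))) (by fun_prop)
    exact hD.continuous.comp (continuous_subtype_val.prodMk h3)
  have hI1 : ∀ i, Integrable (fun k : maxCompact p =>
      α i (conj (p (k : G)⁻¹) Y) • D k (Ad p k ⟨Z i, hZg i⟩)) μ := fun i =>
    integrable_of_continuous μ ((hcA i).smul (hcD i))
  have hI2 : ∀ i, Integrable (fun k : maxCompact p =>
      α i (Z i * conj (p (k : G)⁻¹) Y - conj (p (k : G)⁻¹) Y * Z i) • f k) μ := fun i =>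
    integrable_of_continuous μ ((hcB i).smul (hfc.comp continuous_subtype_val))
  simp only [hk]
  rw [integral_sub (integrable_finsetSum _ fun i _ => hI1 i)
    (integrable_finsetSum _ fun i _ => hI2 i), integral_finsetSum _ fun i _ => hI1 i,
    integral_finsetSum _ fun i _ => hI2 i, sub_eq_zero]
  exact Finset.sum_congr rfl fun i _ => integral_smul_lieDeriv μ hp hD hfc (α i) Y
    (Z := ⟨Z i, hZg i⟩) (hγ i) fun t => (hγ i).mem_maxCompact (hZK i) t

/-- The integral over `K` of continuous sections of the density bundle is invariant under `G`. -/
theorem IsParabolic.integral_density [T2Space G] (hp : IsRealReductive p) {Q : Subgroup G}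
    (hQ : IsParabolic p Q) {f : G → ℂ}
    (hf : f ∈ equivSections (densityRep p Q)) (hfc : Continuous f) (g : G) :
    ∫ k : maxCompact p, f (g * k) ∂μ = ∫ k : maxCompact p, f k ∂μ := by
  have hσ : IsContinuousRep (Representation.trivial ℂ G ℂ) := continuous_snd
  have h := hQ.pairing_leftReg μ hp (hQ.continuous_densityRep hp) hσ
    (Θ := ContinuousMap.const _ (ContinuousLinearMap.id ℂ ℂ)) ?_ ?_ hf hfc g⁻¹
  · simpa [pairing, leftReg_apply] using h
  · intro f hf hfc k
    have := integral_mul_left_eq_self (μ := μ) (fun x : maxCompact p => f x) k⁻¹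
    simpa [pairing, leftReg_apply] using this
  · intro f hf hfs D hD Y γ hγ
    have := hQ.integral_lieDeriv μ hp hf (hfs.continuous hp) hD Y
    simp only [pairing, ContinuousMap.const_apply, ContinuousLinearMap.coe_id', id_eq, this,
      neg_zero]
    exact hasDerivAt_const _ _

end Density

/-! ### Approximation of square integrable sections by continuous sections -/

section Smear

theorem integrable_continuous_smul {X W : Type*} [TopologicalSpace X] [CompactSpace X]
    [MeasurableSpace X] [BorelSpace X] (μ : Measure X) [IsFiniteMeasure μ]
    [NormedAddCommGroup W] [NormedSpace ℝ W] (b : C(X, ℝ)) {f : X → W} (hf : Integrable f μ) :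
    Integrable (fun k => b k • f k) μ := by
  refine (hf.norm.const_mul ‖b‖).mono'
    ((integrable_of_continuous μ b.continuous).1.smul hf.1) (Eventually.of_forall fun k => ?_)
  rw [norm_smul]
  exact mul_le_mul_of_nonneg_right (b.norm_coe_le_norm k) (norm_nonneg _)

theorem norm_integral_continuous_smul_le {X W : Type*} [TopologicalSpace X] [CompactSpace X]
    [MeasurableSpace X] (μ : Measure X) [NormedAddCommGroup W] [NormedSpace ℝ W] (b : C(X, ℝ))
    {f : X → W} (hf : Integrable f μ) : ‖∫ k, b k • f k ∂μ‖ ≤ ‖b‖ * ∫ k, ‖f k‖ ∂μ := by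
  rw [← integral_const_mul]
  refine norm_integral_le_of_norm_le (hf.norm.const_mul ‖b‖) (Eventually.of_forall fun k => ?_)
  rw [norm_smul]
  exact mul_le_mul_of_nonneg_right (b.norm_coe_le_norm k) (norm_nonneg _)

variable {K : Type*} [Group K] [TopologicalSpace K] [IsTopologicalGroup K]

/-- The kernel of the convolution with `b`, as a continuous family of continuous functions. -/
def smearKernel (b : C(K, ℝ)) : C(K, C(K, ℝ)) :=
  ContinuousMap.curry ⟨fun z : K × K => b (z.1 * z.2⁻¹), by fun_prop⟩

theorem norm_smearKernel_le [CompactSpace K] (b : C(K, ℝ)) (x : K) : ‖smearKernel b x‖ ≤ ‖b‖ :=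
  (ContinuousMap.norm_le _ (norm_nonneg _)).2 fun k => b.norm_coe_le_norm (x * k⁻¹)

variable [MeasurableSpace K] (μ : Measure K) {W : Type*} [NormedAddCommGroup W] [NormedSpace ℝ W]

/-- The convolution of an integrable function `f` with a continuous function `b`. -/
def smear (b : C(K, ℝ)) (f : K → W) : K → W := fun x => ∫ k, b (x * k⁻¹) • f k ∂μ

theorem smear_eq (b : C(K, ℝ)) (f : K → W) (x : K) :
    smear μ b f x = ∫ k, smearKernel b x k • f k ∂μ := rfl

variable [CompactSpace K] [BorelSpace K] [μ.IsHaarMeasure]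

theorem continuous_smear (b : C(K, ℝ)) {f : K → W} (hf : Integrable f μ) :
    Continuous (smear μ b f) := by
  refine continuous_iff_continuousAt.2 fun x => tendsto_iff_norm_sub_tendsto_zero.2 ?_
  have h1 : Tendsto (fun y => ‖smearKernel b y - smearKernel b x‖ * ∫ k, ‖f k‖ ∂μ) (𝓝 x) (𝓝 0) := by
    have h2 : Continuous fun y => ‖smearKernel b y - smearKernel b x‖ * ∫ k, ‖f k‖ ∂μ := by fun_prop
    simpa using h2.tendsto x
  refine squeeze_zero (fun _ => norm_nonneg _) (fun y => ?_) h1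
  refine le_trans (le_of_eq ?_) (norm_integral_continuous_smul_le μ _ hf)
  rw [smear_eq, smear_eq, ← integral_sub (integrable_continuous_smul μ _ hf)
    (integrable_continuous_smul μ _ hf)]
  simp only [ContinuousMap.sub_apply, sub_smul]

theorem smear_sub (b : C(K, ℝ)) {f f' : K → W} (hf : Integrable f μ) (hf' : Integrable f' μ)
    (x : K) : smear μ b (fun k => f k - f' k) x = smear μ b f x - smear μ b f' x := by
  simp only [smear_eq, smul_sub]
  exact integral_sub (integrable_continuous_smul μ _ hf) (integrable_continuous_smul μ _ hf')

/-- For continuous `f`; the general case follows by approximation. -/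
theorem integral_norm_smear_le_of_continuous {b : C(K, ℝ)} (hb : ∀ k, 0 ≤ b k)
    (hb1 : ∫ k, b k ∂μ = 1) {f : K → W} (hf : Continuous f) :
    ∫ x, ‖smear μ b f x‖ ∂μ ≤ ∫ k, ‖f k‖ ∂μ := by
  have := isMulRightInvariant_of_compactSpace μ
  have hfi := integrable_of_continuous μ hf
  calc ∫ x, ‖smear μ b f x‖ ∂μ ≤ ∫ x, ∫ k, b (x * k⁻¹) * ‖f k‖ ∂μ ∂μ := by
        refine integral_mono (integrable_of_continuous μ (continuous_smear μ b hfi).norm)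
          (integrable_of_continuous μ (continuous_integral_param μ
            (f := fun x k => b (x * k⁻¹) * ‖f k‖) (by fun_prop))) fun x => ?_
        refine norm_integral_le_of_norm_le (integrable_of_continuous μ (by fun_prop))
          (Eventually.of_forall fun k => ?_)
        rw [norm_smul, Real.norm_of_nonneg (hb _)]
    _ = ∫ k, ∫ x, b (x * k⁻¹) * ‖f k‖ ∂μ ∂μ :=
        integral_integral_swap_of_hasCompactSupport (by fun_prop)
          (HasCompactSupport.of_compactSpace _)
    _ = ∫ k, ‖f k‖ ∂μ := by
        refine integral_congr_ae (Eventually.of_forall fun k => ?_)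
        change ∫ x, b (x * k⁻¹) * ‖f k‖ ∂μ = _
        rw [integral_mul_const, integral_mul_right_eq_self (fun x => b x), hb1, one_mul]

theorem integral_norm_smear_le {b : C(K, ℝ)} (hb : ∀ k, 0 ≤ b k)
    (hb1 : ∫ k, b k ∂μ = 1) {f : K → W} (hf : Integrable f μ) :
    ∫ x, ‖smear μ b f x‖ ∂μ ≤ ∫ k, ‖f k‖ ∂μ := by
  refine le_of_forall_pos_le_add fun ε hε => ?_
  set c : ℝ := 1 + ‖b‖ * μ.real Set.univ with hc
  have hc0 : 0 < c := by positivity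
  obtain ⟨h, hh, hhi⟩ := hf.exists_boundedContinuous_integral_sub_le (div_pos hε hc0)
  have hsub : Integrable (fun k => f k - h k) μ := hf.sub hhi
  have h1 : ∀ x, ‖smear μ b f x‖ ≤ ‖smear μ b h x‖ + ‖b‖ * (ε / c) := fun x => by
    have h2 : ‖smear μ b (fun k => f k - h k) x‖ ≤ ‖b‖ * (ε / c) :=
      (norm_integral_continuous_smul_le μ (smearKernel b x) hsub).trans
        (mul_le_mul (norm_smearKernel_le b x) hh (by positivity) (norm_nonneg _))
    rw [smear_sub μ b hf hhi] at h2
    linarith [norm_sub_norm_le (smear μ b f x) (smear μ b h x)]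
  have h3 : ∫ k, ‖h k‖ ∂μ ≤ ∫ k, ‖f k‖ ∂μ + ε / c := by
    rw [← sub_le_iff_le_add', ← integral_sub hhi.norm hf.norm]
    refine (integral_mono (hhi.norm.sub hf.norm) hsub.norm fun k => ?_).trans hh
    change ‖h k‖ - ‖f k‖ ≤ ‖f k - h k‖
    rw [norm_sub_rev]
    exact norm_sub_norm_le _ _
  have hi : Integrable (fun x => ‖smear μ b h x‖) μ :=
    integrable_of_continuous μ (continuous_smear μ b hhi).norm
  calc ∫ x, ‖smear μ b f x‖ ∂μ ≤ ∫ x, (‖smear μ b h x‖ + ‖b‖ * (ε / c)) ∂μ :=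
        integral_mono (integrable_of_continuous μ (continuous_smear μ b hf).norm)
          (hi.add (integrable_const _)) h1
    _ = ∫ x, ‖smear μ b h x‖ ∂μ + ‖b‖ * (ε / c) * μ.real Set.univ := by
        rw [integral_add hi (integrable_const _), integral_const, smul_eq_mul, mul_comm (μ.real _)]
    _ ≤ (∫ k, ‖f k‖ ∂μ + ε / c) + ‖b‖ * (ε / c) * μ.real Set.univ := by
        gcongr
        exact (integral_norm_smear_le_of_continuous μ hb hb1 h.continuous).trans h3
    _ = ∫ k, ‖f k‖ ∂μ + ε := by rw [hc]; field_simp; ring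

/-- Convolutions with suitable probability densities approximate `f` in `L¹`. -/
theorem exists_smear_sub_lt [T2Space K] [CompleteSpace W] {f : K → W} (hf : Integrable f μ) {δ : ℝ}
    (hδ : 0 < δ) : ∃ b : C(K, ℝ), ∫ x, ‖smear μ b f x - f x‖ ∂μ < δ := by
  obtain ⟨h, hh, hhi⟩ := hf.exists_boundedContinuous_integral_sub_le (by positivity : 0 < δ / 4)
  have hsub : Integrable (fun k => f k - h k) μ := hf.sub hhi
  set η : ℝ := δ / 4 / (μ.real Set.univ + 1) with hη
  have hη0 : 0 < η := by positivity
  -- Translates of a continuous function `h` depend continuously on the group element, uniformly on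
  -- `K`; so `h` is uniformly close to its convolution with a density supported near `1`.
  let φ : C(K, C(K, W)) := ContinuousMap.curry ⟨fun z : K × K => h (z.1⁻¹ * z.2), by fun_prop⟩
  obtain ⟨b, hb, hb1, hbφ⟩ := exists_bump μ φ.continuous hη0
  have h1 := norm_integral_bump_sub_le μ φ.continuous hb hb1 hbφ
  have := isInvInvariant_of_compactSpace μ
  have h2 : ∀ x, (∫ k, b k • φ k ∂μ) x = smear μ b h x := fun x => by
    rw [ContinuousMap.integral_apply (integrable_of_continuous μ (by fun_prop)), smear,
      ← integral_inv_eq_self (fun k => b (x * k⁻¹) • h k)]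
    refine (integral_mul_left_eq_self (fun k => b k • h (k⁻¹ * x)) x).symm.trans
      (integral_congr_ae (Eventually.of_forall fun k => ?_))
    simp
  have h3 : ∀ x, ‖smear μ b h x - h x‖ ≤ η := fun x => by
    refine le_trans (le_of_eq ?_) ((ContinuousMap.norm_coe_le_norm _ x).trans h1)
    rw [ContinuousMap.sub_apply, h2]
    simp [φ]
  refine ⟨b, ?_⟩
  have h4 := integral_norm_smear_le μ hb hb1 hsub
  have hi : Integrable (fun x => ‖smear μ b (fun k => f k - h k) x‖) μ :=
    integrable_of_continuous μ (continuous_smear μ b hsub).norm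
  have hi' : Integrable (fun x => ‖smear μ b (fun k => f k - h k) x‖ + η) μ :=
    hi.add (integrable_const _)
  calc ∫ x, ‖smear μ b f x - f x‖ ∂μ ≤
      ∫ x, (‖smear μ b (fun k => f k - h k) x‖ + η + ‖f x - h x‖) ∂μ := by
        refine integral_mono ((integrable_of_continuous μ (continuous_smear μ b hf)).sub hf).norm
          (hi'.add hsub.norm) fun x => ?_
        rw [smear_sub μ b hf hhi]
        have h5 : smear μ b f x - f x = (smear μ b f x - smear μ b h x) +
            (smear μ b h x - h x) - (f x - h x) := by abel
        change ‖smear μ b f x - f x‖ ≤ _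
        rw [h5]
        refine (norm_sub_le _ _).trans (add_le_add_left ((norm_add_le _ _).trans ?_) _)
        exact add_le_add_right (h3 x) _
    _ = ∫ x, ‖smear μ b (fun k => f k - h k) x‖ ∂μ + μ.real Set.univ * η +
        ∫ x, ‖f x - h x‖ ∂μ := by
        rw [integral_add hi' hsub.norm, integral_add hi (integrable_const _), integral_const,
            smul_eq_mul]
    _ ≤ δ / 4 + δ / 4 + δ / 4 := by
        gcongr
        · exact h4.trans hh
        · rw [hη, mul_div_assoc', div_le_iff₀ (by positivity)]
          nlinarith [measureReal_nonneg (μ := μ) (s := Set.univ)]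
    _ < δ := by linarith

end Smear

section SqInt

variable {n : ℕ} {G : Type*} [Group G] [TopologicalSpace G] [IsTopologicalGroup G] [T2Space G]
variable {p : G →* GL (Fin n) ℝ} (μ : Measure (maxCompact p))
variable [CompactSpace (maxCompact p)] [μ.IsHaarMeasure]
variable {W : Type*} [NormedAddCommGroup W] [NormedSpace ℂ W] [FiniteDimensional ℂ W]

/-- Continuous sections are dense in `L¹`: convolution over `K` preserves the equivariance under
`K ∩ Q`. -/
theorem IsParabolic.exists_continuous_section_near (hp : IsRealReductive p) {Q : Subgroup G}
    (hQ : IsParabolic p Q) {ζ : Representation ℂ Q W} (hζ : IsContinuousRep ζ) {f : G → W}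
    (hf : f ∈ equivSections ζ) (hfi : Integrable (fun k : maxCompact p => f k) μ) {δ : ℝ}
    (hδ : 0 < δ) : ∃ f' ∈ equivSections ζ, Continuous f' ∧
      ∫ k : maxCompact p, ‖f' k - f k‖ ∂μ < δ := by
  have hW : CompleteSpace W := FiniteDimensional.complete ℂ W
  have := isMulRightInvariant_of_compactSpace μ
  obtain ⟨b, hb⟩ := exists_smear_sub_lt μ hfi hδ
  obtain ⟨f', hf', hf'K⟩ := hQ.exists_section hp (ζ := ζ)
    (φ := smear μ b fun k : maxCompact p => f k) fun k m hm => by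
      rw [smear, ← integral_mul_right_eq_self _ m]
      change _ = repCLM ζ (⟨m, hm⟩⁻¹) (∫ x : maxCompact p, smearKernel b k x • f x ∂μ)
      rw [← ContinuousLinearMap.integral_comp_comm _ (integrable_continuous_smul μ _ hfi)]
      refine integral_congr_ae (Eventually.of_forall fun x => ?_)
      change b (k * m * (x * m)⁻¹) • f (x * m) = ζ (⟨m, hm⟩⁻¹) (b (k * x⁻¹) • f x)
      rw [hf x ⟨m, hm⟩, mul_inv_rev, mul_assoc, mul_inv_cancel_left, LinearMap.map_smul_of_tower]
  refine ⟨f', hf', hQ.continuous_section hp hζ hf' ?_, ?_⟩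
  · simp only [hf'K]
    exact continuous_smear μ b hfi
  · simpa only [hf'K] using hb

end SqInt

/-! ### Translation by `G` is bounded for the `L¹` norm of sections -/

section Translation

open scoped Pointwise

variable {n : ℕ} {G : Type*} [Group G] [TopologicalSpace G] {p : G →* GL (Fin n) ℝ}

theorem integrable_of_mem_sqIntSections [CompactSpace (maxCompact p)]
    (μ : Measure (maxCompact p)) [IsFiniteMeasureOnCompacts μ] {W : Type*} [NormedAddCommGroup W]
    [NormedSpace ℂ W] {Q : Subgroup G} {ζ : Representation ℂ Q W} {f : G → W}
    (hf : f ∈ sqIntSections p μ ζ) (g : G) : Integrable (fun k : maxCompact p => f (g * k)) μ :=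
  (hf.2 g).integrable one_le_two

theorem norm_pairing_le [CompactSpace (maxCompact p)] (μ : Measure (maxCompact p))
    {W V : Type*} [NormedAddCommGroup W] [NormedSpace ℂ W] [NormedAddCommGroup V] [NormedSpace ℂ V]
    (Θ : C(maxCompact p, W →L[ℂ] V)) {f : G → W}
    (hf : Integrable (fun k : maxCompact p => f k) μ) :
    ‖pairing μ Θ f‖ ≤ ‖Θ‖ * ∫ k : maxCompact p, ‖f k‖ ∂μ := by
  rw [← integral_const_mul]
  refine norm_integral_le_of_norm_le (hf.norm.const_mul ‖Θ‖) (Eventually.of_forall fun k => ?_)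
  exact ((Θ k).le_opNorm _).trans
    (mul_le_mul_of_nonneg_right (Θ.norm_coe_le_norm k) (norm_nonneg _))

theorem integrable_pairing [CompactSpace (maxCompact p)] (μ : Measure (maxCompact p))
    [IsFiniteMeasureOnCompacts μ]
    {W V : Type*} [NormedAddCommGroup W] [NormedSpace ℂ W] [NormedAddCommGroup V] [NormedSpace ℂ V]
    (Θ : C(maxCompact p, W →L[ℂ] V)) {f : G → W}
    (hf : Integrable (fun k : maxCompact p => f k) μ) :
    Integrable (fun k : maxCompact p => Θ k (f k)) μ := by
  refine (hf.norm.const_mul ‖Θ‖).mono'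
    ((ContinuousLinearMap.apply ℂ V).aestronglyMeasurable_comp₂ hf.1
      (integrable_of_continuous μ Θ.continuous).1) (Eventually.of_forall fun k => ?_)
  exact ((Θ k).le_opNorm _).trans
    (mul_le_mul_of_nonneg_right (Θ.norm_coe_le_norm k) (norm_nonneg _))

theorem pairing_sub [CompactSpace (maxCompact p)] (μ : Measure (maxCompact p))
    [IsFiniteMeasureOnCompacts μ]
    {W V : Type*} [NormedAddCommGroup W] [NormedSpace ℂ W] [NormedAddCommGroup V] [NormedSpace ℂ V]
    (Θ : C(maxCompact p, W →L[ℂ] V)) {f f' : G → W}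
    (hf : Integrable (fun k : maxCompact p => f k) μ)
    (hf' : Integrable (fun k : maxCompact p => f' k) μ) :
    pairing μ Θ (f - f') = pairing μ Θ f - pairing μ Θ f' := by
  rw [pairing, pairing, pairing, ← integral_sub (integrable_pairing μ Θ hf)
    (integrable_pairing μ Θ hf')]
  simp only [Pi.sub_apply, map_sub]

variable [IsTopologicalGroup G]

theorem mem_sqIntSections_of_continuous [CompactSpace (maxCompact p)]
    (μ : Measure (maxCompact p)) [IsFiniteMeasureOnCompacts μ] {W : Type*} [NormedAddCommGroup W]
    [NormedSpace ℂ W] {Q : Subgroup G} {ζ : Representation ℂ Q W} {f : G → W}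
    (hf : f ∈ equivSections ζ) (hfc : Continuous f) : f ∈ sqIntSections p μ ζ := by
  refine ⟨hf, fun g => ?_⟩
  have hc : Continuous fun k : maxCompact p => f (g * k) := by fun_prop
  obtain ⟨C, hC⟩ := (isCompact_range hc).isBounded.exists_norm_le
  exact MemLp.of_bound (integrable_of_continuous μ hc).1 C
    (Eventually.of_forall fun k => hC _ ⟨k, rfl⟩)

/-- The density character is trivial on the compact group `K ∩ Q`. -/
theorem IsParabolic.abs_det_AdQuot_eq_one (hp : IsRealReductive p) {Q : Subgroup G}
    (hQ : IsParabolic p Q) {m : Q} (hm : (m : G) ∈ maxCompact p) :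
    |LinearMap.det (AdQuot p Q m)| = 1 := by
  have hM : IsCompact {q : Q | (q : G) ∈ maxCompact p} :=
    (hQ.isClosed hp).isClosedEmbedding_subtypeVal.isCompact_preimage hp.isCompact_maxCompact
  obtain ⟨C, hC⟩ := hM.bddAbove_image (f := fun q : Q => |LinearMap.det (AdQuot p Q q)|)
    (hQ.continuous_det_AdQuot hp).abs.continuousOn
  have hle : ∀ m : Q, (m : G) ∈ maxCompact p → |LinearMap.det (AdQuot p Q m)| ≤ 1 := by
    intro m hm
    by_contra! hlt
    obtain ⟨N, hN⟩ := pow_unbounded_of_one_lt C hlt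
    have h1 : ∀ N : ℕ, |LinearMap.det (AdQuot p Q (m ^ N))| =
        |LinearMap.det (AdQuot p Q m)| ^ N := by
      intro N
      induction N with
      | zero => rw [pow_zero, pow_zero, abs_det_AdQuot_one]
      | succ N ih => rw [pow_succ, pow_succ, abs_det_AdQuot_mul, ih]
    have h2 := hC ⟨m ^ N, pow_mem hm N, h1 N⟩
    exact absurd hN (not_lt.2 h2)
  refine le_antisymm (hle m hm) ?_
  rw [← abs_det_AdQuot_inv]
  exact (one_le_inv₀ (abs_det_AdQuot_pos _)).2 (hle m⁻¹ (inv_mem hm))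

variable {W : Type*} [NormedAddCommGroup W] [NormedSpace ℂ W] [FiniteDimensional ℂ W]

/-- Bounds for the cocycle relating `f(gk)` to `f` on `K`, uniformly for `g` in a compact set. -/
theorem IsParabolic.exists_cocycle_bound (hp : IsRealReductive p) {Q : Subgroup G}
    (hQ : IsParabolic p Q) {ζ : Representation ℂ Q W} (hζ : IsContinuousRep ζ) {L : Set G}
    (hL : IsCompact L) : ∃ C : ℝ, 1 ≤ C ∧ ∀ g ∈ L, ∀ k ∈ maxCompact p, ∀ k' ∈ maxCompact p,
      ∀ q : Q, g * k = k' * q →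
        (∀ w, ‖ζ q⁻¹ w‖ ≤ C * ‖w‖) ∧ 1 ≤ C * |LinearMap.det (AdQuot p Q q)| := by
  have hS : IsCompact {q : Q | (q : G) ∈ (maxCompact p : Set G) * L * (maxCompact p : Set G)} :=
    (hQ.isClosed hp).isClosedEmbedding_subtypeVal.isCompact_preimage
      ((hp.isCompact_maxCompact.mul hL).mul hp.isCompact_maxCompact)
  have hc1 : Continuous fun q : Q => ‖repCLM ζ q⁻¹‖ :=
    (hζ.continuous_repCLM.comp continuous_inv).norm
  have hc2 : Continuous fun q : Q => |LinearMap.det (AdQuot p Q q)|⁻¹ :=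
    (hQ.continuous_det_AdQuot hp).abs.inv₀ fun q => (abs_det_AdQuot_pos q).ne'
  obtain ⟨C1, hC1⟩ := hS.bddAbove_image hc1.continuousOn
  obtain ⟨C2, hC2⟩ := hS.bddAbove_image hc2.continuousOn
  refine ⟨max 1 (max C1 C2), le_max_left _ _, fun g hg k hk k' hk' q hq => ?_⟩
  have hqS : q ∈ {q : Q | (q : G) ∈ (maxCompact p : Set G) * L * (maxCompact p : Set G)} := by
    have h1 : (q : G) = k'⁻¹ * g * k := by rw [mul_assoc, hq, inv_mul_cancel_left]
    change (q : G) ∈ (maxCompact p : Set G) * L * (maxCompact p : Set G)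
    rw [h1]
    exact Set.mul_mem_mul (Set.mul_mem_mul ((maxCompact p).inv_mem hk') hg) hk
  refine ⟨fun w => ?_, ?_⟩
  · refine ((repCLM ζ q⁻¹).le_opNorm w).trans (mul_le_mul_of_nonneg_right ?_ (norm_nonneg _))
    exact (hC1 ⟨q, hqS, rfl⟩).trans ((le_max_left _ _).trans (le_max_right _ _))
  · rw [← inv_le_iff_one_le_mul₀ (abs_det_AdQuot_pos q)]
    exact (hC2 ⟨q, hqS, rfl⟩).trans ((le_max_right _ _).trans (le_max_right _ _))

variable [T2Space G] (μ : Measure (maxCompact p)) [CompactSpace (maxCompact p)] [μ.IsHaarMeasure]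

/-- Translation of continuous sections is bounded in `L¹`: the norm of a section is comparable to a
section of the density bundle, whose integral is invariant. -/
theorem IsParabolic.exists_integral_norm_le_of_continuous (hp : IsRealReductive p)
    {Q : Subgroup G} (hQ : IsParabolic p Q) {ζ : Representation ℂ Q W} (hζ : IsContinuousRep ζ)
    {L : Set G} (hL : IsCompact L) : ∃ C : ℝ, 0 ≤ C ∧ ∀ g ∈ L, ∀ f ∈ equivSections ζ,
      Continuous f → ∫ k : maxCompact p, ‖f (g * k)‖ ∂μ ≤ C * ∫ k : maxCompact p, ‖f k‖ ∂μ := by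
  obtain ⟨C, hC1, hC⟩ := hQ.exists_cocycle_bound hp hζ (hL.insert 1)
  have hC0 : 0 ≤ C := zero_le_one.trans hC1
  refine ⟨C * C * C, by positivity, fun g hg f hf hfc => ?_⟩
  let M : Set (maxCompact p) := {m | (m : G) ∈ Q}
  have hM : IsCompact M := ((hQ.isClosed hp).preimage continuous_subtype_val).isCompact
  let ψ : maxCompact p → ℝ := fun k => sSup ((fun m : maxCompact p => ‖f (k * m)‖) '' M)
  have hψc : Continuous ψ := hM.continuous_sSup
    (f := fun (k : maxCompact p) (m : maxCompact p) => ‖f (k * m)‖) (by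
      change Continuous fun z : maxCompact p × maxCompact p => ‖f (z.1 * z.2)‖
      fun_prop)
  have hbdd : ∀ k : maxCompact p, BddAbove ((fun m : maxCompact p => ‖f (k * m)‖) '' M) := fun k =>
    hM.bddAbove_image (by fun_prop)
  have hfψ : ∀ k : maxCompact p, ‖f k‖ ≤ ψ k := fun k =>
    le_csSup (hbdd k) ⟨1, Q.one_mem, by simp⟩
  have hψ0 : ∀ k, 0 ≤ ψ k := fun k => (norm_nonneg _).trans (hfψ k)
  have hψf : ∀ k : maxCompact p, ψ k ≤ C * ‖f k‖ := fun k => by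
    refine csSup_le ⟨_, 1, Q.one_mem, rfl⟩ ?_
    rintro _ ⟨m, hm, rfl⟩
    change ‖f (k * (⟨m, hm⟩ : Q))‖ ≤ _
    rw [hf]
    exact (hC 1 (Set.mem_insert _ _) m m.2 1 (one_mem _) ⟨m, hm⟩ rfl).1 _
  have hψm : ∀ (k m : maxCompact p), (m : G) ∈ Q → ψ (k * m) = ψ k := fun k m hm => by
    change sSup _ = sSup _
    congr 1
    ext y
    constructor
    · rintro ⟨m', hm', rfl⟩
      exact ⟨m * m', Q.mul_mem hm hm', by simp [mul_assoc]⟩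
    · rintro ⟨m', hm', rfl⟩
      exact ⟨m⁻¹ * m', Q.mul_mem (Q.inv_mem hm) hm', by simp [mul_assoc]⟩
  obtain ⟨F, hF, hFK⟩ := hQ.exists_section hp (ζ := densityRep p Q) (φ := fun k => (ψ k : ℂ))
    fun k m hm => by
      rw [hψm k m hm, densityRep_inv_apply, hQ.abs_det_AdQuot_eq_one hp (m := ⟨m, hm⟩) m.2,
          one_smul]
  have hFc : Continuous F := hQ.continuous_section hp (hQ.continuous_densityRep hp) hF (by
    simp only [hFK]; fun_prop)
  have hFr : ∀ x, F x = (‖F x‖ : ℂ) := fun x => by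
    obtain ⟨k, hk, q, hq, rfl⟩ := hQ.exists_eq_mul hp x
    rw [section_densityRep hF k ⟨q, hq⟩, hFK ⟨k, hk⟩, Complex.real_smul, ← Complex.ofReal_mul,
      Complex.norm_real, Real.norm_of_nonneg (mul_nonneg (abs_nonneg _) (hψ0 _))]
  have hint : ∫ k : maxCompact p, ‖F (g * k)‖ ∂μ = ∫ k : maxCompact p, ψ k ∂μ := by
    have h1 := hQ.integral_density μ hp hF hFc g
    simp only [hFK] at h1
    have h2 : ∀ k : maxCompact p, F (g * k) = (‖F (g * k)‖ : ℂ) := fun k => hFr _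
    rw [integral_congr_ae (Eventually.of_forall h2), integral_complex_ofReal,
      integral_complex_ofReal] at h1
    exact_mod_cast h1
  have hle : ∀ k : maxCompact p, ‖f (g * k)‖ ≤ C * C * ‖F (g * k)‖ := fun k => by
    obtain ⟨k', hk', q, hq, hgk⟩ := hQ.exists_eq_mul hp (g * k)
    obtain ⟨h1, h2⟩ := hC g (Set.mem_insert_of_mem _ hg) k k.2 k' hk' ⟨q, hq⟩ hgk
    rw [hgk, hf k' ⟨q, hq⟩, section_densityRep hF k' ⟨q, hq⟩, hFK ⟨k', hk'⟩, norm_smul,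
      Complex.norm_real, Real.norm_of_nonneg (hψ0 _), Real.norm_of_nonneg (abs_nonneg _)]
    calc _ ≤ C * ‖f k'‖ := h1 _
      _ ≤ C * ψ ⟨k', hk'⟩ := mul_le_mul_of_nonneg_left (hfψ ⟨k', hk'⟩) hC0
      _ ≤ C * ((C * |LinearMap.det (AdQuot p Q ⟨q, hq⟩)|) * ψ ⟨k', hk'⟩) :=
        mul_le_mul_of_nonneg_left (le_mul_of_one_le_left (hψ0 _) h2) hC0
      _ = _ := by ring
  calc ∫ k : maxCompact p, ‖f (g * k)‖ ∂μ ≤ ∫ k : maxCompact p, C * C * ‖F (g * k)‖ ∂μ :=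
        integral_mono (integrable_of_continuous μ (by fun_prop))
          (integrable_of_continuous μ (by fun_prop)) hle
    _ = C * C * ∫ k : maxCompact p, ψ k ∂μ := by rw [integral_const_mul, hint]
    _ ≤ C * C * ∫ k : maxCompact p, C * ‖f k‖ ∂μ :=
        mul_le_mul_of_nonneg_left (integral_mono (integrable_of_continuous μ hψc)
          (integrable_of_continuous μ (by fun_prop)) hψf) (by positivity)
    _ = _ := by rw [integral_const_mul]; ring

/-- Translates of null sets of `G/Q` are null sets. -/
theorem IsParabolic.measure_translate_eq_zero (hp : IsRealReductive p) {Q : Subgroup G}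
    (hQ : IsParabolic p Q) {S : Set G} (hS : ∀ x ∈ S, ∀ q ∈ Q, x * q ∈ S)
    (h0 : μ {k : maxCompact p | (k : G) ∈ S} = 0) {g : G}
    (hm : NullMeasurableSet {k : maxCompact p | g * (k : G) ∈ S} μ) :
    μ {k : maxCompact p | g * (k : G) ∈ S} = 0 := by
  have hcl : IsClosed (Q : Set G) := hQ.isClosed hp
  have hQc : CompactSpace (G ⧸ Q) := hQ.compactSpace_quotient hp
  by_contra hne
  obtain ⟨t, htS, htm, htae⟩ := hm.exists_measurable_subset_ae_eq
  have ht0 : 0 < μ t := by rw [measure_congr htae]; exact pos_iff_ne_zero.2 hne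
  obtain ⟨A, hAt, hA, hA0⟩ := htm.exists_lt_isCompact_of_ne_top (measure_ne_top μ _) ht0
  obtain ⟨C, hC0, hC⟩ := hQ.exists_integral_norm_le_of_continuous μ hp
    (ζ := Representation.trivial ℂ Q ℂ) continuous_snd (isCompact_singleton (x := g))
  have hmk : Continuous fun x : G => (QuotientGroup.mk x : G ⧸ Q) := QuotientGroup.continuous_mk
  let A' : Set (G ⧸ Q) := (fun k : maxCompact p => (QuotientGroup.mk (g * k) : G ⧸ Q)) '' A
  have hA' : IsCompact A' := hA.image (by fun_prop)
  have hA'0 : μ {k : maxCompact p | (QuotientGroup.mk (k : G) : G ⧸ Q) ∈ A'} = 0 := by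
    refine measure_mono_null ?_ h0
    rintro k ⟨k', hk', h⟩
    rw [QuotientGroup.eq] at h
    have h1 := hS _ (htS (hAt hk')) _ h
    rwa [mul_inv_cancel_left] at h1
  have key : ∀ ε : ℝ, 0 < ε → μ.real A ≤ C * ε := by
    intro ε hε
    obtain ⟨O, hO, hOo, hOε⟩ := Set.exists_isOpen_lt_of_lt
      {k : maxCompact p | (QuotientGroup.mk (k : G) : G ⧸ Q) ∈ A'} (ENNReal.ofReal ε)
      (by rw [hA'0]; exact ENNReal.ofReal_pos.2 hε)
    let B : Set (G ⧸ Q) := (fun k : maxCompact p => (QuotientGroup.mk (k : G) : G ⧸ Q)) '' Oᶜ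
    have hB : IsCompact B := hOo.isClosed_compl.isCompact.image (by fun_prop)
    obtain ⟨u, hu0, hu1, hu⟩ := exists_continuous_zero_one_of_isClosed hB.isClosed hA'.isClosed (by
      rw [Set.disjoint_left]
      rintro _ ⟨k, hk, rfl⟩ hkA
      exact hk (hO hkA))
    have h1 := hC g rfl (fun x => ((u (QuotientGroup.mk x) : ℝ) : ℂ)) (fun x q => by
      change ((u _ : ℝ) : ℂ) = ((u _ : ℝ) : ℂ)
      congr 2
      exact QuotientGroup.mk_mul_of_mem x q.2) (by fun_prop)
    have hni : ∀ x, ‖((u x : ℝ) : ℂ)‖ = u x := fun x => by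
      rw [Complex.norm_real, Real.norm_of_nonneg (hu x).1]
    simp only [hni] at h1
    have h2 : μ.real A ≤ ∫ k : maxCompact p, u (QuotientGroup.mk (g * k)) ∂μ := by
      rw [← integral_indicator_one hA.measurableSet]
      refine integral_mono ((integrable_const (1 : ℝ)).indicator hA.measurableSet)
        (integrable_of_continuous μ (by fun_prop)) fun k => ?_
      by_cases hk : k ∈ A
      · rw [Set.indicator_of_mem hk]
        exact (hu1 ⟨k, hk, rfl⟩).ge
      · rw [Set.indicator_of_notMem hk]
        exact (hu _).1
    have h3 : ∫ k : maxCompact p, u (QuotientGroup.mk (k : G)) ∂μ ≤ μ.real O := by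
      rw [← integral_indicator_one hOo.measurableSet]
      refine integral_mono (integrable_of_continuous μ (by fun_prop))
        ((integrable_const (1 : ℝ)).indicator hOo.measurableSet) fun k => ?_
      by_cases hk : k ∈ O
      · rw [Set.indicator_of_mem hk]
        exact (hu _).2
      · rw [Set.indicator_of_notMem hk]
        exact (hu0 ⟨k, hk, rfl⟩).le
    have h4 : μ.real O ≤ ε := ENNReal.toReal_le_of_le_ofReal hε.le hOε.le
    exact h2.trans (h1.trans (mul_le_mul_of_nonneg_left (h3.trans h4) hC0))
  have h5 : μ.real A ≤ 0 := by
    refine le_of_forall_pos_le_add fun ε hε => ?_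
    refine (key (ε / (C + 1)) (by positivity)).trans ?_
    rw [zero_add, mul_div_assoc', div_le_iff₀ (by positivity)]
    nlinarith
  exact hA0.ne' ((measureReal_eq_zero_iff).1 (le_antisymm h5 measureReal_nonneg))

/-- Translation of square integrable sections is bounded in `L¹`, by approximation with continuous
sections and Fatou's lemma. -/
theorem IsParabolic.exists_integral_norm_le (hp : IsRealReductive p) {Q : Subgroup G}
    (hQ : IsParabolic p Q) {ζ : Representation ℂ Q W} (hζ : IsContinuousRep ζ)
    {L : Set G} (hL : IsCompact L) : ∃ C : ℝ, 0 ≤ C ∧ ∀ g ∈ L, ∀ f ∈ sqIntSections p μ ζ,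
      ∫ k : maxCompact p, ‖f (g * k)‖ ∂μ ≤ C * ∫ k : maxCompact p, ‖f k‖ ∂μ := by
  obtain ⟨C, hC0, hC⟩ := hQ.exists_integral_norm_le_of_continuous μ hp hζ hL
  refine ⟨C, hC0, fun g hg f hf => ?_⟩
  have hfi : Integrable (fun k : maxCompact p => f k) μ := by
    simpa using integrable_of_mem_sqIntSections μ hf 1
  have hfg := integrable_of_mem_sqIntSections μ hf g
  choose F hF hFc hFδ using fun j : ℕ =>
    hQ.exists_continuous_section_near μ hp hζ hf.1 hfi (Nat.one_div_pos_of_nat (α := ℝ) (n := j))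
  have hFi : ∀ j, Integrable (fun k : maxCompact p => F j k) μ := fun j =>
    integrable_of_continuous μ ((hFc j).comp continuous_subtype_val)
  have hsub : ∀ j, Integrable (fun k : maxCompact p => F j k - f k) μ := fun j => (hFi j).sub hfi
  have htend : Tendsto (fun j => ∫ k : maxCompact p, ‖F j k - f k‖ ∂μ) atTop (𝓝 0) :=
    squeeze_zero (fun j => integral_nonneg fun k => norm_nonneg _) (fun j => (hFδ j).le)
      tendsto_one_div_add_atTop_nhds_zero_nat
  have hmeas : TendstoInMeasure μ (fun j (k : maxCompact p) => F j k) atTop fun k => f k := by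
    refine tendstoInMeasure_of_tendsto_eLpNorm one_ne_zero (fun j => (hFi j).1) hfi.1 ?_
    have h1 : ∀ j, eLpNorm ((fun k : maxCompact p => F j k) - fun k : maxCompact p => f k) 1 μ =
        ENNReal.ofReal (∫ k : maxCompact p, ‖F j k - f k‖ ∂μ) := fun j => by
      rw [eLpNorm_one_eq_lintegral_enorm,
        ofReal_integral_norm_eq_lintegral_enorm (hsub j)]
      rfl
    simp only [h1]
    simpa [Function.comp_def] using (ENNReal.continuous_ofReal.tendsto 0).comp htend
  obtain ⟨s, hs, hae⟩ := hmeas.exists_seq_tendsto_ae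
  -- the set of bad points in `G`
  let S : Set G := {x | ¬ Tendsto (fun j => ‖F (s j) x - f x‖) atTop (𝓝 0)}
  have hSQ : ∀ x ∈ S, ∀ q ∈ Q, x * q ∈ S := by
    intro x hx q hq hlim
    refine hx ?_
    have h1 : ∀ j, F (s j) x - f x =
        repCLM ζ ⟨q, hq⟩ (F (s j) (x * q) - f (x * q)) := fun j => by
      have h2 := hF (s j) x ⟨q, hq⟩
      have h3 := hf.1 x ⟨q, hq⟩
      change F (s j) (x * q) = _ at h2
      change f (x * q) = _ at h3
      rw [h2, h3, ← map_sub, repCLM_apply, ← Module.End.mul_apply, ← map_mul, mul_inv_cancel,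
        map_one, Module.End.one_apply]
    simp only [h1]
    have h4 := tendsto_zero_iff_norm_tendsto_zero.2 hlim
    have h5 := ((repCLM ζ ⟨q, hq⟩).continuous.tendsto 0).comp h4
    rw [map_zero] at h5
    exact tendsto_zero_iff_norm_tendsto_zero.1 h5
  have hS0 : μ {k : maxCompact p | (k : G) ∈ S} = 0 := by
    refine measure_mono_null (fun k hk => ?_) (ae_iff.1 hae)
    exact fun hlim => hk (tendsto_iff_norm_sub_tendsto_zero.1 hlim)
  have hFgi : ∀ j, Integrable (fun k : maxCompact p => F j (g * k)) μ := fun j =>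
    integrable_of_continuous μ ((hFc j).comp (by fun_prop))
  have hSm : NullMeasurableSet {k : maxCompact p | g * (k : G) ∈ S} μ := by
    have ha : ∀ j, AEMeasurable (fun k : maxCompact p => ‖F (s j) (g * k) - f (g * k)‖) μ :=
      fun j => ((hFgi (s j)).sub hfg).norm.1.aemeasurable
    have h1 : MeasurableSet {k : maxCompact p |
        Tendsto (fun j => (ha j).mk _ k) atTop (𝓝 (0 : ℝ))} :=
      measurableSet_tendsto _ fun j => (ha j).measurable_mk
    refine (h1.compl.nullMeasurableSet).congr ?_
    have h2 : ∀ᵐ k : maxCompact p ∂μ, ∀ j, ‖F (s j) (g * k) - f (g * k)‖ = (ha j).mk _ k :=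
      ae_all_iff.2 fun j => (ha j).ae_eq_mk
    filter_upwards [h2] with k hk
    change (¬ Tendsto (fun j => (ha j).mk _ k) atTop (𝓝 (0 : ℝ))) =
      ¬ Tendsto (fun j => ‖F (s j) (g * k) - f (g * k)‖) atTop (𝓝 0)
    simp only [hk]
  have hae' : ∀ᵐ k : maxCompact p ∂μ, Tendsto (fun j => F (s j) (g * k)) atTop (𝓝 (f (g * k))) := by
    have h1 := hQ.measure_translate_eq_zero μ hp hSQ hS0 hSm
    rw [ae_iff]
    refine measure_mono_null (fun k hk => ?_) h1
    exact fun hlim => hk (tendsto_iff_norm_sub_tendsto_zero.2 hlim)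
  have hFatou := Lp.eLpNorm_lim_le_liminf_eLpNorm (p := 1)
    (f := fun j (k : maxCompact p) => F (s j) (g * k)) (fun j => (hFgi _).1) _ hae'
  have hbound : ∀ j, eLpNorm (fun k : maxCompact p => F (s j) (g * k)) 1 μ ≤
      ENNReal.ofReal (C * (∫ k : maxCompact p, ‖f k‖ ∂μ +
        ∫ k : maxCompact p, ‖F (s j) k - f k‖ ∂μ)) := fun j => by
    rw [eLpNorm_one_eq_lintegral_enorm, ← ofReal_integral_norm_eq_lintegral_enorm (hFgi _)]
    refine ENNReal.ofReal_le_ofReal ((hC g hg _ (hF _) (hFc _)).trans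
      (mul_le_mul_of_nonneg_left ?_ hC0))
    rw [← integral_add hfi.norm (hsub _).norm]
    refine integral_mono (hFi _).norm (hfi.norm.add (hsub _).norm) fun k => ?_
    change ‖F (s j) k‖ ≤ ‖f k‖ + ‖F (s j) k - f k‖
    linarith [norm_sub_norm_le (F (s j) k) (f k)]
  have hlim : Tendsto (fun j => ENNReal.ofReal (C * (∫ k : maxCompact p, ‖f k‖ ∂μ +
      ∫ k : maxCompact p, ‖F (s j) k - f k‖ ∂μ))) atTop
      (𝓝 (ENNReal.ofReal (C * ∫ k : maxCompact p, ‖f k‖ ∂μ))) := by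
    have h1 := (((htend.comp hs.tendsto_atTop).const_add
      (∫ k : maxCompact p, ‖f k‖ ∂μ)).const_mul C)
    rw [add_zero] at h1
    exact (ENNReal.continuous_ofReal.tendsto _).comp h1
  have hfin := hFatou.trans ((liminf_le_liminf (Eventually.of_forall hbound)).trans
    hlim.liminf_eq.le)
  rw [eLpNorm_one_eq_lintegral_enorm, ← ofReal_integral_norm_eq_lintegral_enorm hfg] at hfin
  exact (ENNReal.ofReal_le_ofReal_iff
    (mul_nonneg hC0 (integral_nonneg fun k => norm_nonneg _))).1 hfin

/-- An equivariant functional on continuous sections is equivariant on square integrable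
sections. -/
theorem IsParabolic.pairing_leftReg_of_mem_sqIntSections (hp : IsRealReductive p) {Q : Subgroup G}
    (hQ : IsParabolic p Q) {ζ : Representation ℂ Q W} (hζ : IsContinuousRep ζ)
    {V : Type*} [NormedAddCommGroup V] [NormedSpace ℂ V] [FiniteDimensional ℂ V]
    {σ : Representation ℂ G V} {Θ : C(maxCompact p, W →L[ℂ] V)}
    (hΘ : ∀ f ∈ equivSections ζ, Continuous f → ∀ g : G,
      pairing μ Θ (leftReg g f) = σ g (pairing μ Θ f))
    {f : G → W} (hf : f ∈ sqIntSections p μ ζ) (g : G) :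
    pairing μ Θ (leftReg g f) = σ g (pairing μ Θ f) := by
  have hint : ∀ f ∈ sqIntSections p μ ζ, Integrable (fun k : maxCompact p => f k) μ :=
    fun f hf => by simpa using integrable_of_mem_sqIntSections μ hf 1
  obtain ⟨C, hC0, hC⟩ := hQ.exists_integral_norm_le μ hp hζ (isCompact_singleton (x := g⁻¹))
  have key : ∀ δ : ℝ, 0 < δ → ‖pairing μ Θ (leftReg g f) - σ g (pairing μ Θ f)‖ ≤
      (‖Θ‖ * C + ‖repCLM σ g‖ * ‖Θ‖) * δ := by
    intro δ hδ
    obtain ⟨f', hf', hf'c, hlt⟩ := hQ.exists_continuous_section_near μ hp hζ hf.1 (hint f hf) hδ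
    have hf's := mem_sqIntSections_of_continuous μ hf' hf'c
    have hd : f' - f ∈ sqIntSections p μ ζ := sub_mem hf's hf
    have h1 : pairing μ Θ (leftReg g (f' - f)) =
        pairing μ Θ (leftReg g f') - pairing μ Θ (leftReg g f) := by
      rw [map_sub]
      exact pairing_sub μ Θ (integrable_of_mem_sqIntSections μ hf's g⁻¹)
        (integrable_of_mem_sqIntSections μ hf g⁻¹)
    have h2 : pairing μ Θ (leftReg g f) - σ g (pairing μ Θ f) =
        repCLM σ g (pairing μ Θ (f' - f)) - pairing μ Θ (leftReg g (f' - f)) := by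
      rw [h1, pairing_sub μ Θ (hint _ hf's) (hint _ hf), map_sub, repCLM_apply, repCLM_apply,
        hΘ f' hf' hf'c g]
      abel
    have h3 := norm_pairing_le μ Θ (f := leftReg g (f' - f))
      (integrable_of_mem_sqIntSections μ hd g⁻¹)
    have h4 := hC g⁻¹ rfl _ hd
    have h5 := norm_pairing_le μ Θ (hint _ hd)
    have h6 : ∫ k : maxCompact p, ‖(f' - f) k‖ ∂μ ≤ δ := hlt.le
    rw [h2]
    calc _ ≤ ‖repCLM σ g‖ * (‖Θ‖ * δ) + ‖Θ‖ * (C * δ) := by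
          refine (norm_sub_le _ _).trans (add_le_add ?_ (h3.trans ?_))
          · refine ((repCLM σ g).le_opNorm _).trans (mul_le_mul_of_nonneg_left ?_ (norm_nonneg _))
            exact h5.trans (mul_le_mul_of_nonneg_left h6 (norm_nonneg Θ))
          · refine mul_le_mul_of_nonneg_left (le_trans ?_ (mul_le_mul_of_nonneg_left h6 hC0))
              (norm_nonneg Θ)
            simpa only [leftReg_apply] using h4
      _ = _ := by ring
  have h0 : ‖pairing μ Θ (leftReg g f) - σ g (pairing μ Θ f)‖ ≤ 0 := by
    refine le_of_forall_pos_le_add fun ε hε => ?_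
    set A := ‖Θ‖ * C + ‖repCLM σ g‖ * ‖Θ‖ with hA
    have hA0 : 0 ≤ A := by positivity
    refine (key (ε / (A + 1)) (by positivity)).trans ?_
    rw [zero_add, mul_div_assoc', div_le_iff₀ (by positivity)]
    nlinarith
  exact sub_eq_zero.1 (norm_le_zero_iff.1 h0)

end Translation

/-! ### Strong continuity of translation -/

section StrongContinuity

variable {n : ℕ} {G : Type*} [Group G] [TopologicalSpace G] [IsTopologicalGroup G]
variable {p : G →* GL (Fin n) ℝ}

/-- A real reductive group is locally compact: the sets on which `p(g)` and `p(g)⁻¹` are bounded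
are compact. -/
theorem IsRealReductive.exists_isCompact_mem_nhds (hp : IsRealReductive p) (g₀ : G) :
    ∃ L ∈ 𝓝 g₀, IsCompact L := by
  have hc1 : Continuous fun g : G => (p g).val := hp.continuous_val
  have hc2 : Continuous fun g : G => (p g⁻¹).val := hc1.comp continuous_inv
  set R : ℝ := max ‖(p g₀).val‖ ‖(p g₀⁻¹).val‖ + 1
  have hR1 : ‖(p g₀).val‖ < R := (le_max_left _ _).trans_lt (lt_add_one _)
  have hR2 : ‖(p g₀⁻¹).val‖ < R := (le_max_right _ _).trans_lt (lt_add_one _)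
  have hS : IsClosed {g : G | ‖(p g).val‖ ≤ R ∧ ‖(p g⁻¹).val‖ ≤ R} :=
    (isClosed_le hc1.norm continuous_const).inter (isClosed_le hc2.norm continuous_const)
  refine ⟨{g | ‖(p g).val‖ ≤ R ∧ ‖(p g⁻¹).val‖ ≤ R}, ?_, ?_⟩
  · filter_upwards [hc1.norm.continuousAt.eventually_lt continuousAt_const hR1,
      hc2.norm.continuousAt.eventually_lt continuousAt_const hR2] with g h1 h2
    exact ⟨h1.le, h2.le⟩
  · rw [isCompact_iff_ultrafilter_le_nhds]
    intro F hF
    have hF' := le_principal_iff.1 hF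
    have hball : IsCompact (Metric.closedBall (0 : Matrix (Fin n) (Fin n) ℝ) R) :=
      isCompact_closedBall _ _
    obtain ⟨u, -, hu⟩ := isCompact_iff_ultrafilter_le_nhds.1 hball
      (F.map fun g => (p g).val) (le_principal_iff.2 (mem_map.2 (mem_of_superset hF'
        fun g hg => mem_closedBall_zero_iff.2 hg.1)))
    obtain ⟨v, -, hv⟩ := isCompact_iff_ultrafilter_le_nhds.1 hball
      (F.map fun g => (p g⁻¹).val) (le_principal_iff.2 (mem_map.2 (mem_of_superset hF'
        fun g hg => mem_closedBall_zero_iff.2 hg.2)))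
    have hu' : Tendsto (fun g => (p g).val) F (𝓝 u) := hu
    have hv' : Tendsto (fun g => (p g⁻¹).val) F (𝓝 v) := hv
    have huv : u * v = 1 := by
      refine tendsto_nhds_unique (hu'.mul hv') ?_
      have : ∀ g : G, (p g).val * (p g⁻¹).val = 1 := fun g => by
        rw [← Units.val_mul, ← map_mul, mul_inv_cancel, map_one, Units.val_one]
      simp only [this]
      exact tendsto_const_nhds
    obtain ⟨x, -, hx⟩ := hp.exists_mapClusterPt (g := id) (l := (F : Filter G))
      (u := ⟨u, v, huv, mul_eq_one_comm.1 huv⟩) hu'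
    have hx' : (F : Filter G) ≤ 𝓝 x := Ultrafilter.clusterPt_iff.1 (by
      simpa [MapClusterPt] using hx)
    exact ⟨x, hS.mem_of_tendsto (f := id) hx' hF', hx'⟩

variable [T2Space G] (μ : Measure (maxCompact p)) [CompactSpace (maxCompact p)] [μ.IsHaarMeasure]
variable {W : Type*} [NormedAddCommGroup W] [NormedSpace ℂ W] [FiniteDimensional ℂ W]

/-- Translation is strongly continuous for the `L¹` norm: this holds for continuous sections, and
the translations by a compact neighbourhood of `g₀` are uniformly bounded. -/
theorem IsParabolic.tendsto_integral_norm_translate_sub (hp : IsRealReductive p) {Q : Subgroup G}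
    (hQ : IsParabolic p Q) {ζ : Representation ℂ Q W} (hζ : IsContinuousRep ζ) {f : G → W}
    (hf : f ∈ sqIntSections p μ ζ) (g₀ : G) :
    Tendsto (fun g => ∫ k : maxCompact p, ‖f (g * k) - f (g₀ * k)‖ ∂μ) (𝓝 g₀) (𝓝 0) := by
  obtain ⟨L, hL, hLc⟩ := hp.exists_isCompact_mem_nhds g₀
  obtain ⟨C, hC0, hC⟩ := hQ.exists_integral_norm_le μ hp hζ hLc
  have hint := fun g => integrable_of_mem_sqIntSections μ hf g
  rw [Metric.tendsto_nhds]
  intro ε hε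
  obtain ⟨f', hf', hf'c, hlt⟩ := hQ.exists_continuous_section_near μ hp hζ hf.1
    (by simpa using hint 1) (δ := ε / (2 * C + 1) / 2) (by positivity)
  have hf's := mem_sqIntSections_of_continuous μ hf' hf'c
  have hint' := fun g => integrable_of_mem_sqIntSections μ hf's g
  have hd : f' - f ∈ sqIntSections p μ ζ := sub_mem hf's hf
  have hcont : Continuous fun g : G => ∫ k : maxCompact p, ‖f' (g * k) - f' (g₀ * k)‖ ∂μ :=
    continuous_integral_param μ (f := fun g (k : maxCompact p) => ‖f' (g * k) - f' (g₀ * k)‖) (by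
      change Continuous fun z : G × maxCompact p => ‖f' (z.1 * z.2) - f' (g₀ * z.2)‖
      fun_prop)
  have h0 := hcont.tendsto g₀
  simp only [sub_self, norm_zero, integral_zero] at h0
  filter_upwards [hL, (tendsto_order.1 h0).2 (ε / 2) (by positivity)] with g hg hgε
  rw [dist_zero_right, Real.norm_of_nonneg (integral_nonneg fun k => norm_nonneg _)]
  have hb : ∀ g ∈ L, ∫ k : maxCompact p, ‖f' (g * k) - f (g * k)‖ ∂μ ≤
      C * (ε / (2 * C + 1) / 2) := fun g hg =>
    (hC g hg _ hd).trans (mul_le_mul_of_nonneg_left hlt.le hC0)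
  have hi1 : ∀ g, Integrable (fun k : maxCompact p => ‖f' (g * k) - f (g * k)‖) μ := fun g =>
    ((hint' g).sub (hint g)).norm
  have hi2 : Integrable (fun k : maxCompact p => ‖f' (g * k) - f' (g₀ * k)‖) μ :=
    ((hint' g).sub (hint' g₀)).norm
  have hi3 : Integrable (fun k : maxCompact p =>
      ‖f' (g * k) - f (g * k)‖ + ‖f' (g₀ * k) - f (g₀ * k)‖) μ := (hi1 g).add (hi1 g₀)
  have hle : ∫ k : maxCompact p, ‖f (g * k) - f (g₀ * k)‖ ∂μ ≤
      ∫ k : maxCompact p, ((‖f' (g * k) - f (g * k)‖ + ‖f' (g₀ * k) - f (g₀ * k)‖) +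
        ‖f' (g * k) - f' (g₀ * k)‖) ∂μ := by
    refine integral_mono ((hint g).sub (hint g₀)).norm (hi3.add hi2) fun k => ?_
    have h1 : f (g * k) - f (g₀ * k) = (f' (g₀ * k) - f (g₀ * k)) - (f' (g * k) - f (g * k)) +
        (f' (g * k) - f' (g₀ * k)) := by abel
    change ‖f (g * k) - f (g₀ * k)‖ ≤ _
    rw [h1]
    refine (norm_add_le _ _).trans ?_
    gcongr
    refine (norm_sub_le _ _).trans (add_comm _ _).le
  rw [integral_add hi3 hi2, integral_add (hi1 g) (hi1 g₀)] at hle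
  have h1 := hb g hg
  have h2 := hb g₀ (mem_of_mem_nhds hL)
  have h3 : C * (ε / (2 * C + 1) / 2) + C * (ε / (2 * C + 1) / 2) ≤ ε / 2 := by
    have h4 : C * (ε / (2 * C + 1) / 2) + C * (ε / (2 * C + 1) / 2) =
      (2 * C / (2 * C + 1)) * (ε / 2) := by field_simp; ring
    rw [h4]
    refine mul_le_of_le_one_left (by positivity) ((div_le_one (by positivity)).2 (by linarith))
  linarith

end StrongContinuity

/-! ### Restriction of sections to open subsets of the flag variety -/

section Cutoff

open TopologicalSpace

variable {n : ℕ} {G : Type*} [Group G] [TopologicalSpace G]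
variable {p : G →* GL (Fin n) ℝ} (μ : Measure (maxCompact p))
variable {W : Type*} [NormedAddCommGroup W] [NormedSpace ℂ W]
variable {Q : Subgroup G} {ζ : Representation ℂ Q W}

theorem sqIntAction_mul (a b : G) (f : sqIntSections p μ ζ) :
    sqIntAction p μ ζ (a * b) f = sqIntAction p μ ζ a (sqIntAction p μ ζ b f) :=
  Subtype.ext (by
    change leftReg (a * b) f.1 = leftReg a (leftReg b f.1)
    rw [map_mul]; rfl)

theorem sqIntAction_one (f : sqIntSections p μ ζ) : sqIntAction p μ ζ 1 f = f :=
  Subtype.ext (by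
    change leftReg 1 f.1 = f.1
    rw [map_one]; rfl)

variable [IsTopologicalGroup G]

/-- The operator on square integrable sections which multiplies by the indicator function of an
open set `N` of `G/Q`. -/
def cutoff (N : Opens (G ⧸ Q)) : sqIntSections p μ ζ →ₗ[ℂ] sqIntSections p μ ζ where
  toFun f := ⟨Set.indicator {x : G | (x : G ⧸ Q) ∈ N} f.1, fun x q => by
      have h : (x * q : G) ∈ {x : G | (x : G ⧸ Q) ∈ N} ↔ x ∈ {x : G | (x : G ⧸ Q) ∈ N} := by
        change ((x * q : G) : G ⧸ Q) ∈ N ↔ _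
        rw [QuotientGroup.mk_mul_of_mem x q.2]
        rfl
      by_cases hx : x ∈ {x : G | (x : G ⧸ Q) ∈ N}
      · rw [Set.indicator_of_mem hx, Set.indicator_of_mem (h.2 hx), f.2.1]
      · rw [Set.indicator_of_notMem hx, Set.indicator_of_notMem (mt h.1 hx), map_zero],
    fun g => by
      have hN : IsOpen {k : maxCompact p | ((g * k : G) : G ⧸ Q) ∈ N} :=
        N.isOpen.preimage (QuotientGroup.continuous_mk.comp (by fun_prop))
      exact (f.2.2 g).indicator hN.measurableSet⟩
  map_add' f f' := Subtype.ext (Set.indicator_add _ _ _)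
  map_smul' c f := Subtype.ext (Set.indicator_const_smul _ c f.1)

theorem cutoff_apply_of_mem {N : Opens (G ⧸ Q)} (f : sqIntSections p μ ζ) {x : G}
    (hx : (x : G ⧸ Q) ∈ N) : (cutoff μ N f).1 x = f.1 x :=
  Set.indicator_of_mem (s := {x : G | (x : G ⧸ Q) ∈ N}) hx _

theorem cutoff_apply_of_notMem {N : Opens (G ⧸ Q)} (f : sqIntSections p μ ζ) {x : G}
    (hx : (x : G ⧸ Q) ∉ N) : (cutoff μ N f).1 x = 0 :=
  Set.indicator_of_notMem (s := {x : G | (x : G ⧸ Q) ∈ N}) hx _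

theorem norm_cutoff_le (N : Opens (G ⧸ Q)) (f : sqIntSections p μ ζ) (x : G) :
    ‖(cutoff μ N f).1 x‖ ≤ ‖f.1 x‖ := by
  by_cases hx : (x : G ⧸ Q) ∈ N
  · rw [cutoff_apply_of_mem μ f hx]
  · rw [cutoff_apply_of_notMem μ f hx, norm_zero]
    exact norm_nonneg _

theorem cutoff_cutoff (N N' : Opens (G ⧸ Q)) (f : sqIntSections p μ ζ) :
    cutoff μ N (cutoff μ N' f) = cutoff μ (N ⊓ N') f := by
  refine Subtype.ext (funext fun x => ?_)
  by_cases h : (x : G ⧸ Q) ∈ N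
  · rw [cutoff_apply_of_mem μ _ h]
    by_cases h' : (x : G ⧸ Q) ∈ N'
    · rw [cutoff_apply_of_mem μ _ h', cutoff_apply_of_mem μ _ (N := N ⊓ N') ⟨h, h'⟩]
    · rw [cutoff_apply_of_notMem μ _ h', cutoff_apply_of_notMem μ _ (N := N ⊓ N') fun hh => h' hh.2]
  · rw [cutoff_apply_of_notMem μ _ h, cutoff_apply_of_notMem μ _ (N := N ⊓ N') fun hh => h hh.1]

theorem cutoff_bot (f : sqIntSections p μ ζ) : cutoff μ ⊥ f = 0 :=
  Subtype.ext (funext fun _ => cutoff_apply_of_notMem μ f (N := ⊥) fun h => h)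

theorem cutoff_top (f : sqIntSections p μ ζ) : cutoff μ ⊤ f = f :=
  Subtype.ext (funext fun _ => cutoff_apply_of_mem μ f (N := ⊤) trivial)

theorem cutoff_sup (N N' : Opens (G ⧸ Q)) (f : sqIntSections p μ ζ) :
    cutoff μ (N ⊔ N') f = cutoff μ N f + cutoff μ N' (f - cutoff μ N f) := by
  refine Subtype.ext (funext fun x => ?_)
  change _ = (cutoff μ N f).1 x + (cutoff μ N' (f - cutoff μ N f)).1 x
  by_cases h : (x : G ⧸ Q) ∈ N
  · rw [cutoff_apply_of_mem μ _ (N := N ⊔ N') (Or.inl h), cutoff_apply_of_mem μ _ h]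
    by_cases h' : (x : G ⧸ Q) ∈ N'
    · rw [cutoff_apply_of_mem μ _ h']
      change _ = _ + (f.1 x - (cutoff μ N f).1 x)
      rw [cutoff_apply_of_mem μ _ h, sub_self, add_zero]
    · rw [cutoff_apply_of_notMem μ _ h', add_zero]
  · rw [cutoff_apply_of_notMem μ _ h, zero_add]
    by_cases h' : (x : G ⧸ Q) ∈ N'
    · rw [cutoff_apply_of_mem μ _ (N := N ⊔ N') (Or.inr h'), cutoff_apply_of_mem μ _ h']
      change _ = f.1 x - (cutoff μ N f).1 x
      rw [cutoff_apply_of_notMem μ _ h, sub_zero]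
    · rw [cutoff_apply_of_notMem μ _ h', cutoff_apply_of_notMem μ _ (N := N ⊔ N')
        fun hh => hh.elim h h']

theorem cutoff_sqIntAction {N N' : Opens (G ⧸ Q)} {g : G} (h : ∀ x, g • x ∈ N' ↔ x ∈ N)
    (f : sqIntSections p μ ζ) :
    cutoff μ N' (sqIntAction p μ ζ g f) = sqIntAction p μ ζ g (cutoff μ N f) := by
  refine Subtype.ext (funext fun x => ?_)
  have h1 : (x : G ⧸ Q) ∈ N' ↔ ((g⁻¹ * x : G) : G ⧸ Q) ∈ N := by
    rw [← h]
    change _ ↔ ((g * (g⁻¹ * x) : G) : G ⧸ Q) ∈ N'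
    rw [mul_inv_cancel_left]
  change _ = (cutoff μ N f).1 (g⁻¹ * x)
  by_cases hx : (x : G ⧸ Q) ∈ N'
  · rw [cutoff_apply_of_mem μ _ hx, cutoff_apply_of_mem μ _ (h1.1 hx)]
    rfl
  · rw [cutoff_apply_of_notMem μ _ hx, cutoff_apply_of_notMem μ _ (mt h1.2 hx)]

end Cutoff

/-! ### Intertwining operators attached to invariant open sets -/

section Intertwiner

/-- A lower bound for the dimension of a space `E` from vectors `T j A` and evaluations `ev i v`
which separate them. -/
theorem card_mul_finrank_le_rank {V W E : Type*} [AddCommGroup V] [Module ℂ V] [AddCommGroup W]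
    [Module ℂ W] [AddCommMonoid E] [Module ℂ E] (F : Submodule ℂ (V →ₗ[ℂ] W))
    [FiniteDimensional ℂ F] {m : ℕ} (T : Fin m → F → E) (ev : Fin m → V → E →ₗ[ℂ] W)
    (h : ∀ i j A v, ev i v (T j A) = if j = i then A.1 v else 0) :
    ((m * Module.finrank ℂ F : ℕ) : Cardinal) ≤ Module.rank ℂ E := by
  let b := Module.finBasis ℂ F
  let L : E →ₗ[ℂ] (Fin m → V → W) := LinearMap.pi fun i => LinearMap.pi fun v => ev i v
  have hli : LinearIndependent ℂ fun z : Fin m × Fin (Module.finrank ℂ F) => T z.1 (b z.2) := by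
    refine LinearIndependent.of_comp L (Fintype.linearIndependent_iff.2 ?_)
    rintro c hc ⟨i, j⟩
    have h1 : ∑ j, c (i, j) • b j = 0 := by
      refine Subtype.ext (LinearMap.ext fun v => ?_)
      have h3 := congr_fun (congr_fun hc i) v
      rw [Fintype.sum_prod_type] at h3
      simp only [Finset.sum_apply, Pi.smul_apply, Function.comp_apply, L, LinearMap.pi_apply, h,
        smul_ite, smul_zero] at h3
      rw [Finset.sum_eq_single i (fun i' _ hi' => by simp [hi']) (by simp)] at h3
      simpa using h3
    exact Fintype.linearIndependent_iff.1 b.linearIndependent _ h1 j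
  simpa using hli.cardinal_lift_le_rank

open TopologicalSpace

variable {n : ℕ} {G : Type*} [Group G] [TopologicalSpace G] {p : G →* GL (Fin n) ℝ}
variable (μ : Measure (maxCompact p)) [CompactSpace (maxCompact p)]
variable {W V W' : Type*} [NormedAddCommGroup W] [NormedSpace ℂ W]
variable [NormedAddCommGroup V] [NormedSpace ℂ V] [NormedAddCommGroup W'] [NormedSpace ℂ W']
variable {Q H : Subgroup G} {ζ : Representation ℂ Q W} {σ : Representation ℂ G V}
variable {τ : Representation ℂ H W'}

section Finite

variable [IsFiniteMeasureOnCompacts μ]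

/-- The functional `f ↦ ∫_K Θ(k) f(k) dk` on square integrable sections. -/
def pairingLM (ζ : Representation ℂ Q W) (Θ : C(maxCompact p, W →L[ℂ] V)) :
    sqIntSections p μ ζ →ₗ[ℂ] V where
  toFun f := pairing μ Θ f.1
  map_add' f f' := by
    have h : ∀ f : sqIntSections p μ ζ, Integrable (fun k : maxCompact p => Θ k (f.1 k)) μ :=
      fun f => integrable_pairing μ Θ (by simpa using integrable_of_mem_sqIntSections μ f.2 1)
    change ∫ k : maxCompact p, Θ k (f.1 k + f'.1 k) ∂μ = _
    simp only [map_add]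
    exact integral_add (h f) (h f')
  map_smul' c f := by
    change ∫ k : maxCompact p, Θ k (c • f.1 k) ∂μ = _
    simp only [map_smul]
    exact integral_smul c _

theorem integral_norm_le_norm_toL2 (f : sqIntSections p μ ζ) :
    ∫ k : maxCompact p, ‖f.1 k‖ ∂μ ≤ (μ Set.univ ^ (1 / 2 : ℝ)).toReal * ‖toL2 p μ ζ f‖ := by
  have h2 : MemLp (fun k : maxCompact p => f.1 k) 2 μ := by simpa using f.2.2 1
  have h1 : ‖toL2 p μ ζ f‖ = (eLpNorm (fun k : maxCompact p => f.1 k) 2 μ).toReal :=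
    Lp.norm_toLp _ h2
  have hfin : μ Set.univ ^ (1 / 2 : ℝ) ≠ ⊤ :=
    ENNReal.rpow_ne_top_of_nonneg (by norm_num) isCompact_univ.measure_lt_top.ne
  rw [h1, integral_norm_eq_lintegral_enorm h2.1, ← eLpNorm_one_eq_lintegral_enorm,
    ← ENNReal.toReal_mul, mul_comm]
  refine ENNReal.toReal_mono (ENNReal.mul_ne_top h2.eLpNorm_ne_top hfin) ?_
  refine (eLpNorm_le_eLpNorm_mul_rpow_measure_univ (one_le_two (α := ENNReal)) h2.1).trans
    (le_of_eq ?_)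
  congr 2
  norm_num

end Finite

variable [IsTopologicalGroup G] [T2Space G] [μ.IsHaarMeasure] [FiniteDimensional ℂ W]
  [FiniteDimensional ℂ V]

/-- For an `H`-invariant open set `N` of `G/Q`, a `G`-equivariant functional with values in `σ` and
`A ∈ Hom_H(σ, τ)`, the intertwining operator which sends `f` to the function
`g ↦ A (∫ Θ(k) (1_N · (g⁻¹ f))(k) dk)`. -/
theorem IsParabolic.exists_mem_homG (hp : IsRealReductive p) (hQ : IsParabolic p Q)
    (hζ : IsContinuousRep ζ) {Θ : C(maxCompact p, W →L[ℂ] V)}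
    (hΘ : ∀ f ∈ equivSections ζ, Continuous f → ∀ g : G,
      pairing μ Θ (leftReg g f) = σ g (pairing μ Θ f))
    {N : Opens (G ⧸ Q)} (hN : ∀ h ∈ H, ∀ x ∈ N, h • x ∈ N) {A : V →ₗ[ℂ] W'}
    (hA : A ∈ homH σ τ) :
    ∃ T ∈ homG p μ ζ τ, ∀ f : sqIntSections p μ ζ,
      (T (toL2 p μ ζ f)).1 1 = A (pairingLM μ ζ Θ (cutoff μ N f)) := by
  have hN' : ∀ h ∈ H, ∀ x, h • x ∈ N ↔ x ∈ N := fun h hh x =>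
    ⟨fun hx => by simpa using hN h⁻¹ (H.inv_mem hh) _ hx, hN h hh x⟩
  let B : V →L[ℂ] W' := LinearMap.toContinuousLinearMap A
  have hint : ∀ (f : sqIntSections p μ ζ) (g : G),
      Integrable (fun k : maxCompact p => f.1 (g * k)) μ :=
    fun f g => integrable_of_mem_sqIntSections μ f.2 g
  have hint1 : ∀ f : sqIntSections p μ ζ, Integrable (fun k : maxCompact p => f.1 k) μ :=
      fun f => by
    simpa using hint f 1
  -- the basic estimate, by the `L¹` norm
  have hbound : ∀ f : sqIntSections p μ ζ, ‖A (pairingLM μ ζ Θ (cutoff μ N f))‖ ≤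
      ‖B‖ * ‖Θ‖ * ∫ k : maxCompact p, ‖f.1 k‖ ∂μ := fun f => by
    refine (B.le_opNorm _).trans ?_
    rw [mul_assoc]
    refine mul_le_mul_of_nonneg_left ((norm_pairing_le μ Θ (hint1 _)).trans
      (mul_le_mul_of_nonneg_left ?_ (norm_nonneg Θ))) (norm_nonneg _)
    exact integral_mono (hint1 (cutoff μ N f)).norm (hint1 f).norm fun k => norm_cutoff_le μ N f k
  have hcont : ∀ f : sqIntSections p μ ζ,
      Continuous fun g : G => A (pairingLM μ ζ Θ (cutoff μ N (sqIntAction p μ ζ g⁻¹ f))) := by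
    refine fun f => continuous_iff_continuousAt.2 fun g₀ => ?_
    refine tendsto_iff_norm_sub_tendsto_zero.2 ?_
    have h1 := (hQ.tendsto_integral_norm_translate_sub μ hp hζ f.2 g₀).const_mul (‖B‖ * ‖Θ‖)
    rw [mul_zero] at h1
    refine squeeze_zero (fun g => norm_nonneg _) (fun g => ?_) h1
    rw [← map_sub, ← map_sub, ← map_sub]
    refine (hbound _).trans (le_of_eq ?_)
    congr 1
    refine integral_congr_ae (Eventually.of_forall fun k => ?_)
    change ‖f.1 (g⁻¹⁻¹ * k) - f.1 (g₀⁻¹⁻¹ * k)‖ = _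
    rw [inv_inv, inv_inv]
  let S : sqIntSections p μ ζ →ₗ[ℂ] contSections τ :=
    { toFun := fun f => ⟨⟨_, hcont f⟩, fun g h => by
        change A (pairingLM μ ζ Θ (cutoff μ N (sqIntAction p μ ζ (g * h)⁻¹ f))) =
          τ h⁻¹ (A (pairingLM μ ζ Θ (cutoff μ N (sqIntAction p μ ζ g⁻¹ f))))
        rw [mul_inv_rev, sqIntAction_mul, cutoff_sqIntAction μ (N := N)
          (hN' (h : G)⁻¹ (H.inv_mem h.2))]
        have h1 : pairingLM μ ζ Θ (sqIntAction p μ ζ (h : G)⁻¹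
            (cutoff μ N (sqIntAction p μ ζ g⁻¹ f))) =
            σ (h : G)⁻¹ (pairingLM μ ζ Θ (cutoff μ N (sqIntAction p μ ζ g⁻¹ f))) :=
          hQ.pairing_leftReg_of_mem_sqIntSections μ hp hζ hΘ
            (cutoff μ N (sqIntAction p μ ζ g⁻¹ f)).2 _
        rw [h1]
        exact hA h⁻¹ _⟩
      map_add' := fun f f' => Subtype.ext (ContinuousMap.ext fun g => by
        change A (pairingLM μ ζ Θ (cutoff μ N (sqIntAction p μ ζ g⁻¹ (f + f')))) = _
        simp only [map_add]
        rfl)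
      map_smul' := fun c f => Subtype.ext (ContinuousMap.ext fun g => by
        change A (pairingLM μ ζ Θ (cutoff μ N (sqIntAction p μ ζ g⁻¹ (c • f)))) = _
        simp only [map_smul]
        rfl) }
  have hSle : ∀ {L : Set G}, IsCompact L → ∃ C : ℝ, 0 ≤ C ∧ ∀ f, ∀ g ∈ L,
      ‖(S f).1 g‖ ≤ C * ‖toL2 p μ ζ f‖ := fun {L} hL => by
    obtain ⟨C, hC0, hC⟩ := hQ.exists_integral_norm_le μ hp hζ hL
    refine ⟨‖B‖ * ‖Θ‖ * (C * (μ Set.univ ^ (1 / 2 : ℝ)).toReal), by positivity, fun f g hg => ?_⟩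
    refine (hbound (sqIntAction p μ ζ g⁻¹ f)).trans ?_
    rw [mul_assoc (‖B‖ * ‖Θ‖), mul_assoc C]
    refine mul_le_mul_of_nonneg_left ?_ (by positivity)
    refine le_trans (le_of_eq ?_) ((hC g hg f.1 f.2).trans
      (mul_le_mul_of_nonneg_left (integral_norm_le_norm_toL2 μ f) hC0))
    refine integral_congr_ae (Eventually.of_forall fun k => ?_)
    change ‖f.1 (g⁻¹⁻¹ * k)‖ = _
    rw [inv_inv]
  have hS0 : ∀ f f', toL2 p μ ζ f = toL2 p μ ζ f' → S f = S f' := fun f f' h => by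
    refine Subtype.ext (ContinuousMap.ext fun g => ?_)
    obtain ⟨C, -, hC⟩ := hSle (isCompact_singleton (x := g))
    have h1 := hC (f - f') g rfl
    rw [map_sub, map_sub, h, sub_self, norm_zero, mul_zero, norm_le_zero_iff] at h1
    exact sub_eq_zero.1 h1
  obtain ⟨r, hr⟩ := (toL2 p μ ζ).exists_rightInverse_of_surjective
    (classL2 p μ ζ).range_rangeRestrict
  have hr' : ∀ u, toL2 p μ ζ (r u) = u := fun u => LinearMap.congr_fun hr u
  have hTc : Continuous (S ∘ₗ r) := by
    refine continuous_of_continuousAt_zero (S ∘ₗ r) ?_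
    rw [ContinuousAt, map_zero, tendsto_subtype_rng,
      ContinuousMap.tendsto_iff_forall_isCompact_tendstoUniformlyOn]
    intro L hL
    obtain ⟨C, hC0, hC⟩ := hSle hL
    rw [Metric.tendstoUniformlyOn_iff]
    intro ε hε
    have h1 : ∀ᶠ u : L2 p μ ζ in 𝓝 0, C * ‖u‖ < ε := by
      have h2 : Continuous fun u : L2 p μ ζ => C * ‖u‖ := by fun_prop
      exact h2.continuousAt.eventually_lt continuousAt_const (by simpa using hε)
    filter_upwards [h1] with u hu g hg
    change dist 0 ((S (r u)).1 g) < ε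
    rw [dist_zero_left]
    refine lt_of_le_of_lt ((hC _ g hg).trans ?_) hu
    rw [hr']
  refine ⟨⟨S ∘ₗ r, hTc⟩, fun g f => ?_, fun f => ?_⟩
  · change S (r _) = contAction τ g (S (r _))
    rw [hS0 _ _ (hr' _), hS0 _ _ (hr' _)]
    refine Subtype.ext (ContinuousMap.ext fun x => ?_)
    change A (pairingLM μ ζ Θ (cutoff μ N (sqIntAction p μ ζ x⁻¹ (sqIntAction p μ ζ g f)))) =
      A (pairingLM μ ζ Θ (cutoff μ N (sqIntAction p μ ζ (g⁻¹ * x)⁻¹ f)))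
    rw [← sqIntAction_mul, mul_inv_rev, inv_inv]
  · change (S (r _)).1 1 = _
    rw [hS0 _ _ (hr' _)]
    change A (pairingLM μ ζ Θ (cutoff μ N (sqIntAction p μ ζ 1⁻¹ f))) = _
    rw [inv_one, sqIntAction_one]

/-- Disjoint invariant open sets on which the functional remains surjective give linearly
independent intertwining operators. -/
theorem IsParabolic.le_rank_homG (hp : IsRealReductive p) (hQ : IsParabolic p Q)
    (hζ : IsContinuousRep ζ) {Θ : C(maxCompact p, W →L[ℂ] V)}
    (hΘ : ∀ f ∈ equivSections ζ, Continuous f → ∀ g : G,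
      pairing μ Θ (leftReg g f) = σ g (pairing μ Θ f))
    [FiniteDimensional ℂ W'] {m : ℕ} {N : Fin m → Opens (G ⧸ Q)}
    (hN : ∀ i, ∀ h ∈ H, ∀ x ∈ N i, h • x ∈ N i)
    (hdisj : Pairwise fun i j => Disjoint (N i) (N j))
    (hsurj : ∀ i v, ∃ f : sqIntSections p μ ζ, pairingLM μ ζ Θ (cutoff μ (N i) f) = v) :
    ((m * Module.finrank ℂ (homH σ τ) : ℕ) : Cardinal) ≤ Module.rank ℂ (homG p μ ζ τ) := by
  choose T hT hTe using fun (i : Fin m) (A : homH σ τ) => hQ.exists_mem_homG μ hp hζ hΘ (hN i) A.2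
  choose f hf using hsurj
  refine card_mul_finrank_le_rank (homH σ τ) (fun i A => (⟨T i A, hT i A⟩ : homG p μ ζ τ))
    (fun i v => ⟨⟨fun T => (T.1 (toL2 p μ ζ (cutoff μ (N i) (f i v)))).1 1, fun _ _ => rfl⟩,
      fun _ _ => rfl⟩) fun i j A v => ?_
  refine (hTe j A _).trans ?_
  rw [cutoff_cutoff]
  split_ifs with hz
  · rw [hz, inf_idem, hf]
  · rw [disjoint_iff.1 (hdisj hz), cutoff_bot, map_zero, map_zero]

end Intertwiner

/-! ### Sections supported in an open set suffice -/

section Local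

open TopologicalSpace

variable {n : ℕ} {G : Type*} [Group G] [TopologicalSpace G] [IsTopologicalGroup G]
variable {p : G →* GL (Fin n) ℝ} (μ : Measure (maxCompact p)) {Q : Subgroup G}

theorem IsParabolic.measure_mk_mem_pos [T2Space G] [μ.IsHaarMeasure]
    (hp : IsRealReductive p) (hQ : IsParabolic p Q)
    {N : Opens (G ⧸ Q)} (hN : (N : Set (G ⧸ Q)).Nonempty) :
    0 < μ {k : maxCompact p | ((k : G) : G ⧸ Q) ∈ N} := by
  have hopen : IsOpen {k : maxCompact p | ((k : G) : G ⧸ Q) ∈ N} :=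
    N.isOpen.preimage (QuotientGroup.continuous_mk.comp continuous_subtype_val)
  refine hopen.measure_pos μ ?_
  obtain ⟨x, hx⟩ := hN
  obtain ⟨g, rfl⟩ := QuotientGroup.mk_surjective x
  obtain ⟨k, hk, q, hq, rfl⟩ := hQ.exists_eq_mul hp g
  refine ⟨⟨k, hk⟩, ?_⟩
  rwa [QuotientGroup.mk_mul_of_mem k hq] at hx

variable [CompactSpace (maxCompact p)] {W V : Type*} [NormedAddCommGroup W] [NormedSpace ℂ W]
variable [NormedAddCommGroup V] [NormedSpace ℂ V] {σ : Representation ℂ G V}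

section Finite

variable [IsFiniteMeasureOnCompacts μ] (ζ : Representation ℂ Q W)
variable (Θ : C(maxCompact p, W →L[ℂ] V))

/-- The values of the functional defined by `Θ` on sections which vanish outside `N`. -/
def localRange (N : Opens (G ⧸ Q)) : Submodule ℂ V :=
  LinearMap.range (pairingLM μ ζ Θ ∘ₗ cutoff μ N)

theorem localRange_mono {N N' : Opens (G ⧸ Q)} (h : N ≤ N') :
    localRange μ ζ Θ N ≤ localRange μ ζ Θ N' := by
  rintro _ ⟨f, rfl⟩
  refine ⟨cutoff μ N f, ?_⟩
  rw [LinearMap.comp_apply, cutoff_cutoff, inf_eq_right.2 h]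
  rfl

theorem localRange_sup_le (N N' : Opens (G ⧸ Q)) :
    localRange μ ζ Θ (N ⊔ N') ≤ localRange μ ζ Θ N ⊔ localRange μ ζ Θ N' := by
  rintro _ ⟨f, rfl⟩
  rw [LinearMap.comp_apply, cutoff_sup, map_add]
  exact Submodule.add_mem_sup ⟨_, rfl⟩ ⟨_, rfl⟩

theorem localRange_bot : localRange μ ζ Θ ⊥ = ⊥ := by
  refine (Submodule.eq_bot_iff _).2 ?_
  rintro _ ⟨f, rfl⟩
  rw [LinearMap.comp_apply, cutoff_bot, map_zero]

end Finite

variable [T2Space G] [μ.IsHaarMeasure]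

variable [FiniteDimensional ℂ W] [FiniteDimensional ℂ V]
variable {ζ : Representation ℂ Q W} {Θ : C(maxCompact p, W →L[ℂ] V)}

theorem IsParabolic.finrank_localRange_le (hp : IsRealReductive p) (hQ : IsParabolic p Q)
    (hζ : IsContinuousRep ζ)
    (hΘ : ∀ f ∈ equivSections ζ, Continuous f → ∀ g : G,
      pairing μ Θ (leftReg g f) = σ g (pairing μ Θ f))
    {N N' : Opens (G ⧸ Q)} {g : G} (h : ∀ x, g • x ∈ N' ↔ x ∈ N) :
    Module.finrank ℂ (localRange μ ζ Θ N) ≤ Module.finrank ℂ (localRange μ ζ Θ N') := by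
  have hinj : Function.Injective (σ g) := Function.LeftInverse.injective (g := σ g⁻¹) fun v => by
    rw [← Module.End.mul_apply, ← map_mul, inv_mul_cancel, map_one, Module.End.one_apply]
  rw [(Submodule.equivMapOfInjective (σ g) hinj (localRange μ ζ Θ N)).finrank_eq]
  refine Submodule.finrank_mono ?_
  rintro _ ⟨_, ⟨f, rfl⟩, rfl⟩
  refine ⟨sqIntAction p μ ζ g f, ?_⟩
  rw [LinearMap.comp_apply, cutoff_sqIntAction μ h]
  exact hQ.pairing_leftReg_of_mem_sqIntSections μ hp hζ hΘ (cutoff μ N f).2 g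

/-- If `G/Q` is connected, a surjective equivariant functional is already surjective on the
sections supported in a given non-empty open set. The range on a small open set does not change
under further shrinking, hence is locally constant along `G/Q`, and the ranges on the sets of an
open covering span everything. -/
theorem IsParabolic.localRange_eq_top [ConnectedSpace (G ⧸ Q)] (hp : IsRealReductive p)
    (hQ : IsParabolic p Q) (hζ : IsContinuousRep ζ)
    (hΘ : ∀ f ∈ equivSections ζ, Continuous f → ∀ g : G,
      pairing μ Θ (leftReg g f) = σ g (pairing μ Θ f))
    (hsurj : localRange μ ζ Θ ⊤ = ⊤) {N : Opens (G ⧸ Q)} (hN : (N : Set (G ⧸ Q)).Nonempty) :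
    localRange μ ζ Θ N = ⊤ := by
  have hQc : CompactSpace (G ⧸ Q) := hQ.compactSpace_quotient hp
  -- an open set with smallest possible range
  obtain ⟨N₀, hN₀, hmin⟩ : ∃ N₀ : Opens (G ⧸ Q), (N₀ : Set (G ⧸ Q)).Nonempty ∧
      ∀ N : Opens (G ⧸ Q), (N : Set (G ⧸ Q)).Nonempty →
        Module.finrank ℂ (localRange μ ζ Θ N₀) ≤ Module.finrank ℂ (localRange μ ζ Θ N) := by
    obtain ⟨N₀, h1, h2⟩ := (measure fun N : Opens (G ⧸ Q) =>
      Module.finrank ℂ (localRange μ ζ Θ N)).wf.has_min {N | (N : Set (G ⧸ Q)).Nonempty} ⟨N, hN⟩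
    exact ⟨N₀, h1, fun N hN => not_lt.1 (h2 N hN)⟩
  have htrans : ∀ x : G ⧸ Q, ∃ N₁ : Opens (G ⧸ Q), x ∈ N₁ ∧
      Module.finrank ℂ (localRange μ ζ Θ N₁) ≤ Module.finrank ℂ (localRange μ ζ Θ N₀) := by
    intro x
    obtain ⟨y, hy⟩ := hN₀
    obtain ⟨g, hg⟩ := MulAction.exists_smul_eq G x y
    refine ⟨⟨(fun z => g • z) ⁻¹' N₀, N₀.isOpen.preimage (continuous_const_smul g)⟩, ?_,
      hQ.finrank_localRange_le μ hp hζ hΘ (g := g) fun z => Iff.rfl⟩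
    change g • x ∈ N₀
    rw [hg]
    exact hy
  let O : Set (G ⧸ Q) := {x | ∃ N₂ : Opens (G ⧸ Q), x ∈ N₂ ∧
    localRange μ ζ Θ N₂ ≤ localRange μ ζ Θ N₀}
  have hO : IsOpen O := isOpen_iff_mem_nhds.2 fun x ⟨N₂, hx, hN₂⟩ =>
    mem_of_superset (N₂.isOpen.mem_nhds hx) fun y hy => ⟨N₂, hy, hN₂⟩
  have hO' : IsClosed O := isClosed_of_closure_subset fun x hx => by
    obtain ⟨N₁, hx₁, hN₁⟩ := htrans x
    obtain ⟨y, hy₁, N₂, hy₂, hN₂⟩ := mem_closure_iff.1 hx N₁ N₁.isOpen hx₁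
    have h1 : localRange μ ζ Θ (N₁ ⊓ N₂) = localRange μ ζ Θ N₁ :=
      Submodule.eq_of_le_of_finrank_le (localRange_mono μ ζ Θ inf_le_left)
        (hN₁.trans (hmin _ ⟨y, hy₁, hy₂⟩))
    exact ⟨N₁, hx₁, h1 ▸ (localRange_mono μ ζ Θ inf_le_right).trans hN₂⟩
  have hOuniv : O = Set.univ := by
    obtain ⟨y, hy⟩ := hN₀
    exact IsClopen.eq_univ ⟨hO', hO⟩ ⟨y, N₀, hy, le_rfl⟩
  obtain ⟨N₂, hN₂, hle⟩ : ∃ N₂ : Opens (G ⧸ Q), Set.univ ⊆ (N₂ : Set (G ⧸ Q)) ∧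
      localRange μ ζ Θ N₂ ≤ localRange μ ζ Θ N₀ := by
    refine isCompact_univ.induction_on (p := fun s => ∃ N₂ : Opens (G ⧸ Q),
      s ⊆ (N₂ : Set (G ⧸ Q)) ∧ localRange μ ζ Θ N₂ ≤ localRange μ ζ Θ N₀) ?_ ?_ ?_ ?_
    · exact ⟨⊥, Set.empty_subset _, by rw [localRange_bot]; exact bot_le⟩
    · exact fun s t hst ⟨N₂, ht, h⟩ => ⟨N₂, hst.trans ht, h⟩
    · rintro s t ⟨N₂, hs, h⟩ ⟨N₃, ht, h'⟩
      exact ⟨N₂ ⊔ N₃, Set.union_subset_union hs ht,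
        (localRange_sup_le μ ζ Θ N₂ N₃).trans (sup_le h h')⟩
    · intro x _
      obtain ⟨N₂, hx, h⟩ : x ∈ O := hOuniv ▸ Set.mem_univ x
      exact ⟨N₂, mem_nhdsWithin_of_mem_nhds (N₂.isOpen.mem_nhds hx), N₂, subset_rfl, h⟩
  have htop : localRange μ ζ Θ N₀ = ⊤ := by
    have h1 : N₂ = ⊤ := Opens.ext (Set.univ_subset_iff.1 hN₂)
    rw [h1, hsurj] at hle
    exact top_le_iff.1 hle
  refine Submodule.eq_top_of_finrank_eq (le_antisymm (Submodule.finrank_le _) ?_)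
  have h1 := hmin N hN
  rwa [htop, finrank_top] at h1

/-- The integral of densities is a non-zero functional on densities supported in any non-empty open
set. -/
theorem IsParabolic.exists_pairing_density_eq (hp : IsRealReductive p) (hQ : IsParabolic p Q)
    {N : Opens (G ⧸ Q)} (hN : (N : Set (G ⧸ Q)).Nonempty) (v : ℂ) :
    ∃ f : sqIntSections p μ (densityRep p Q), pairingLM μ (densityRep p Q)
      (ContinuousMap.const _ (ContinuousLinearMap.id ℂ ℂ)) (cutoff μ N f) = v := by
  -- the density on `G/Q` which is invariant under `K`
  obtain ⟨c, hc, hcK⟩ := hQ.exists_section hp (ζ := densityRep p Q) (φ := fun _ => (1 : ℂ))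
    fun k m hm => by
      rw [densityRep_inv_apply, hQ.abs_det_AdQuot_eq_one hp (m := ⟨m, hm⟩) m.2, one_smul]
  have hcc : Continuous c := hQ.continuous_section hp (hQ.continuous_densityRep hp) hc (by
    simp only [hcK]; fun_prop)
  let f : sqIntSections p μ (densityRep p Q) := ⟨c, mem_sqIntSections_of_continuous μ hc hcc⟩
  have hopen : IsOpen {k : maxCompact p | ((k : G) : G ⧸ Q) ∈ N} :=
    N.isOpen.preimage (QuotientGroup.continuous_mk.comp continuous_subtype_val)
  have h1 : pairingLM μ (densityRep p Q)
      (ContinuousMap.const _ (ContinuousLinearMap.id ℂ ℂ)) (cutoff μ N f) =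
      (μ.real {k : maxCompact p | ((k : G) : G ⧸ Q) ∈ N} : ℂ) := by
    change ∫ k : maxCompact p, (cutoff μ N f).1 k ∂μ = _
    have h2 : ∀ k : maxCompact p, (cutoff μ N f).1 k =
        Set.indicator {k : maxCompact p | ((k : G) : G ⧸ Q) ∈ N} (fun _ => (1 : ℂ)) k := by
      intro k
      by_cases hk : ((k : G) : G ⧸ Q) ∈ N
      · rw [cutoff_apply_of_mem μ f hk,
          Set.indicator_of_mem (s := {k : maxCompact p | ((k : G) : G ⧸ Q) ∈ N}) hk]
        exact hcK k
      · rw [cutoff_apply_of_notMem μ f hk,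
          Set.indicator_of_notMem (s := {k : maxCompact p | ((k : G) : G ⧸ Q) ∈ N}) hk]
    simp only [h2]
    rw [integral_indicator hopen.measurableSet, setIntegral_const, Complex.real_smul, mul_one]
  have hne : (μ.real {k : maxCompact p | ((k : G) : G ⧸ Q) ∈ N} : ℂ) ≠ 0 := by
    rw [Complex.ofReal_ne_zero]
    exact (ENNReal.toReal_pos (hQ.measure_mk_mem_pos μ hp hN).ne' (measure_ne_top μ _)).ne'
  refine ⟨(v / (μ.real {k : maxCompact p | ((k : G) : G ⧸ Q) ∈ N} : ℂ)) • f, ?_⟩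
  rw [map_smul, map_smul, h1, smul_eq_mul, div_mul_cancel₀ _ hne]

end Local

end RealFlag

end

theorem proposition5p2
    {n : ℕ} {G : Type*} [Group G] [TopologicalSpace G] [IsTopologicalGroup G] [T2Space G]
    (p : G →* GL (Fin n) ℝ) (hp : RealFlag.IsRealReductive p)
    (μ : Measure (RealFlag.maxCompact p)) [μ.IsHaarMeasure]
    (Q : Subgroup G) (hQ : RealFlag.IsParabolic p Q)
    (H : Subgroup G) (hH : IsClosed (H : Set G))
    (m : ℕ) (U : Fin m → Set (G ⧸ Q))
    (hU_open : ∀ i, IsOpen (U i)) (hU_nonempty : ∀ i, (U i).Nonempty)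
    (hU_disjoint : Pairwise fun i j => Disjoint (U i) (U j))
    (hU_inv : ∀ i, ∀ h ∈ H, ∀ x ∈ U i, h • x ∈ U i) :
    (∀ {V Wζ Wτ : Type*}
        [NormedAddCommGroup V] [NormedSpace ℂ V] [FiniteDimensional ℂ V]
        [NormedAddCommGroup Wζ] [InnerProductSpace ℂ Wζ] [FiniteDimensional ℂ Wζ]
        [NormedAddCommGroup Wτ] [NormedSpace ℂ Wτ] [FiniteDimensional ℂ Wτ]
        (σ : Representation ℂ G V) (ζ : Representation ℂ Q Wζ) (τ : Representation ℂ H Wτ),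
        ConnectedSpace (G ⧸ Q) →
        RealFlag.IsContinuousRep σ → RealFlag.IsContinuousRep ζ → RealFlag.IsContinuousRep τ →
        RealFlag.IsQuotientOfGKModule p ζ σ →
        ((m * Module.finrank ℂ (RealFlag.homH σ τ) : ℕ) : Cardinal) ≤
          Module.rank ℂ (RealFlag.homG p μ ζ τ)) ∧
    (m : Cardinal) ≤
      Module.rank ℂ (RealFlag.homG p μ (RealFlag.densityRep p Q)
        (Representation.trivial ℂ H ℂ)) := by
  have hK : CompactSpace (RealFlag.maxCompact p) :=
    isCompact_iff_compactSpace.1 hp.isCompact_maxCompact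
  let N : Fin m → TopologicalSpace.Opens (G ⧸ Q) := fun i => ⟨U i, hU_open i⟩
  have hN : Pairwise fun i j => Disjoint (N i) (N j) := fun i j hij =>
    TopologicalSpace.Opens.coe_disjoint.1 (hU_disjoint hij)
  refine ⟨?_, ?_⟩
  · intro V Wζ Wτ _ _ _ _ _ _ _ _ _ σ ζ τ _ hσ hζ _ h
    obtain ⟨Θ, hΘ, hsurj⟩ := hQ.exists_equivariant_pairing μ hp hζ hσ h
    have htop : RealFlag.localRange μ ζ Θ ⊤ = ⊤ := top_le_iff.1 fun v _ => by
      obtain ⟨f, hf, hfc, hfv⟩ := hsurj v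
      refine ⟨⟨f, RealFlag.mem_sqIntSections_of_continuous μ hf hfc⟩, ?_⟩
      rw [LinearMap.comp_apply, RealFlag.cutoff_top]
      exact hfv
    refine hQ.le_rank_homG μ hp hζ hΘ (N := N) hU_inv hN fun i v => ?_
    have h1 : v ∈ RealFlag.localRange μ ζ Θ (N i) := by
      rw [hQ.localRange_eq_top μ hp hζ hΘ htop (hU_nonempty i)]
      trivial
    exact h1
  · have h1 := hQ.le_rank_homG (σ := Representation.trivial ℂ G ℂ)
      (τ := Representation.trivial ℂ H ℂ) μ hp (hQ.continuous_densityRep hp) ?_ (N := N) hU_inv hN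
      fun i v => hQ.exists_pairing_density_eq μ hp (hU_nonempty i) v
    · have h2 : RealFlag.homH (Representation.trivial ℂ G ℂ) (Representation.trivial ℂ H ℂ) = ⊤ :=
        top_le_iff.1 fun A _ h v => rfl
      rwa [h2, finrank_top, Module.finrank_linearMap_self, Module.finrank_self, mul_one] at h1
    · intro f hf hfc g
      exact hQ.integral_density μ hp hf hfc g⁻¹
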